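/- **Setting.** Write $x\cdot y=x_0y_0-\sum_{k=1}^3x_ky_k=(x,\eta y)$ on $\mathbb R^4$, $p\,\theta\,q:=(p,\eta\theta\eta q)$, and $\tilde f(p)=(2\pi)^{-2}\int d^4x\,f(x)e^{-ip\cdot x}$ (and likewise, with $(2\pi)^{-2n}$, in $n$ variables). Let $\mathscr S_K=\mathscr S(\mathbb R^4)^{\oplus K}$, and let $\mathscr S_K^{(n)}$ be the Schwartz functions on $\mathbb R^{4n}$ with components indexed by $\{1,\dots,K\}^n$. *The undeformed theory.* Let $\mathcal H$ be a separable Hilbert space with a strongly continuous unitary representation $U$ of the translations $\mathbb R^4$ and a $U$-invariant unit vector $\Omega$. Let $\phi(f)$, $f\in\mathscr S_K$, be fields, linear in $f$, defined on a dense, $U$-invariant subspace $\mathcal D\ni\Omega$ that is stable under all $\phi(f)$, such that $f\mapsto\langle\Psi,\phi(f)\Psi'\rangle$ is a tempered distribution for $\Psi,\Psi'\in\mathcal D$, $U(y)\phi(f)U(y)^{-1}=\phi(f(\cdot-y))$ on $\mathcal D$, and $\phi(f)^*\supset\phi(f^*)$ with $f^*(x)_k=\overline{f(x)_{\bar k}}$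 for an involution $k\mapsto\bar k$ of $\{1,\dots,K\}$. Let $\Psi^n:\mathscr S_K^{(n)}\to\mathcal H$ be the continuous linear maps with $\Psi^n(f_1\otimes\cdots\otimes f_n)=\phi(f_1)\cdots\phi(f_n)\Omega$; the domain is $\mathcal D=\mathrm{span}\{\Psi^n(F):n\ge0,\,F\in\mathscr S_K^{(n)}\}$. Put $\omega_n(F)=\langle\Omega,\Psi^n(F)\rangle$, with distributional Fourier transform $\tilde\omega_n$, so that $\omega_n(F)=\sum_{\boldsymbol k}\int d^{4n}p\;\tilde\omega_n(-p)_{\boldsymbol k}\tilde F(p)_{\boldsymbol k}$. (Every Wightman theory is of this kind; Lorentz covariance, the spectrum condition and locality are not needed.) *Noncommutative Minkowski space.* Let $\kappa_e,\kappa_m\in\mathbb R$ be not both zero, and let $\Sigma\subset\mathbb R^{16}$ be the submanifold of real antisymmetric $4\times4$ matrices $\theta$ with $\theta_{\mu\nu}\theta^{\mu\nu}=2(\kappa_m^2-\kappa_e^2)$ and $\varepsilon_{\mu\nu\alpha\beta}\theta^{\mu\nu}\theta^{\alpha\beta}=-8\kappa_e\kappa_m$ ($\varepsilon_{0123}=1$),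 with its induced (four-dimensional Euclidean surface) measure $d\sigma$. It contains the matrix $\theta_1$ whose only non-zero entries are $(\theta_1)_{01}=-(\theta_1)_{10}=\kappa_e$ and $(\theta_1)_{23}=-(\theta_1)_{32}=\kappa_m$. Let $\theta\mapsto\Lambda_\theta$ be a Borel map, bounded on compact sets, from $\Sigma$ to the proper orthochronous Lorentz group with $\Lambda_\theta\theta_1\Lambda_\theta^T=\theta$. With $\hat x=(s_1,-i\kappa_e\partial_{s_1},s_2,-i\kappa_m\partial_{s_2})$, put $(X_\mu v)(s,\theta)=((\Lambda_\theta\hat x)_\mu v)(s,\theta)$ for functions $v$ on $\mathbb R^2\times\Sigma$, and let $e^{ip\cdot X}$ be the unitary generated by $p\cdot X$. *The deformed fields.* Let $\underline{\mathscr S}^\otimes$ be the space of terminating sequences $\boldsymbol g=(\boldsymbol g^0,\boldsymbol g^1,\dots)$, where $\boldsymbol g^n$ assigns to each $\theta\in\Sigma$ a Schwartz function $(s,x)\mapsto\boldsymbol g^n_{s,\theta}(x)$ of $(s,x)\in\mathbb R^2\times\mathbb R^{4n}$ with components indexed by $\{1,\dots,K\}^n$, depending on $\theta$ in a Borel measurable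 way, bounded in each Schwartz seminorm uniformly in $\theta$, and vanishing for $\theta$ outside a compact subset of $\Sigma$. Put $\Psi^\otimes(\boldsymbol g)(s,\theta)=\sum_n\Psi^n(\boldsymbol g^n_{s,\theta})$ and $\mathcal D^\otimes=\mathrm{span}\{\Psi^\otimes(\boldsymbol g):\boldsymbol g\in\underline{\mathscr S}^\otimes\}$. For $f\in\mathscr S_K$ define $f\times\boldsymbol g$ by $(f\times\boldsymbol g)^0=0$ and $$\widetilde{(f\times\boldsymbol g)^{n}_{s,\theta}}(p_1,\dots,p_n)_{k\boldsymbol l}=\tilde f(p_1)_k\,\widetilde{(e^{ip_1\cdot X}\boldsymbol g)^{n-1}_{s,\theta}}(p_2,\dots,p_n)_{\boldsymbol l}\qquad(n\ge1),$$ and define the Weyl–Wigner deformed field by $\phi^\otimes(f)\Psi^\otimes(\boldsymbol g)=\Psi^\otimes(f\times\boldsymbol g)$. **Proposition.** (a) For $f\in\mathscr S_K$ and $\boldsymbol g\in\underline{\mathscr S}^\otimes$ one has $\Psi^\otimes(\boldsymbol g)\in L^2(\mathbb R^2\times\Sigma\to\mathcal H)\cong L^2(\mathbb R^2\times\Sigma)\otimes\mathcal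 H$, and $f\times\boldsymbol g$ exists, uniquely, in $\underline{\mathscr S}^\otimes$. The span of the vectors $v\otimes\Psi^n(F)$ with $v\in C_0^\infty(\mathbb R^2\times\Sigma)$, $n\ge0$, $F\in\mathscr S_K^{(n)}$ is contained in $\mathcal D^\otimes$ and dense; in particular $\mathcal D^\otimes$ is dense. Each $\phi^\otimes(f)$ is a well-defined linear operator with domain $\mathcal D^\otimes$, and leaves $\mathcal D^\otimes$ invariant. (b) $\phi^\otimes(f)^*\supset\phi^\otimes(f^*)$ for all $f\in\mathscr S_K$. (c) For $v\in C_0^\infty(\mathbb R^2\times\Sigma)$, $n\ge0$ and $f_1,\dots,f_n\in\mathscr S_K$, $$\langle v\otimes\Omega,\ \phi^\otimes(f_1)\cdots\phi^\otimes(f_n)\,v\otimes\Omega\rangle=\sum_{\boldsymbol k}\int ds\,d\sigma(\theta)\int d^{4n}p\;\tilde\omega_n(-p)_{\boldsymbol k}\prod_{j=1}^n\tilde f_j(p_j)_{k_j}\prod_{l<r}e^{-\frac i2p_l\theta p_r}\,|v(s,\theta)|^2,$$ where the $p$-integral, summed over $\boldsymbol k$, denotes $\omega_n(F_\theta)$ for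 the $F_\theta\in\mathscr S_K^{(n)}$ with $\tilde F_\theta(p)_{\boldsymbol k}=\prod_j\tilde f_j(p_j)_{k_j}\prod_{l<r}e^{-\frac i2p_l\theta p_r}$, and the integral over $(s,\theta)$ converges absolutely. -/

import Mathlib

open MeasureTheory
open scoped SchwartzMap ContDiff InnerProductSpace

noncomputable section

namespace WeylWigner

/-! ### Minkowski space and multi-component test functions -/

/-- Four-dimensional Minkowski space, as a vector space (points and momenta). -/
abbrev Mink : Type := EuclideanSpace ℝ (Fin 4)

/-- The diagonal entries of the Minkowski metric `η = diag(1,-1,-1,-1)`. -/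
def eta (μ : Fin 4) : ℝ := if μ = 0 then 1 else -1

/-- The Minkowski inner product `x · y = x₀y₀ - x₁y₁ - x₂y₂ - x₃y₃`. -/
def mdot (x y : Mink) : ℝ := ∑ μ, eta μ * x μ * y μ

/-- `p θ q = (p, η θ η q)`. -/
def twist (θ : Matrix (Fin 4) (Fin 4) ℝ) (p q : Mink) : ℝ :=
  ∑ μ, ∑ ν, (eta μ * p μ) * θ μ ν * (eta ν * q ν)

/-- The space of `K`-component Schwartz functions of one spacetime variable. -/
abbrev Test (K : ℕ) : Type := 𝓢(Mink, Fin K → ℂ)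

/-- Schwartz functions of `n` spacetime variables, with components labelled by
multi-indices in `{1,…,K}ⁿ`. -/
abbrev TestN (K n : ℕ) : Type := 𝓢(Fin n → Mink, (Fin n → Fin K) → ℂ)

/-- The Fourier transform `f̃(p) = (2π)⁻² ∫ d⁴x f(x) e^{-ip·x}`, componentwise. -/
def fourier {K : ℕ} (f : Test K) (p : Mink) (k : Fin K) : ℂ :=
  (((2 * Real.pi) ^ 2)⁻¹ : ℝ) *
    ∫ x : Mink, f x k * Complex.exp (-Complex.I * (mdot p x : ℝ))

/-- The Fourier transform in all `n` variables, componentwise. -/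
def fourierN {K n : ℕ} (F : TestN K n) (p : Fin n → Mink) (k : Fin n → Fin K) : ℂ :=
  (((2 * Real.pi) ^ (2 * n))⁻¹ : ℝ) *
    ∫ x : Fin n → Mink, F x k * Complex.exp (-Complex.I * (∑ j, mdot (p j) (x j) : ℝ))

/-- `F = f₁ ⊗ ⋯ ⊗ fₙ`. -/
def IsTensor {K n : ℕ} (f : Fin n → Test K) (F : TestN K n) : Prop :=
  ∀ x k, F x k = ∏ j, f j (x j) (k j)

/-- The antilinear map `(c_k) ↦ (conj c_{bar k})` on components. -/
def conjComponents {K : ℕ} (bar : Fin K → Fin K) : (Fin K → ℂ) →L[ℝ] (Fin K → ℂ) :=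
  ContinuousLinearMap.pi fun k =>
    (Complex.conjCLE : ℂ →L[ℝ] ℂ).comp (ContinuousLinearMap.proj (bar k))

/-- `f*(x)_k = conj (f(x)_{bar k})`. -/
def starTest {K : ℕ} (bar : Fin K → Fin K) (f : Test K) : Test K :=
  SchwartzMap.postcompCLM (conjComponents bar) f

/-! ### The undeformed quantum field theory -/

/-- A theory of `K` quantum fields in the Wightman framework, with the properties that refer to
translations only: a strongly continuous unitary representation `U` of the translations with an
invariant unit vector `Ω`, and operator-valued tempered distributions `φ` on a dense, stable,
`U`-invariant domain `D ∋ Ω`, closed under taking adjoints and translation covariant. The domain is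
the one generated from the vacuum by the vector-valued tempered distributions `Ψⁿ`, where `Ψⁿ` is
the continuous linear map on the `n`-variable test functions with
`Ψⁿ(f₁ ⊗ ⋯ ⊗ fₙ) = φ(f₁) ⋯ φ(fₙ) Ω`. -/
structure Theory (K : ℕ) (H : Type*) [NormedAddCommGroup H] [InnerProductSpace ℂ H] where
  U : Mink → H ≃ₗᵢ[ℂ] H
  U_add : ∀ x y v, U (x + y) v = U x (U y v)
  U_continuous : ∀ v, Continuous fun x => U x v
  Ω : H
  norm_Ω : ‖Ω‖ = 1
  U_Ω : ∀ x, U x Ω = Ω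
  /-- The common domain of the fields. -/
  D : Submodule ℂ H
  D_dense : Dense (D : Set H)
  Ω_mem : Ω ∈ D
  U_mem : ∀ x, ∀ v ∈ D, U x v ∈ D
  /-- The fields, `φ(f) = ∑ₖ φₖ(fₖ)`. -/
  φ : Test K →ₗ[ℂ] (D →ₗ[ℂ] D)
  φ_tempered : ∀ v w : D, Continuous fun f => ⟪(v : H), (φ f w : H)⟫_ℂ
  φ_covariant : ∀ x f (v : D),
    U x (φ f v : H) = (φ (SchwartzMap.compSubConstCLM ℂ x f) ⟨U x v, U_mem x v v.2⟩ : H)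
  /-- The index of the adjoint field, `φₖ(f)* = φ_{bar k}(conj f)` on `D`. -/
  bar : Fin K → Fin K
  bar_bar : ∀ k, bar (bar k) = k
  φ_adjoint : ∀ f (v w : D), ⟪(v : H), (φ f w : H)⟫_ℂ = ⟪(φ (starTest bar f) v : H), (w : H)⟫_ℂ
  Ψ : ∀ n, TestN K n →L[ℂ] H
  Ψ_tensor : ∀ n (f : Fin n → Test K) (F : TestN K n), IsTensor f F →
    Ψ n F = ((List.ofFn f).foldr (fun g v => φ g v) ⟨Ω, Ω_mem⟩ : D)
  D_eq : D = Submodule.span ℂ {v | ∃ n F, v = Ψ n F}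

/-- The `n`-point functions `ωₙ(F) = ⟨Ω, Ψⁿ(F)⟩`. -/
def Theory.npoint {K : ℕ} {H : Type*} [NormedAddCommGroup H] [InnerProductSpace ℂ H]
    (T : Theory K H) (n : ℕ) (F : TestN K n) : ℂ := ⟪T.Ω, T.Ψ n F⟫_ℂ

/-! ### Noncommutative Minkowski space -/

/-- The space `ℝ¹⁶` of real `4 × 4` matrices with its Euclidean metric. -/
abbrev MatSpace : Type := EuclideanSpace ℝ (Fin 4 × Fin 4)

/-- A point of `ℝ¹⁶` as a matrix; its entries are the components `θ_{μν}` with lower indices. -/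
def toMat (θ : MatSpace) : Matrix (Fin 4) (Fin 4) ℝ := Matrix.of fun μ ν => θ (μ, ν)

/-- `θ^{μν}`: both indices raised with the Minkowski metric. -/
def raise (θ : Matrix (Fin 4) (Fin 4) ℝ) (μ ν : Fin 4) : ℝ := eta μ * θ μ ν * eta ν

/-- The reference matrix `θ₁`. -/
def thetaRef (κe κm : ℝ) : Matrix (Fin 4) (Fin 4) ℝ :=
  !![0, κe, 0, 0; -κe, 0, 0, 0; 0, 0, 0, κm; 0, 0, -κm, 0]

/-- The joint spectrum `Σ` of the commutators: antisymmetric matrices `θ` with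
`θ_{μν}θ^{μν} = 2(κm² - κe²)` and `ε_{μναβ}θ^{μν}θ^{αβ} = -8 κe κm`, where `ε_{0123} = 1`. -/
def Spec (κe κm : ℝ) : Set MatSpace :=
  {θ | (toMat θ).transpose = -toMat θ ∧
    ∑ μ, ∑ ν, toMat θ μ ν * raise (toMat θ) μ ν = 2 * (κm ^ 2 - κe ^ 2) ∧
    ∑ τ : Equiv.Perm (Fin 4), (Equiv.Perm.sign τ : ℝ) *
      (raise (toMat θ) (τ 0) (τ 1) * raise (toMat θ) (τ 2) (τ 3)) = -8 * κe * κm}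

/-- The proper orthochronous Lorentz transformations. -/
def IsLorentz (L : Matrix (Fin 4) (Fin 4) ℝ) : Prop :=
  L.transpose * Matrix.diagonal eta * L = Matrix.diagonal eta ∧ L.det = 1 ∧ 0 < L 0 0

/-- A choice `θ ↦ Λ_θ` of proper orthochronous Lorentz transformations with
`Λ_θ θ₁ Λ_θᵀ = θ`, Borel measurable and bounded on compact sets. -/
structure IsFrame (κe κm : ℝ) (Λ : Spec κe κm → Matrix (Fin 4) (Fin 4) ℝ) : Prop where
  lorentz : ∀ θ, IsLorentz (Λ θ)
  conj : ∀ θ, Λ θ * thetaRef κe κm * (Λ θ).transpose = toMat θ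
  measurable : ∀ μ ν, Measurable fun θ => Λ θ μ ν
  bounded : ∀ C : Set (Spec κe κm), IsCompact C → ∃ B, ∀ θ ∈ C, ∀ μ ν, |Λ θ μ ν| ≤ B

/-- The plane `ℝ²` of the variable `s = (s₁, s₂)`. -/
abbrev Plane : Type := EuclideanSpace ℝ (Fin 2)

/-- The measure `d²s × dσ(θ)` on `ℝ² × Σ`; here `dσ` is the measure of `Σ` as a four-dimensional
submanifold of `ℝ¹⁶`, i.e. its four-dimensional Euclidean Hausdorff measure. -/
def specMeasure (κe κm : ℝ) : Measure (Plane × Spec κe κm) :=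
  (volume : Measure Plane).prod (μHE[4] : Measure (Spec κe κm))

/-- The Schrödinger operators `x̂₀ = s₁`, `x̂₁ = -iκe ∂_{s₁}`, `x̂₂ = s₂`, `x̂₃ = -iκm ∂_{s₂}`. -/
def xhat (κe κm : ℝ) (μ : Fin 4) (w : Plane → ℂ) (s : Plane) : ℂ :=
  match μ with
  | 0 => s 0 * w s
  | 1 => -Complex.I * κe * fderiv ℝ w s (EuclideanSpace.single 0 1)
  | 2 => s 1 * w s
  | 3 => -Complex.I * κm * fderiv ℝ w s (EuclideanSpace.single 1 1)

/-- The coordinate operators `X_μ = (Λ_θ x̂)_μ` in the fibre over `θ`, with `L = Λ_θ`. -/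
def coord (κe κm : ℝ) (L : Matrix (Fin 4) (Fin 4) ℝ) (μ : Fin 4) (w : Plane → ℂ) (s : Plane) : ℂ :=
  ∑ ν, L μ ν * xhat κe κm ν w s

/-- `p · X` in the fibre over `θ`. -/
def dotCoord (κe κm : ℝ) (L : Matrix (Fin 4) (Fin 4) ℝ) (p : Mink) (w : Plane → ℂ) (s : Plane) :
    ℂ :=
  ∑ μ, (eta μ * p μ : ℝ) * coord κe κm L μ w s

/-- The coefficients `a = Λᵀ η p`, so that `p · X = ∑ᵥ aᵥ x̂ᵥ`. -/
def coeff (L : Matrix (Fin 4) (Fin 4) ℝ) (p : Mink) (ν : Fin 4) : ℝ := ∑ μ, eta μ * p μ * L μ ν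

/-- The translation of `s` that is implemented by `e^{ip·X}`. -/
def shift (κe κm : ℝ) (L : Matrix (Fin 4) (Fin 4) ℝ) (p : Mink) : Plane :=
  WithLp.toLp 2 ![κe * coeff L p 1, κm * coeff L p 3]

/-- The unitary `e^{ip·X}` in the fibre over `θ`: the one-parameter group generated by `i p·X`
(see `weyl_zero`, `weyl_add_smul` and `weyl_hasDerivAt`). -/
def weyl (κe κm : ℝ) (L : Matrix (Fin 4) (Fin 4) ℝ) (p : Mink) (w : Plane → ℂ) (s : Plane) : ℂ :=
  Complex.exp (Complex.I * ((coeff L p 0 * s 0 + coeff L p 2 * s 1 +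
      (κe * coeff L p 0 * coeff L p 1 + κm * coeff L p 2 * coeff L p 3) / 2 : ℝ) : ℂ)) *
    w (s + shift κe κm L p)

lemma coeff_smul (L : Matrix (Fin 4) (Fin 4) ℝ) (t : ℝ) (p : Mink) (ν : Fin 4) :
    coeff L (t • p) ν = t * coeff L p ν := by
  simp only [coeff, PiLp.smul_apply, smul_eq_mul, Finset.mul_sum]
  exact Finset.sum_congr rfl fun μ _ => by ring

lemma shift_smul (κe κm : ℝ) (L : Matrix (Fin 4) (Fin 4) ℝ) (t : ℝ) (p : Mink) :
    shift κe κm L (t • p) = t • shift κe κm L p := by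
  ext i
  fin_cases i <;> simp [shift, coeff_smul] <;> ring

lemma weyl_zero (κe κm : ℝ) (L : Matrix (Fin 4) (Fin 4) ℝ) (p : Mink) (w : Plane → ℂ) :
    weyl κe κm L ((0 : ℝ) • p) w = w := by
  funext s
  simp only [weyl, shift_smul, coeff_smul]
  simp

lemma weyl_add_smul (κe κm : ℝ) (L : Matrix (Fin 4) (Fin 4) ℝ) (p : Mink) (t r : ℝ)
    (w : Plane → ℂ) :
    weyl κe κm L ((t + r) • p) w = weyl κe κm L (t • p) (weyl κe κm L (r • p) w) := by
  funext s
  simp only [weyl, shift_smul, coeff_smul, ← mul_assoc, ← Complex.exp_add]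
  congr 2
  · simp [shift]
    ring
  · rw [add_smul, add_assoc]

lemma dotCoord_eq (κe κm : ℝ) (L : Matrix (Fin 4) (Fin 4) ℝ) (p : Mink) (w : Plane → ℂ)
    (s : Plane) :
    dotCoord κe κm L p w s = ∑ ν, (coeff L p ν : ℂ) * xhat κe κm ν w s := by
  simp only [dotCoord, coord, coeff, Fin.sum_univ_four]
  push_cast
  ring

/-- The derivative at `t = 0` of `e^{itp·X}` is `i p·X`. -/
lemma weyl_hasDerivAt (κe κm : ℝ) (L : Matrix (Fin 4) (Fin 4) ℝ) (p : Mink) (w : Plane → ℂ)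
    (s : Plane) (hw : DifferentiableAt ℝ w s) :
    HasDerivAt (fun t : ℝ => weyl κe κm L (t • p) w s)
      (Complex.I * dotCoord κe κm L p w s) 0 := by
  have h1 : HasDerivAt (fun t : ℝ => s + t • shift κe κm L p) (shift κe κm L p) 0 := by
    simpa using ((hasDerivAt_id (0 : ℝ)).smul_const (shift κe κm L p)).const_add s
  have h2 : HasDerivAt (fun t : ℝ => w (s + t • shift κe κm L p))
      (fderiv ℝ w s (shift κe κm L p)) 0 := by
    have : HasFDerivAt w (fderiv ℝ w s) (s + (0 : ℝ) • shift κe κm L p) := by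
      simpa using hw.hasFDerivAt
    exact this.comp_hasDerivAt (0 : ℝ) h1
  have h3 : HasDerivAt (fun t : ℝ => t * (coeff L p 0 * s 0 + coeff L p 2 * s 1) + t ^ 2 *
      ((κe * coeff L p 0 * coeff L p 1 + κm * coeff L p 2 * coeff L p 3) / 2))
      (coeff L p 0 * s 0 + coeff L p 2 * s 1) 0 := by
    have := ((hasDerivAt_id (0 : ℝ)).mul_const (coeff L p 0 * s 0 + coeff L p 2 * s 1)).add
      (((hasDerivAt_id (0 : ℝ)).pow 2).mul_const
        ((κe * coeff L p 0 * coeff L p 1 + κm * coeff L p 2 * coeff L p 3) / 2))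
    convert! this using 1
    simp
  have h4 := ((h3.ofReal_comp.const_mul Complex.I).cexp).mul h2
  have h5 : shift κe κm L p = (κe * coeff L p 1) • EuclideanSpace.single (0 : Fin 2) (1 : ℝ) +
      (κm * coeff L p 3) • EuclideanSpace.single (1 : Fin 2) (1 : ℝ) := by
    ext i
    fin_cases i <;> simp [shift]
  convert! h4 using 1
  · funext t
    simp only [weyl, shift_smul, coeff_smul, Pi.mul_apply]
    congr 4
    ring
  · rw [dotCoord_eq, h5, map_add, map_smul, map_smul]
    simp only [Fin.sum_univ_four, xhat]
    simp
    linear_combination (-(κe * coeff L p 1 * fderiv ℝ w s (EuclideanSpace.single 0 1) : ℂ) -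
      κm * coeff L p 3 * fderiv ℝ w s (EuclideanSpace.single 1 1)) * Complex.I_sq

/-! ### The enlarged test function space -/

/-- Sequences `𝐠 = (𝐠⁰, 𝐠¹, …)` of functions of `(s, θ)` and of the spacetime variables: the
`n`-th member is, for each `θ ∈ Σ`, a Schwartz function of `(s, x₁, …, xₙ)`. -/
abbrev BigTest (κe κm : ℝ) (K : ℕ) : Type :=
  ∀ n : ℕ, Spec κe κm → 𝓢(Plane × (Fin n → Mink), (Fin n → Fin K) → ℂ)

/-- The enlarged Borchers-Uhlmann space: terminating sequences whose members depend on `θ` in a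
Borel measurable way, boundedly with respect to each Schwartz seminorm, and with compact support
in `Σ`. -/
structure IsBigTest {κe κm : ℝ} {K : ℕ} (g : BigTest κe κm K) : Prop where
  terminating : ∃ N, ∀ n, N ≤ n → g n = 0
  measurable : ∀ n z, Measurable fun θ => g n θ z
  bounded : ∀ n a b : ℕ, ∃ B, ∀ θ, SchwartzMap.seminorm ℝ a b (g n θ) ≤ B
  support : ∀ n, ∃ C : Set (Spec κe κm), IsCompact C ∧ ∀ θ, θ ∉ C → g n θ = 0

lemma slice_temperate {n : ℕ} (s : Plane) :
    Function.HasTemperateGrowth fun x : Fin n → Mink => (s, x) := by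
  have h := (Function.HasTemperateGrowth.const ((s, 0) : Plane × (Fin n → Mink))).add
    (ContinuousLinearMap.inr ℝ Plane (Fin n → Mink)).hasTemperateGrowth
  convert! h using 1
  funext x
  simp

/-- The restriction `x ↦ G(s, x)` of a Schwartz function of `(s, x)`, at fixed `s`. -/
def slice {K n : ℕ} (s : Plane) :
    𝓢(Plane × (Fin n → Mink), (Fin n → Fin K) → ℂ) →L[ℂ] TestN K n :=
  SchwartzMap.compCLMOfAntilipschitz (g := fun x => (s, x)) (K := 1) ℂ (slice_temperate s)
    (fun x y => by simp [Prod.edist_eq])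

lemma slice_apply {K n : ℕ} (s : Plane) (G : 𝓢(Plane × (Fin n → Mink), (Fin n → Fin K) → ℂ))
    (x : Fin n → Mink) : slice s G x = G (s, x) := rfl

/-- `h = f × g`: in momentum space,
`(f × g)ⁿ⁺¹_{s,θ}(p₀, …, pₙ) = f̃(p₀) (e^{ip₀·X} g)ⁿ_{s,θ}(p₁, …, pₙ)`, and `(f × g)⁰ = 0`. -/
def IsAction {κe κm : ℝ} {K : ℕ} (Λ : Spec κe κm → Matrix (Fin 4) (Fin 4) ℝ)
    (f : Test K) (g h : BigTest κe κm K) : Prop :=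
  h 0 = 0 ∧ ∀ n θ s (p : Fin (n + 1) → Mink) (k : Fin (n + 1) → Fin K),
    fourierN (slice s (h (n + 1) θ)) p k = fourier f (p 0) (k 0) *
      weyl κe κm (Λ θ) (p 0) (fun s' => fourierN (slice s' (g n θ)) (Fin.tail p) (Fin.tail k)) s

/-- Smooth compactly supported functions on the closed submanifold `ℝ² × Σ` of `ℝ² × ℝ¹⁶`. -/
def IsSmoothCompact {κe κm : ℝ} (v : Plane × Spec κe κm → ℂ) : Prop :=
  ∃ V : Plane × MatSpace → ℂ, ContDiff ℝ ∞ V ∧ HasCompactSupport V ∧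
    ∀ s (θ : Spec κe κm), v (s, θ) = V (s, θ)

/-! ### The deformed fields -/

section Fields

variable {K : ℕ} {H : Type*} [NormedAddCommGroup H] [InnerProductSpace ℂ H]

/-- The Hilbert space `L²(ℝ² × Σ) ⊗ H ≅ L²(ℝ² × Σ → H)`. -/
abbrev BigHilbert (κe κm : ℝ) (H : Type*) [NormedAddCommGroup H] : Type _ :=
  Lp H 2 (specMeasure κe κm)

/-- `Ψ^⊗(𝐠)(s, θ) = ∑ₙ Ψⁿ(𝐠ⁿ_{s,θ})`. -/
def bigPsi {κe κm : ℝ} (T : Theory K H) (g : BigTest κe κm K) (z : Plane × Spec κe κm) : H :=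
  ∑ᶠ n, T.Ψ n (slice z.1 (g n z.2))

/-- The domain `D^⊗`, spanned by the vectors `Ψ^⊗(𝐠)`. -/
def bigDomain (κe κm : ℝ) (T : Theory K H) : Submodule ℂ (BigHilbert κe κm H) :=
  Submodule.span ℂ {ξ | ∃ g : BigTest κe κm K, IsBigTest g ∧
    ξ =ᵐ[specMeasure κe κm] bigPsi T g}

/-- The subspace spanned by the vectors `v ⊗ Ψⁿ(F)` with `v ∈ C₀^∞(ℝ² × Σ)`. -/
def smoothDomain (κe κm : ℝ) (T : Theory K H) : Submodule ℂ (BigHilbert κe κm H) :=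
  Submodule.span ℂ {ξ | ∃ v : Plane × Spec κe κm → ℂ, IsSmoothCompact v ∧
    ∃ (n : ℕ) (F : TestN K n), ξ =ᵐ[specMeasure κe κm] fun z => v z • T.Ψ n F}

/-- The linear relation spanned by the pairs `(Ψ^⊗(𝐠), Ψ^⊗(f × 𝐠))`. -/
def fieldGraph {κe κm : ℝ} (Λ : Spec κe κm → Matrix (Fin 4) (Fin 4) ℝ) (T : Theory K H)
    (f : Test K) : Submodule ℂ (BigHilbert κe κm H × BigHilbert κe κm H) :=
  Submodule.span ℂ {ξ | ∃ g h : BigTest κe κm K, IsBigTest g ∧ IsBigTest h ∧ IsAction Λ f g h ∧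
    ξ.1 =ᵐ[specMeasure κe κm] bigPsi T g ∧ ξ.2 =ᵐ[specMeasure κe κm] bigPsi T h}

/-- The Weyl-Wigner deformed field `φ^⊗(f) : Ψ^⊗(𝐠) ↦ Ψ^⊗(f × 𝐠)`, the operator whose graph is
the relation `fieldGraph` (it has this graph once the relation is single-valued). -/
def field {κe κm : ℝ} (Λ : Spec κe κm → Matrix (Fin 4) (Fin 4) ℝ) (T : Theory K H)
    (f : Test K) : BigHilbert κe κm H →ₗ.[ℂ] BigHilbert κe κm H :=
  (fieldGraph Λ T f).toLinearPMap

/-- `ζ = φ^⊗(f₁) ⋯ φ^⊗(fₙ) ξ`, including that each factor acts on a vector of its domain. -/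
def IsFieldProduct {κe κm : ℝ} (Λ : Spec κe κm → Matrix (Fin 4) (Fin 4) ℝ) (T : Theory K H) :
    List (Test K) → BigHilbert κe κm H → BigHilbert κe κm H → Prop
  | [], ξ, ζ => ζ = ξ
  | f :: fs, ξ, ζ => ∃ χ, IsFieldProduct Λ T fs ξ χ ∧
      ∃ hχ : χ ∈ (field Λ T f).domain, ζ = field Λ T f ⟨χ, hχ⟩

end Fields

/-- The test function `F` with
`F̃(p)_k = ∏ⱼ f̃ⱼ(pⱼ)_{kⱼ} ∏_{l<r} exp(-(i/2) p_l θ p_r)`. -/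
def IsTwistedProduct {K n : ℕ} (θ : Matrix (Fin 4) (Fin 4) ℝ) (f : Fin n → Test K)
    (F : TestN K n) : Prop :=
  ∀ p k, fourierN F p k = (∏ j, fourier (f j) (p j) (k j)) *
    ∏ l, ∏ r ∈ Finset.Ioi l, Complex.exp (-(Complex.I / 2) * (twist θ (p l) (p r) : ℝ))

end WeylWigner

end

open MeasureTheory
open scoped SchwartzMap ContDiff InnerProductSpace

noncomputable section

set_option linter.unusedSectionVars false

namespace WeylWigner

open scoped FourierTransform Topology BoundedContinuousFunction

/-! ### Functions of temperate growth -/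

section Temperate

variable {D E F : Type*} [NormedAddCommGroup D] [NormedSpace ℝ D] [NormedAddCommGroup E]
  [NormedSpace ℝ E] [NormedAddCommGroup F] [NormedSpace ℝ F]

/-! Three mechanisms carry the proof.

Analysis of `f × g`. In momentum space the operation multiplies by `f̃(p)`, translates `s` by a
vector depending polynomially on `(Λ_θ, p)`, and multiplies by a phase `exp(iQ)` with `Q` a real
polynomial in `(Λ_θ, p, s)`. Treat the matrix `Λ_θ` as one more variable `L` and cut off by a
Schwartz function `χ(L)` equal to one on the bounded set of matrices in use. The result is one
Schwartz function of `(L, p, s, y)`, depending linearly and continuously on `g` (`weylKernel`), and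
the fibre over `θ` is its slice at `L = Λ_θ`. Estimates uniform in `θ` follow from the fact that
slicing does not increase seminorms. Measurability in `θ` follows from the fact that pointwise
measurable families of Schwartz functions are weakly measurable (`stronglyMeasurable_clm_prod`).
Injectivity of the Fourier transform gives uniqueness. Square integrability of `Ψ^⊗(g)` needs decay
in `s`, compact support in `θ`, and local finiteness of the surface measure. The last holds because
`Σ` is the complex quadric `(E + iB)² = (κe + iκm)²`, on which two of the three components are local
coordinates with Lipschitz inverse (`isLocallyFiniteMeasure_spec`).

Adjoint and well-definedness. In one fibre, both sides of the adjoint relation are continuous in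
each of the two test functions, so it suffices to check products `u ⊗ G` (`pairing_action`, via
`clm_eq_zero_of_tensor`). There the deformed field reduces to the undeformed `φ`, smeared with the
function whose transform is `f̃(p) ⟨u', e^{ip·X} u⟩`. The relation is then `φ(f)* ⊃ φ(f*)` combined
with `(e^{ip·X})* = e^{-ip·X}`. Integration over `θ` gives the relation for the graphs. Since the
domain is dense, a vector zero can only be mapped to zero, so the field is well defined. Density
comes from the totality of the `Ψⁿ(F)` and the fundamental lemma of the calculus of variations.

Expectation values. By the Weyl relations, `n` fields applied to `v ⊗ Ω` produce the twist factors
times `(e^{iP·X} v)(s)`, where `P` is the total momentum. The `n`-point functions are translation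
invariant, hence see only `P = 0` (`Theory.npoint_eq_of_fourierN_eq`), where this factor is `v(s,
θ)`.

The interchange of continuous linear maps with parameter integrals (`clm_integrate`) and the
resulting mollification formula supply the density and measurability statements for tensor products.
-/

@[fun_prop]
lemma hasTemperateGrowth_prodMk {f : D → E} {g : D → F} (hf : f.HasTemperateGrowth)
    (hg : g.HasTemperateGrowth) : (fun x => (f x, g x)).HasTemperateGrowth := by
  have h1 := (ContinuousLinearMap.inl ℝ E F).hasTemperateGrowth.comp hf
  have h2 := (ContinuousLinearMap.inr ℝ E F).hasTemperateGrowth.comp hg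
  convert! h1.add h2 using 1
  funext x
  simp

@[fun_prop]
lemma hasTemperateGrowth_fst {f : D → E × F} (hf : f.HasTemperateGrowth) :
    (fun x => (f x).1).HasTemperateGrowth :=
  (ContinuousLinearMap.fst ℝ E F).hasTemperateGrowth.comp hf

@[fun_prop]
lemma hasTemperateGrowth_snd {f : D → E × F} (hf : f.HasTemperateGrowth) :
    (fun x => (f x).2).HasTemperateGrowth :=
  (ContinuousLinearMap.snd ℝ E F).hasTemperateGrowth.comp hf

lemma hasTemperateGrowth_pi {ι : Type*} [Fintype ι] {f : D → ι → E}
    (hf : ∀ i, (fun x => f x i).HasTemperateGrowth) : f.HasTemperateGrowth := by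
  classical
  have h := Function.HasTemperateGrowth.sum (s := Finset.univ)
    fun i _ => (ContinuousLinearMap.single ℝ (fun _ : ι => E) i).hasTemperateGrowth.comp (hf i)
  convert! h using 1
  funext x
  simp [Finset.univ_sum_single]

/-- Each derivative is a power of `I` times the function itself, hence of modulus one: growth
exponent zero and constant one serve for all orders. -/
lemma hasTemperateGrowth_cexp_I :
    (fun t : ℝ => Complex.exp (Complex.I * t)).HasTemperateGrowth := by
  have hd : ∀ n : ℕ, iteratedDeriv n (fun t : ℝ => Complex.exp (Complex.I * t)) =
      fun t : ℝ => Complex.I ^ n * Complex.exp (Complex.I * t) := by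
    intro n
    induction n with
    | zero => simp
    | succ n ih =>
      rw [iteratedDeriv_succ, ih]
      funext t
      have h1 : HasDerivAt (fun t : ℝ => Complex.I * (t : ℂ)) Complex.I t := by
        simpa using (Complex.ofRealCLM.hasDerivAt (x := t)).const_mul Complex.I
      have h2 := (h1.cexp).const_mul (Complex.I ^ n)
      rw [h2.deriv]
      ring
  refine ⟨(contDiff_const.mul Complex.ofRealCLM.contDiff).cexp, fun n => ⟨0, 1, fun t => ?_⟩⟩
  rw [norm_iteratedFDeriv_eq_norm_iteratedDeriv, hd]
  simp [Complex.norm_exp]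

@[fun_prop]
lemma hasTemperateGrowth_cexp_I_mul {f : D → ℝ} (hf : f.HasTemperateGrowth) :
    (fun x => Complex.exp (Complex.I * (f x : ℂ))).HasTemperateGrowth :=
  hasTemperateGrowth_cexp_I.comp hf

end Temperate

/-! ### Tensor products, slices -/

lemma norm_pow_le_add {X Y : Type*} [NormedAddCommGroup X] [NormedAddCommGroup Y] (z : X × Y)
    (k : ℕ) : ‖z‖ ^ k ≤ ‖z.1‖ ^ k + ‖z.2‖ ^ k := by
  rcases max_cases ‖z.1‖ ‖z.2‖ with h | h <;> rw [Prod.norm_def, h.1]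
  · exact le_add_of_nonneg_right (by positivity)
  · exact le_add_of_nonneg_left (by positivity)

section Tensor

variable {X Y A B V : Type*} [NormedAddCommGroup X] [NormedSpace ℝ X] [NormedAddCommGroup Y]
  [NormedSpace ℝ Y] [NormedAddCommGroup A] [NormedSpace ℂ A] [NormedAddCommGroup B]
  [NormedSpace ℂ B] [NormedAddCommGroup V] [NormedSpace ℂ V]

lemma norm_iteratedFDeriv_comp_fst_le (f : 𝓢(X, A)) (n : ℕ) (z : X × Y) :
    ‖iteratedFDeriv ℝ n (fun z : X × Y => f z.1) z‖ ≤ ‖iteratedFDeriv ℝ n f z.1‖ := by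
  have h := (ContinuousLinearMap.fst ℝ X Y).iteratedFDeriv_comp_right (f.smooth n) z
    (i := n) le_rfl
  change ‖iteratedFDeriv ℝ n (f ∘ ContinuousLinearMap.fst ℝ X Y) z‖ ≤ _
  rw [h]
  refine (ContinuousMultilinearMap.norm_compContinuousLinearMap_le _ _).trans ?_
  refine mul_le_of_le_one_right (norm_nonneg _) (Finset.prod_le_one (fun _ _ => norm_nonneg _) ?_)
  exact fun _ _ => ContinuousLinearMap.norm_fst_le ℝ X Y

lemma norm_iteratedFDeriv_comp_snd_le (f : 𝓢(Y, B)) (n : ℕ) (z : X × Y) :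
    ‖iteratedFDeriv ℝ n (fun z : X × Y => f z.2) z‖ ≤ ‖iteratedFDeriv ℝ n f z.2‖ := by
  have h := (ContinuousLinearMap.snd ℝ X Y).iteratedFDeriv_comp_right (f.smooth n) z
    (i := n) le_rfl
  change ‖iteratedFDeriv ℝ n (f ∘ ContinuousLinearMap.snd ℝ X Y) z‖ ≤ _
  rw [h]
  refine (ContinuousMultilinearMap.norm_compContinuousLinearMap_le _ _).trans ?_
  refine mul_le_of_le_one_right (norm_nonneg _) (Finset.prod_le_one (fun _ _ => norm_nonneg _) ?_)
  exact fun _ _ => ContinuousLinearMap.norm_snd_le ℝ X Y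

/-- The tensor product `(x, y) ↦ M (f x) (g y)` of two Schwartz functions. -/
def tensorCLM (M : A →L[ℂ] B →L[ℂ] V) (f : 𝓢(X, A)) : 𝓢(Y, B) →L[ℂ] 𝓢(X × Y, V) :=
  SchwartzMap.mkCLM (fun g z => M (f z.1) (g z.2)) (fun _ _ _ => by simp) (fun _ _ _ => by simp)
    (fun g => ((M.bilinearRestrictScalars ℝ).isBoundedBilinearMap.contDiff).comp
      (((f.smooth ⊤).comp contDiff_fst).prodMk ((g.smooth ⊤).comp contDiff_snd))) (by
    rintro ⟨k, n⟩
    -- Leibniz rule, with the weight `‖z‖ᵏ` bounded by a weight on `x` plus a weight on `y`. These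
    -- two terms account for the seminorms of `f` of weight `k` and of weight zero.
    refine ⟨Finset.Iic (k, n), ‖M‖ * ∑ i ∈ Finset.range (n + 1), (n.choose i : ℝ) *
      (SchwartzMap.seminorm ℂ k i f + SchwartzMap.seminorm ℂ 0 i f), by positivity, ?_⟩
    intro g z
    set S := (Finset.Iic (k, n)).sup (schwartzSeminormFamily ℂ Y B) g
    have hS : ∀ a b, a ≤ k → b ≤ n → SchwartzMap.seminorm ℂ a b g ≤ S := fun a b ha hb =>
      Seminorm.le_def.mp (Finset.le_sup (f := schwartzSeminormFamily ℂ Y B)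
        (show (a, b) ∈ Finset.Iic (k, n) by simp [ha, hb])) g
    have h1 := (M.bilinearRestrictScalars ℝ).norm_iteratedFDeriv_le_of_bilinear
      (f := fun z : X × Y => f z.1) (g := fun z : X × Y => g z.2) (n := n) (N := n)
      ((f.smooth n).comp contDiff_fst) ((g.smooth n).comp contDiff_snd) z le_rfl
    change ‖z‖ ^ k * ‖iteratedFDeriv ℝ n
      (fun z : X × Y => (M.bilinearRestrictScalars ℝ) (f z.1) (g z.2)) z‖ ≤ _
    refine (mul_le_mul_of_nonneg_left h1 (by positivity)).trans ?_
    rw [ContinuousLinearMap.norm_bilinearRestrictScalars, mul_left_comm, mul_assoc ‖M‖,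
      Finset.mul_sum, Finset.sum_mul]
    refine mul_le_mul_of_nonneg_left (Finset.sum_le_sum fun i hi => ?_) (by positivity)
    have hi' : i ≤ n := by simpa [Nat.lt_succ_iff] using hi
    calc ‖z‖ ^ k * (n.choose i * ‖iteratedFDeriv ℝ i (fun z : X × Y => f z.1) z‖ *
          ‖iteratedFDeriv ℝ (n - i) (fun z : X × Y => g z.2) z‖)
        ≤ (‖z.1‖ ^ k + ‖z.2‖ ^ k) * (n.choose i * ‖iteratedFDeriv ℝ i f z.1‖ *
          ‖iteratedFDeriv ℝ (n - i) g z.2‖) := by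
          gcongr
          · exact norm_pow_le_add z k
          · exact norm_iteratedFDeriv_comp_fst_le f i z
          · exact norm_iteratedFDeriv_comp_snd_le g _ z
      _ = n.choose i * ((‖z.1‖ ^ k * ‖iteratedFDeriv ℝ i f z.1‖) *
            ‖iteratedFDeriv ℝ (n - i) g z.2‖ + ‖iteratedFDeriv ℝ i f z.1‖ *
            (‖z.2‖ ^ k * ‖iteratedFDeriv ℝ (n - i) g z.2‖)) := by ring
      _ ≤ n.choose i * (SchwartzMap.seminorm ℂ k i f * S + SchwartzMap.seminorm ℂ 0 i f * S) := by
          gcongr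
          · exact SchwartzMap.le_seminorm ℂ k i f z.1
          · exact (SchwartzMap.norm_iteratedFDeriv_le_seminorm ℂ g _ _).trans
              (hS _ _ (Nat.zero_le _) (Nat.sub_le _ _))
          · exact SchwartzMap.norm_iteratedFDeriv_le_seminorm ℂ f _ _
          · exact (SchwartzMap.le_seminorm ℂ k (n - i) g z.2).trans (hS _ _ le_rfl (Nat.sub_le _ _))
      _ = _ := by ring)

@[simp]
lemma tensorCLM_apply (M : A →L[ℂ] B →L[ℂ] V) (f : 𝓢(X, A)) (g : 𝓢(Y, B)) (z : X × Y) :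
    tensorCLM M f g z = M (f z.1) (g z.2) := rfl

lemma temperate_mk_left (x : X) : Function.HasTemperateGrowth fun y : Y => (x, y) := by fun_prop

/-- The restriction `y ↦ G(x, y)` at fixed `x`. -/
def sliceCLM (x : X) : 𝓢(X × Y, V) →L[ℂ] 𝓢(Y, V) :=
  SchwartzMap.compCLMOfAntilipschitz (g := fun y => (x, y)) (K := 1) ℂ (temperate_mk_left x)
    (fun y y' => by simp [Prod.edist_eq])

@[simp]
lemma sliceCLM_apply (x : X) (G : 𝓢(X × Y, V)) (y : Y) : sliceCLM x G y = G (x, y) := rfl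

/-- Exchanging the two groups of variables. -/
def swapCLM : 𝓢(X × Y, V) →L[ℂ] 𝓢(Y × X, V) :=
  SchwartzMap.compCLMOfContinuousLinearEquiv ℂ (ContinuousLinearEquiv.prodComm ℝ Y X)

@[simp]
lemma swapCLM_apply (G : 𝓢(X × Y, V)) (z : Y × X) : swapCLM G z = G (z.2, z.1) := rfl

lemma iteratedFDeriv_slice (G : 𝓢(X × Y, V)) (n : ℕ) (x : X) (y : Y) :
    iteratedFDeriv ℝ n (fun y => G (x, y)) y =
      (iteratedFDeriv ℝ n G (x, y)).compContinuousLinearMap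
        fun _ => ContinuousLinearMap.inr ℝ X Y := by
  have h : (fun y => G (x, y)) =
      (fun w => G ((x, (0 : Y)) + w)) ∘ ContinuousLinearMap.inr ℝ X Y := by
    funext y
    simp
  have hs : ContDiff ℝ n fun w => G ((x, (0 : Y)) + w) :=
    (G.smooth n).comp (contDiff_const.add contDiff_id)
  rw [h, (ContinuousLinearMap.inr ℝ X Y).iteratedFDeriv_comp_right hs y le_rfl,
    iteratedFDeriv_comp_add_left]
  simp

lemma norm_compContinuousLinearMap_inr_le {n : ℕ}
    (L : ContinuousMultilinearMap ℝ (fun _ : Fin n => X × Y) V) :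
    ‖L.compContinuousLinearMap fun _ => ContinuousLinearMap.inr ℝ X Y‖ ≤ ‖L‖ := by
  refine (ContinuousMultilinearMap.norm_compContinuousLinearMap_le _ _).trans ?_
  refine mul_le_of_le_one_right (norm_nonneg _) (Finset.prod_le_one (fun _ _ => norm_nonneg _) ?_)
  exact fun _ _ => ContinuousLinearMap.norm_inr_le_one ℝ X Y

/-- Both `‖x‖` and `‖y‖` are at most `‖(x, y)‖`, so a weight in the parameter is absorbed by the
weight of `G`. Slices therefore decay rapidly in the parameter, in every seminorm. -/
lemma pow_mul_seminorm_slice_le (G : 𝓢(X × Y, V)) (m a b : ℕ) (x : X) :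
    ‖x‖ ^ m * SchwartzMap.seminorm ℂ a b (sliceCLM x G) ≤ SchwartzMap.seminorm ℂ (m + a) b G := by
  rcases eq_or_ne (‖x‖ ^ m) 0 with h0 | h0
  · rw [h0, zero_mul]
    exact apply_nonneg _ _
  have hpos : 0 < ‖x‖ ^ m := lt_of_le_of_ne (by positivity) h0.symm
  rw [mul_comm, ← le_div_iff₀ hpos]
  refine SchwartzMap.seminorm_le_bound ℂ a b _ (by positivity) fun y => ?_
  rw [le_div_iff₀ hpos]
  change ‖y‖ ^ a * ‖iteratedFDeriv ℝ b (fun y => G (x, y)) y‖ * ‖x‖ ^ m ≤ _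
  rw [iteratedFDeriv_slice]
  refine le_trans ?_ (SchwartzMap.le_seminorm ℂ (m + a) b G (x, y))
  calc _ ≤ ‖(x, y)‖ ^ a * ‖iteratedFDeriv ℝ b G (x, y)‖ * ‖(x, y)‖ ^ m := by
        gcongr
        · exact norm_snd_le (x, y)
        · exact norm_compContinuousLinearMap_inr_le _
        · exact norm_fst_le (x, y)
    _ = _ := by ring

lemma seminorm_slice_le (G : 𝓢(X × Y, V)) (a b : ℕ) (x : X) :
    SchwartzMap.seminorm ℂ a b (sliceCLM x G) ≤ SchwartzMap.seminorm ℂ a b G := by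
  simpa using pow_mul_seminorm_slice_le G 0 a b x

/-- Mean value inequality in the parameter: one more derivative of `G` provides the Lipschitz
constant. This makes slices continuous in the Schwartz topology. -/
lemma seminorm_slice_sub_le (G : 𝓢(X × Y, V)) (a b : ℕ) (x x' : X) :
    SchwartzMap.seminorm ℂ a b (sliceCLM x G - sliceCLM x' G) ≤
      SchwartzMap.seminorm ℂ a (b + 1) G * ‖x - x'‖ := by
  refine SchwartzMap.seminorm_le_bound ℂ a b _ (by positivity) fun y => ?_
  have h1 : iteratedFDeriv ℝ b (⇑(sliceCLM x G - sliceCLM x' G)) y =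
      (iteratedFDeriv ℝ b G (x, y) - iteratedFDeriv ℝ b G (x', y)).compContinuousLinearMap
        fun _ => ContinuousLinearMap.inr ℝ X Y := by
    have : ⇑(sliceCLM x G - sliceCLM x' G) = (fun y => G (x, y)) - fun y => G (x', y) := by
      ext; simp
    rw [this, iteratedFDeriv_sub_apply, iteratedFDeriv_slice, iteratedFDeriv_slice]
    · ext; simp
    · exact ((sliceCLM x G).smooth b).contDiffAt
    · exact ((sliceCLM x' G).smooth b).contDiffAt
  rw [h1]
  refine (mul_le_mul_of_nonneg_left (norm_compContinuousLinearMap_inr_le _)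
    (by positivity)).trans ?_
  have hdiff : Differentiable ℝ (iteratedFDeriv ℝ b G) :=
    (G.smooth ⊤).differentiable_iteratedFDeriv (by exact_mod_cast WithTop.coe_lt_top _)
  -- The weight `‖y‖ᵃ` is constant in `w`. Keeping it inside the function makes the derivative bound
  -- exactly a seminorm of `G`.
  have key := Convex.norm_image_sub_le_of_norm_hasFDerivWithin_le (𝕜 := ℝ) (s := Set.univ)
    (f := fun w : X => (‖y‖ ^ a) • iteratedFDeriv ℝ b G (w, y))
    (f' := fun w : X => (‖y‖ ^ a) • (fderiv ℝ (iteratedFDeriv ℝ b G) (w, y)).comp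
      (ContinuousLinearMap.inl ℝ X Y))
    (C := SchwartzMap.seminorm ℂ a (b + 1) G) (x := x') (y := x) ?_ ?_ convex_univ
    (Set.mem_univ _) (Set.mem_univ _)
  · rw [← smul_sub, norm_smul, Real.norm_of_nonneg (by positivity)] at key
    exact key
  · intro w _
    have h2 : HasFDerivAt (fun w : X => (w, y)) (ContinuousLinearMap.inl ℝ X Y) w :=
      hasFDerivAt_prodMk_left w y
    exact (((hdiff (w, y)).hasFDerivAt.comp w h2).const_smul (‖y‖ ^ a)).hasFDerivWithinAt
  · intro w _
    rw [norm_smul, Real.norm_of_nonneg (by positivity)]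
    refine le_trans ?_ (SchwartzMap.le_seminorm ℂ a (b + 1) G (w, y))
    gcongr
    · exact norm_snd_le (w, y)
    · refine (ContinuousLinearMap.opNorm_comp_le _ _).trans ?_
      rw [← norm_fderiv_iteratedFDeriv]
      exact mul_le_of_le_one_right (norm_nonneg _) (ContinuousLinearMap.norm_inl_le_one ℝ X Y)

lemma continuous_slice (G : 𝓢(X × Y, V)) : Continuous fun x : X => sliceCLM x G := by
  rw [continuous_iff_continuousAt]
  intro x
  refine ((schwartz_withSeminorms ℂ Y V).tendsto_nhds _ _).2 ?_
  rintro ⟨a, b⟩ ε hε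
  have h : Filter.Tendsto (fun x' => SchwartzMap.seminorm ℂ a (b + 1) G * ‖x' - x‖) (nhds x)
      (nhds 0) := by
    have : Continuous fun x' => SchwartzMap.seminorm ℂ a (b + 1) G * ‖x' - x‖ := by fun_prop
    simpa using this.tendsto x
  filter_upwards [h.eventually (gt_mem_nhds hε)] with x' hx'
  exact (seminorm_slice_sub_le G a b x' x).trans_lt hx'

/-- A continuous linear map carries bounded families of Schwartz functions to bounded families. -/
lemma bounded_family_map {ι : Type*} (T : 𝓢(X, A) →L[ℂ] 𝓢(Y, B)) (g : ι → 𝓢(X, A))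
    (hg : ∀ a b : ℕ, ∃ C, ∀ i, SchwartzMap.seminorm ℂ a b (g i) ≤ C) (a b : ℕ) :
    ∃ C, ∀ i, SchwartzMap.seminorm ℂ a b (T (g i)) ≤ C := by
  obtain ⟨s, C, -, hC⟩ := Seminorm.bound_of_continuous (schwartz_withSeminorms ℂ X A)
    ((schwartzSeminormFamily ℂ Y B (a, b)).comp T.toLinearMap)
    (by exact ((schwartz_withSeminorms ℂ Y B).continuous_seminorm (a, b)).comp T.continuous)
  choose K hK using hg
  refine ⟨C * ∑ q ∈ s, |K q.1 q.2|, fun i => (hC (g i)).trans ?_⟩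
  change (C : ℝ) * (s.sup (schwartzSeminormFamily ℂ X A)) (g i) ≤ _
  gcongr
  refine Seminorm.finset_sup_apply_le (Finset.sum_nonneg fun _ _ => abs_nonneg _) fun q hq => ?_
  refine ((hK q.1 q.2 i).trans (le_abs_self _)).trans ?_
  exact Finset.single_le_sum (f := fun q : ℕ × ℕ => |K q.1 q.2|) (fun _ _ => abs_nonneg _) hq

end Tensor

/-! ### The partial Fourier transform -/

section PartialFourier

/-- Precomposition with a fixed real-linear map. -/
def precompL {V X X' : Type} [NormedAddCommGroup V] [NormedSpace ℂ V] [NormedAddCommGroup X]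
    [NormedSpace ℝ X] [NormedAddCommGroup X'] [NormedSpace ℝ X'] (A : X' →L[ℝ] X) :
    (X →L[ℝ] V) →L[ℂ] (X' →L[ℝ] V) :=
  LinearMap.mkContinuous
    { toFun := fun T => T.comp A
      map_add' := fun _ _ => by ext; simp
      map_smul' := fun _ _ => by ext; simp } ‖A‖ fun T => by
    rw [mul_comm]
    exact ContinuousLinearMap.opNorm_comp_le T A

variable {Y E : Type} [NormedAddCommGroup Y] [NormedSpace ℝ Y]
  [NormedAddCommGroup E] [InnerProductSpace ℝ E]

/-- The inner product of the second components, as a bilinear form. -/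
def innerSnd : (Y × E) →L[ℝ] (Y × E) →L[ℝ] ℝ :=
  (innerSL ℝ).bilinearComp (ContinuousLinearMap.snd ℝ Y E) (ContinuousLinearMap.snd ℝ Y E)

/-- The Schwartz function whose partial Fourier transform is the derivative of the partial
Fourier transform of `G`. -/
def derivPartial {V : Type} [NormedAddCommGroup V] [NormedSpace ℂ V] :
    𝓢(Y × E, V) →L[ℂ] 𝓢(Y × E, (Y × E) →L[ℝ] V) :=
  -- The first term is the derivative in the frequency, which brings down `-2πi⟨e, ·⟩`. The second
  -- differentiates in the parameter directions only, whence the projection to the first factor.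
  (-(2 * Real.pi * Complex.I)) • SchwartzMap.smulRightCLM ℂ V innerSnd +
    (SchwartzMap.postcompCLM (precompL ((ContinuousLinearMap.inl ℝ Y E).comp
      (ContinuousLinearMap.fst ℝ Y E)))).comp (SchwartzMap.fderivCLM ℂ (Y × E) V)

variable [FiniteDimensional ℝ E] [MeasurableSpace E]
  [BorelSpace E]

/-- The partial Fourier transform in the second variable. -/
def partialFourier {V : Type} [NormedAddCommGroup V] [NormedSpace ℂ V] (G : 𝓢(Y × E, V))
    (z : Y × E) : V := 𝓕 (fun e => G (z.1, e)) z.2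

lemma partialFourier_eq {V : Type} [NormedAddCommGroup V] [NormedSpace ℂ V] (G : 𝓢(Y × E, V))
    (z : Y × E) : partialFourier G z = 𝓕 (sliceCLM z.1 G) z.2 := rfl

/-- A single integrable majorant valid for all parameters at once, as required for differentiation
under the integral. -/
lemma exists_integrable_bound {V : Type} [NormedAddCommGroup V] [NormedSpace ℂ V]
    (G : 𝓢(Y × E, V)) : ∃ b : E → ℝ, Integrable b ∧ ∀ y e, ‖G (y, e)‖ ≤ b e := by
  set l := (volume : Measure E).integrablePower
  refine ⟨fun e => (2 ^ l * ((Finset.Iic (l, 0)).sup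
    (schwartzSeminormFamily ℂ (Y × E) V)) G) * (1 + ‖e‖) ^ (-(l : ℝ)),
    (Measure.integrable_pow_neg_integrablePower volume).const_mul _, fun y e => ?_⟩
  have h := SchwartzMap.one_add_le_sup_seminorm_apply (𝕜 := ℂ) (m := (l, 0)) le_rfl le_rfl G (y, e)
  rw [norm_iteratedFDeriv_zero] at h
  have hpos : (0 : ℝ) < 1 + ‖e‖ := by positivity
  beta_reduce
  rw [Real.rpow_neg hpos.le, Real.rpow_natCast, ← div_eq_mul_inv, le_div_iff₀ (by positivity),
    mul_comm]
  refine le_trans ?_ h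
  gcongr
  exact norm_snd_le (y, e)

lemma hasFDerivAt_partialFourier {V : Type} [NormedAddCommGroup V] [NormedSpace ℂ V]
    (G : 𝓢(Y × E, V)) (z : Y × E) :
    HasFDerivAt (partialFourier G) (partialFourier (V := (Y × E) →L[ℝ] V) (derivPartial G) z) z := by
  obtain ⟨b, hb, hbG⟩ := exists_integrable_bound (V := (Y × E) →L[ℝ] V) (derivPartial G)
  have hcont : ∀ {W : Type} [NormedAddCommGroup W] [NormedSpace ℂ W] (G : 𝓢(Y × E, W)) (z : Y × E),
      Continuous fun e => Real.fourierChar (-⟪e, z.2⟫_ℝ) • G (z.1, e) := by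
    intro W _ _ G z
    have : Continuous fun e => G (z.1, e) := G.continuous.comp (by fun_prop)
    exact (Real.continuous_fourierChar.comp (by fun_prop)).smul this
  have key := hasFDerivAt_integral_of_dominated_of_fderiv_le (𝕜 := ℝ) (μ := (volume : Measure E))
    (F := fun z e => Real.fourierChar (-⟪e, z.2⟫_ℝ) • G (z.1, e))
    (F' := fun z e => Real.fourierChar (-⟪e, z.2⟫_ℝ) • derivPartial G (z.1, e))
    (x₀ := z) (s := Set.univ) (bound := b) Filter.univ_mem
    (Filter.Eventually.of_forall fun z => (hcont G z).aestronglyMeasurable)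
    ((Real.fourierIntegral_convergent_iff z.2).2 (sliceCLM z.1 G).integrable)
    (hcont _ z).aestronglyMeasurable
    (Filter.Eventually.of_forall fun e z _ => by
      rw [Circle.smul_def, norm_smul, Circle.norm_coe, one_mul]
      exact hbG _ _) hb
    (Filter.Eventually.of_forall fun e z _ => by
      have h1 : HasFDerivAt (fun z : Y × E => (Real.fourierChar (-⟪e, z.2⟫_ℝ) : ℂ))
          (((-2 * Real.pi * Complex.I * Real.fourierChar (-⟪e, z.2⟫_ℝ)) •
            (Complex.ofRealCLM ∘L (innerSL ℝ e))).comp (ContinuousLinearMap.snd ℝ Y E)) z := by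
        have := Real.hasFDerivAt_fourierChar_neg_bilinear_right (innerSL ℝ) e z.2
        exact HasFDerivAt.comp (f := fun z : Y × E => z.2) z this hasFDerivAt_snd
      have h2 : HasFDerivAt (fun z : Y × E => G (z.1, e)) ((fderiv ℝ G (z.1, e)).comp
          ((ContinuousLinearMap.inl ℝ Y E).comp (ContinuousLinearMap.fst ℝ Y E))) z := by
        have h3 : HasFDerivAt (fun z : Y × E => (z.1, e)) ((ContinuousLinearMap.inl ℝ Y E).comp
            (ContinuousLinearMap.fst ℝ Y E)) z :=
          HasFDerivAt.comp (f := fun z : Y × E => z.1) (g := fun y : Y => (y, e)) z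
            (hasFDerivAt_prodMk_left z.1 e) hasFDerivAt_fst
        exact (G.hasFDerivAt (z.1, e)).comp z h3
      have h4 := h1.smul h2
      convert! h4 using 1
      refine ContinuousLinearMap.ext fun w => ?_
      change (Real.fourierChar (-⟪e, z.2⟫_ℝ) : ℂ) • ((-(2 * Real.pi * Complex.I)) •
        (⟪e, w.2⟫_ℝ • G (z.1, e)) + fderiv ℝ G (z.1, e) (w.1, 0)) =
        (Real.fourierChar (-⟪e, z.2⟫_ℝ) : ℂ) • fderiv ℝ G (z.1, e) (w.1, 0) +
        ((-2 * Real.pi * Complex.I * Real.fourierChar (-⟪e, z.2⟫_ℝ)) * (⟪e, w.2⟫_ℝ : ℂ)) •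
          G (z.1, e)
      rw [smul_add, add_comm, ← Complex.coe_smul ⟪e, w.2⟫_ℝ, smul_smul, smul_smul]
      congr 2
      ring)
  exact key

/-- The derivative is again a partial Fourier transform, with values in a larger space. The
induction over the order therefore has to quantify over `V`. -/
lemma contDiff_partialFourier (n : ℕ) : ∀ {V : Type} [NormedAddCommGroup V] [NormedSpace ℂ V]
    (G : 𝓢(Y × E, V)), ContDiff ℝ n (partialFourier G) := by
  induction n with
  | zero =>
    intro V _ _ G
    exact contDiff_zero.2 (continuous_iff_continuousAt.2 fun z =>
      (hasFDerivAt_partialFourier G z).continuousAt)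
  | succ n ih =>
    intro V _ _ G
    exact contDiff_succ_iff_hasFDerivAt.2 ⟨_, ih (V := (Y × E) →L[ℝ] V) (derivPartial G), hasFDerivAt_partialFourier G⟩

lemma exists_bound_comp {X X' V V' : Type} [NormedAddCommGroup V] [NormedSpace ℂ V]
    [NormedAddCommGroup V'] [NormedSpace ℂ V'] [NormedAddCommGroup X] [NormedSpace ℝ X]
    [NormedAddCommGroup X'] [NormedSpace ℝ X'] (T : 𝓢(X, V) →L[ℂ] 𝓢(X', V'))
    (s : Finset (ℕ × ℕ)) : ∃ (s' : Finset (ℕ × ℕ)) (C : ℝ), 0 ≤ C ∧ ∀ G : 𝓢(X, V),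
      s.sup (schwartzSeminormFamily ℂ X' V') (T G) ≤
        C * s'.sup (schwartzSeminormFamily ℂ X V) G := by
  obtain ⟨s', C, -, hC⟩ := Seminorm.bound_of_continuous (schwartz_withSeminorms ℂ X V)
    ((s.sup (schwartzSeminormFamily ℂ X' V')).comp T.toLinearMap)
    (by
      have : Continuous ⇑(s.sup (schwartzSeminormFamily ℂ X' V')) :=
        (schwartz_withSeminorms ℂ X' V').finset_sups.continuous_seminorm s
      exact this.comp T.continuous)
  exact ⟨s', C, C.2, fun G => hC G⟩

lemma pow_mul_sup_seminorm_slice_le {X V : Type} [NormedAddCommGroup V] [NormedSpace ℂ V]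
    [NormedAddCommGroup X] [NormedSpace ℝ X] (G : 𝓢(Y × X, V)) (k : ℕ)
    (s : Finset (ℕ × ℕ)) (y : Y) :
    ‖y‖ ^ k * s.sup (schwartzSeminormFamily ℂ X V) (sliceCLM y G) ≤
      (s.image fun q => (k + q.1, q.2)).sup (schwartzSeminormFamily ℂ (Y × X) V) G := by
  rcases eq_or_ne (‖y‖ ^ k) 0 with h0 | h0
  · rw [h0, zero_mul]
    exact apply_nonneg _ _
  have hpos : 0 < ‖y‖ ^ k := lt_of_le_of_ne (by positivity) h0.symm
  rw [mul_comm, ← le_div_iff₀ hpos]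
  refine Seminorm.finset_sup_apply_le (by positivity) fun q hq => ?_
  rw [le_div_iff₀ hpos, mul_comm]
  refine (pow_mul_seminorm_slice_le G k q.1 q.2 y).trans ?_
  exact Seminorm.le_def.mp (Finset.le_sup (f := schwartzSeminormFamily ℂ (Y × X) V)
    (Finset.mem_image_of_mem (fun q : ℕ × ℕ => (k + q.1, q.2)) hq)) G

lemma partialFourier_bound (n : ℕ) : ∀ {V : Type} [NormedAddCommGroup V] [NormedSpace ℂ V] (k : ℕ),
    ∃ (s : Finset (ℕ × ℕ)) (C : ℝ), 0 ≤ C ∧ ∀ (G : 𝓢(Y × E, V)) (z : Y × E),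
      ‖z‖ ^ k * ‖iteratedFDeriv ℝ n (partialFourier G) z‖ ≤
        C * s.sup (schwartzSeminormFamily ℂ (Y × E) V) G := by
  induction n with
  | zero =>
    intro V _ _ k
    obtain ⟨s₁, C₁, hC₁, h₁⟩ := exists_bound_comp
      (SchwartzMap.fourierTransformCLM ℂ : 𝓢(E, V) →L[ℂ] 𝓢(E, V)) {(k, 0), (0, 0)}
    -- The first set handles the weight on the parameter, which raises the weight of `G` by `k`. The
    -- second handles the weight on the frequency, already controlled by continuity of the Fourier
    -- transform of each slice.
    refine ⟨(s₁.image fun q => (k + q.1, q.2)) ∪ s₁.image fun q => (0 + q.1, q.2), C₁ + C₁,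
      by positivity, fun G z => ?_⟩
    rw [norm_iteratedFDeriv_zero]
    have h2 : ∀ a ∈ ({(k, 0), (0, 0)} : Finset (ℕ × ℕ)),
        SchwartzMap.seminorm ℂ a.1 a.2 (𝓕 (sliceCLM z.1 G)) ≤
        C₁ * s₁.sup (schwartzSeminormFamily ℂ E V) (sliceCLM z.1 G) := fun a ha =>
      (Seminorm.le_def.mp (Finset.le_sup (f := schwartzSeminormFamily ℂ E V) ha) _).trans
        (h₁ (sliceCLM z.1 G))
    have hx : ‖z.2‖ ^ k * ‖partialFourier G z‖ ≤
        C₁ * s₁.sup (schwartzSeminormFamily ℂ E V) (sliceCLM z.1 G) := by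
      rw [partialFourier_eq]
      exact (SchwartzMap.norm_pow_mul_le_seminorm ℂ (𝓕 (sliceCLM z.1 G)) k z.2).trans
        (h2 (k, 0) (by simp))
    have hy : ‖partialFourier G z‖ ≤
        C₁ * s₁.sup (schwartzSeminormFamily ℂ E V) (sliceCLM z.1 G) := by
      rw [partialFourier_eq]
      exact (SchwartzMap.norm_le_seminorm ℂ (𝓕 (sliceCLM z.1 G)) z.2).trans
        (h2 (0, 0) (by simp))
    have e1 := pow_mul_sup_seminorm_slice_le G k s₁ z.1
    have e2 := pow_mul_sup_seminorm_slice_le G 0 s₁ z.1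
    rw [pow_zero, one_mul] at e2
    have m1 := Seminorm.le_def.mp (Finset.sup_mono (f := schwartzSeminormFamily ℂ (Y × E) V)
      (Finset.subset_union_left (s₁ := s₁.image fun q => (k + q.1, q.2))
        (s₂ := s₁.image fun q => (0 + q.1, q.2)))) G
    have m2 := Seminorm.le_def.mp (Finset.sup_mono (f := schwartzSeminormFamily ℂ (Y × E) V)
      (Finset.subset_union_right (s₁ := s₁.image fun q => (k + q.1, q.2))
        (s₂ := s₁.image fun q => (0 + q.1, q.2)))) G
    calc ‖z‖ ^ k * ‖partialFourier G z‖
        ≤ (‖z.1‖ ^ k + ‖z.2‖ ^ k) * ‖partialFourier G z‖ := by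
          gcongr
          exact norm_pow_le_add z k
      _ = ‖z.1‖ ^ k * ‖partialFourier G z‖ + ‖z.2‖ ^ k * ‖partialFourier G z‖ := by ring
      _ ≤ ‖z.1‖ ^ k * (C₁ * s₁.sup (schwartzSeminormFamily ℂ E V) (sliceCLM z.1 G)) +
          C₁ * s₁.sup (schwartzSeminormFamily ℂ E V) (sliceCLM z.1 G) := by gcongr
      _ = C₁ * (‖z.1‖ ^ k * s₁.sup (schwartzSeminormFamily ℂ E V) (sliceCLM z.1 G)) +
          C₁ * s₁.sup (schwartzSeminormFamily ℂ E V) (sliceCLM z.1 G) := by ring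
      _ ≤ _ := by
          rw [add_mul]
          gcongr
          · exact e1.trans m1
          · exact e2.trans m2
  | succ n ih =>
    intro V _ _ k
    obtain ⟨s, C, hC, h⟩ := ih (V := (Y × E) →L[ℝ] V) k
    obtain ⟨s', C', hC', h'⟩ := exists_bound_comp (V' := (Y × E) →L[ℝ] V)
      (derivPartial (Y := Y) (E := E) (V := V)) s
    refine ⟨s', C * C', by positivity, fun G z => ?_⟩
    have hf : fderiv ℝ (partialFourier G) = partialFourier (V := (Y × E) →L[ℝ] V) (derivPartial G) :=
      funext fun z => (hasFDerivAt_partialFourier G z).fderiv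
    rw [← norm_iteratedFDeriv_fderiv, hf, mul_assoc]
    exact (h _ z).trans (mul_le_mul_of_nonneg_left (h' G) hC)

variable {V : Type} [NormedAddCommGroup V] [NormedSpace ℂ V]

/-- The partial Fourier transform in the second variable, on Schwartz functions. -/
def partialFourierCLM : 𝓢(Y × E, V) →L[ℂ] 𝓢(Y × E, V) :=
  SchwartzMap.mkCLM partialFourier
    (fun f g z => by
      rw [partialFourier_eq, map_add, FourierTransform.fourier_add]
      rfl)
    (fun c f z => by
      rw [partialFourier_eq, map_smul, FourierTransform.fourier_smul]
      rfl)
    (fun G => contDiff_infty.2 fun n => contDiff_partialFourier n G)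
    (fun n => partialFourier_bound n.2 n.1)

lemma partialFourierCLM_apply (G : 𝓢(Y × E, V)) (y : Y) (x : E) :
    partialFourierCLM G (y, x) = 𝓕 (fun e => G (y, e)) x := rfl

/-- Integration over the first variable. -/
def integrateCLM : 𝓢(E × Y, V) →L[ℂ] 𝓢(Y, V) :=
  -- An integral is a Fourier transform at frequency zero, so continuity is inherited from
  -- `partialFourierCLM`.
  (sliceCLM (0 : E)).comp (swapCLM.comp (partialFourierCLM.comp swapCLM))

@[simp]
lemma integrateCLM_apply (q : 𝓢(E × Y, V)) (y : Y) : integrateCLM q y = ∫ e, q (e, y) := by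
  simp only [integrateCLM, ContinuousLinearMap.comp_apply, sliceCLM_apply, swapCLM_apply,
    partialFourierCLM_apply, Real.fourier_eq]
  simp

end PartialFourier

/-! ### Continuous linear maps commute with integrals of Schwartz functions -/

section WeightedDerivatives

variable {Y V : Type} [NormedAddCommGroup Y] [NormedSpace ℝ Y] [NormedAddCommGroup V]
  [NormedSpace ℂ V]

/-- The space of values of the `n`-th derivative. -/
def Jet (Y V : Type) [NormedAddCommGroup Y] [NormedSpace ℝ Y] [NormedAddCommGroup V]
    [NormedSpace ℂ V] (n : ℕ) : Type := ContinuousMultilinearMap ℝ (fun _ : Fin n => Y) V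

instance (n : ℕ) : NormedAddCommGroup (Jet Y V n) :=
  inferInstanceAs (NormedAddCommGroup (ContinuousMultilinearMap ℝ (fun _ : Fin n => Y) V))

instance (n : ℕ) : NormedSpace ℝ (Jet Y V n) :=
  inferInstanceAs (NormedSpace ℝ (ContinuousMultilinearMap ℝ (fun _ : Fin n => Y) V))

instance [CompleteSpace V] (n : ℕ) : CompleteSpace (Jet Y V n) :=
  inferInstanceAs (CompleteSpace (ContinuousMultilinearMap ℝ (fun _ : Fin n => Y) V))

/-- The `n`-th derivative of a Schwartz function. -/
def jet (n : ℕ) (F : 𝓢(Y, V)) (y : Y) : Jet Y V n := iteratedFDeriv ℝ n F y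

lemma continuous_jet (n : ℕ) (F : 𝓢(Y, V)) : Continuous (jet n F) :=
  (F.smooth n).continuous_iteratedFDeriv le_rfl

lemma pow_mul_norm_jet_le (k n : ℕ) (F : 𝓢(Y, V)) (y : Y) :
    ‖y‖ ^ k * ‖jet n F y‖ ≤ SchwartzMap.seminorm ℂ k n F :=
  SchwartzMap.le_seminorm ℂ k n F y

/-- The bounded continuous function `y ↦ ‖y‖ᵏ Dⁿ F(y)`. -/
def weightedDeriv (k n : ℕ) (F : 𝓢(Y, V)) : Y →ᵇ Jet Y V n :=
  BoundedContinuousFunction.ofNormedAddCommGroup (fun y => ‖y‖ ^ k • jet n F y)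
    ((continuous_norm.pow k).smul (continuous_jet n F))
    (SchwartzMap.seminorm ℂ k n F) fun y => by
      rw [norm_smul, norm_pow, norm_norm]
      exact pow_mul_norm_jet_le k n F y

lemma weightedDeriv_apply (k n : ℕ) (F : 𝓢(Y, V)) (y : Y) :
    weightedDeriv k n F y = ‖y‖ ^ k • jet n F y := rfl

lemma norm_weightedDeriv (k n : ℕ) (F : 𝓢(Y, V)) :
    ‖weightedDeriv k n F‖ = SchwartzMap.seminorm ℂ k n F := by
  refine le_antisymm (BoundedContinuousFunction.norm_ofNormedAddCommGroup_le _ (apply_nonneg _ _) _)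
    (SchwartzMap.seminorm_le_bound ℂ k n F (norm_nonneg _) fun y => ?_)
  refine le_trans (le_of_eq ?_) ((weightedDeriv k n F).norm_coe_le_norm y)
  rw [weightedDeriv_apply, norm_smul, norm_pow, norm_norm]
  rfl

/-- `weightedDeriv` as a linear map, for finitely many pairs of orders at once. -/
def weightedDerivs (s : Finset (ℕ × ℕ)) : 𝓢(Y, V) →ₗ[ℝ]
    ((q : s) → Y →ᵇ Jet Y V q.1.2) where
  toFun F q := weightedDeriv q.1.1 q.1.2 F
  map_add' F G := by
    funext q
    ext1 y
    simp only [weightedDeriv_apply, Pi.add_apply, BoundedContinuousFunction.coe_add]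
    rw [← smul_add]
    congr 1
    exact iteratedFDeriv_add_apply (F.smooth _).contDiffAt (G.smooth _).contDiffAt
  map_smul' c F := by
    funext q
    ext1 y
    simp only [weightedDeriv_apply, Pi.smul_apply, BoundedContinuousFunction.coe_smul,
      RingHom.id_apply]
    rw [smul_comm]
    congr 1
    exact iteratedFDeriv_const_smul_apply (F.smooth _).contDiffAt

/-- Realizes finitely many seminorms as the norm of a space of bounded continuous functions, so that
Bochner integrals in normed spaces can replace integration in the Schwartz space. -/
lemma sup_seminorm_eq_norm (s : Finset (ℕ × ℕ)) (F : 𝓢(Y, V)) :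
    s.sup (schwartzSeminormFamily ℂ Y V) F = ‖weightedDerivs s F‖ := by
  refine le_antisymm (Seminorm.finset_sup_apply_le (norm_nonneg _) fun q hq => ?_)
    ((pi_norm_le_iff_of_nonneg (apply_nonneg _ _)).2 fun q => ?_)
  · rw [SchwartzMap.schwartzSeminormFamily_apply, ← norm_weightedDeriv]
    exact norm_le_pi_norm (weightedDerivs s F) ⟨q, hq⟩
  · change ‖weightedDeriv q.1.1 q.1.2 F‖ ≤ _
    rw [norm_weightedDeriv]
    exact Seminorm.le_def.mp (Finset.le_sup (f := schwartzSeminormFamily ℂ Y V) q.2) F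

lemma continuous_weightedDerivs (s : Finset (ℕ × ℕ)) :
    Continuous (weightedDerivs s : 𝓢(Y, V) →ₗ[ℝ] _) := by
  have hs := (schwartz_withSeminorms ℂ Y V).finset_sups.continuous_seminorm s
  refine continuous_of_continuousAt_zero (weightedDerivs s).toAddMonoidHom ?_
  change ContinuousAt (weightedDerivs s) 0
  rw [ContinuousAt, map_zero, tendsto_zero_iff_norm_tendsto_zero]
  have := hs.tendsto 0
  rw [map_zero] at this
  exact this.congr fun F => sup_seminorm_eq_norm s F

end WeightedDerivatives

/-! ### Integrals of Schwartz functions over a parameter -/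

section Integration

variable {Y E : Type} [NormedAddCommGroup Y] [NormedSpace ℝ Y]
  [NormedAddCommGroup E] [InnerProductSpace ℝ E]

/-- The derivative in the direction of the second factor. -/
def derivSnd {V : Type} [NormedAddCommGroup V] [NormedSpace ℂ V] :
    𝓢(E × Y, V) →L[ℂ] 𝓢(E × Y, Y →L[ℝ] V) :=
  (SchwartzMap.postcompCLM (precompL (ContinuousLinearMap.inr ℝ E Y))).comp
    (SchwartzMap.fderivCLM ℂ (E × Y) V)

lemma hasFDerivAt_slice {V : Type} [NormedAddCommGroup V] [NormedSpace ℂ V]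
    (q : 𝓢(E × Y, V)) (e : E) (y : Y) :
    HasFDerivAt (fun y => q (e, y)) (derivSnd q (e, y)) y :=
  (q.hasFDerivAt (e, y)).comp y (hasFDerivAt_prodMk_right e y)

variable [FiniteDimensional ℝ E] [MeasurableSpace E]
  [BorelSpace E]

lemma exists_integrable_bound_fst {V : Type} [NormedAddCommGroup V] [NormedSpace ℂ V]
    (G : 𝓢(E × Y, V)) : ∃ b : E → ℝ, Integrable b ∧ ∀ e y, ‖G (e, y)‖ ≤ b e := by
  obtain ⟨b, hb, h⟩ := exists_integrable_bound (swapCLM G)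
  exact ⟨b, hb, fun e y => h y e⟩

lemma integrable_section {V : Type} [NormedAddCommGroup V] [NormedSpace ℂ V]
    (q : 𝓢(E × Y, V)) (y : Y) : Integrable fun e => q (e, y) :=
  (sliceCLM y (swapCLM q)).integrable

lemma hasFDerivAt_integral_slice {V : Type} [NormedAddCommGroup V] [NormedSpace ℂ V]
    (q : 𝓢(E × Y, V)) (y : Y) :
    HasFDerivAt (fun y => ∫ e, q (e, y)) (∫ e, derivSnd q (e, y)) y := by
  obtain ⟨b, hb, hbG⟩ := exists_integrable_bound_fst (V := Y →L[ℝ] V) (derivSnd q)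
  have hcont : ∀ {W : Type} [NormedAddCommGroup W] [NormedSpace ℂ W] (G : 𝓢(E × Y, W)) (y : Y),
      Continuous fun e => G (e, y) := fun G y => G.continuous.comp (by fun_prop)
  exact hasFDerivAt_integral_of_dominated_of_fderiv_le (𝕜 := ℝ) (μ := (volume : Measure E))
    (F := fun y e => q (e, y)) (F' := fun y e => derivSnd q (e, y)) (s := Set.univ) (bound := b)
    Filter.univ_mem (Filter.Eventually.of_forall fun y => (hcont q y).aestronglyMeasurable)
    (integrable_section q y)
    (hcont (W := Y →L[ℝ] V) (derivSnd q) y).aestronglyMeasurable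
    (Filter.Eventually.of_forall fun e y _ => hbG e y) hb
    (Filter.Eventually.of_forall fun e y _ => hasFDerivAt_slice q e y)

lemma iteratedFDeriv_integral_slice (n : ℕ) : ∀ {V : Type} [NormedAddCommGroup V]
    [NormedSpace ℂ V] [CompleteSpace V] (q : 𝓢(E × Y, V)) (y : Y),
    iteratedFDeriv ℝ n (fun y => ∫ e, q (e, y)) y =
      ∫ e, iteratedFDeriv ℝ n (fun y => q (e, y)) y := by
  induction n with
  | zero =>
    intro V _ _ _ q y
    simp only [iteratedFDeriv_zero_eq_comp, Function.comp_apply]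
    exact ((ContinuousLinearEquiv.integral_comp_comm (μ := (volume : Measure E))
      (continuousMultilinearCurryFin0 ℝ Y V).symm.toContinuousLinearEquiv fun e => q (e, y))).symm
  | succ n ih =>
    intro V _ _ _ q y
    have h1 : fderiv ℝ (fun y => ∫ e, q (e, y)) = fun y => ∫ e, derivSnd q (e, y) :=
      funext fun y => (hasFDerivAt_integral_slice q y).fderiv
    have h2 : ∀ e, fderiv ℝ (fun y => q (e, y)) = fun y => derivSnd q (e, y) :=
      fun e => funext fun y => (hasFDerivAt_slice q e y).fderiv
    simp only [iteratedFDeriv_succ_eq_comp_right, Function.comp_apply, h1, h2]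
    rw [ih (V := Y →L[ℝ] V) (derivSnd q) y]
    exact (ContinuousLinearEquiv.integral_comp_comm (μ := (volume : Measure E)) (𝕜 := ℝ)
      (E := ContinuousMultilinearMap ℝ (fun _ : Fin n => Y) (Y →L[ℝ] V))
      (F := ContinuousMultilinearMap ℝ (fun _ : Fin (n + 1) => Y) V)
      (continuousMultilinearCurryRightEquiv' ℝ n Y V).symm.toContinuousLinearEquiv _).symm

variable {V : Type} [NormedAddCommGroup V] [NormedSpace ℂ V]
  {H : Type*} [NormedAddCommGroup H] [NormedSpace ℂ H]

lemma exists_bound_clm (W : 𝓢(Y, V) →L[ℂ] H) : ∃ (s : Finset (ℕ × ℕ)) (C : ℝ), 0 ≤ C ∧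
    ∀ F, ‖W F‖ ≤ C * s.sup (schwartzSeminormFamily ℂ Y V) F := by
  obtain ⟨s, C, -, h⟩ := Seminorm.bound_of_continuous (schwartz_withSeminorms ℂ Y V)
    ((normSeminorm ℂ H).comp W.toLinearMap) (continuous_norm.comp W.continuous)
  exact ⟨s, C, C.2, h⟩

lemma integrable_sup_seminorm_slice (q : 𝓢(E × Y, V)) (s : Finset (ℕ × ℕ)) :
    Integrable fun e => s.sup (schwartzSeminormFamily ℂ Y V) (sliceCLM e q) := by
  have hc : Continuous fun e => s.sup (schwartzSeminormFamily ℂ Y V) (sliceCLM e q) :=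
    ((schwartz_withSeminorms ℂ Y V).finset_sups.continuous_seminorm s).comp (continuous_slice q)
  have := integrable_of_le_of_pow_mul_le (μ := (volume : Measure E)) (k := 0)
    (f := fun e => s.sup (schwartzSeminormFamily ℂ Y V) (sliceCLM e q))
    (C₁ := (s.image fun p => (0 + p.1, p.2)).sup (schwartzSeminormFamily ℂ (E × Y) V) q)
    (C₂ := (s.image fun p => (0 + (volume : Measure E).integrablePower + p.1, p.2)).sup
      (schwartzSeminormFamily ℂ (E × Y) V) q) (fun e => by
        rw [Real.norm_of_nonneg (apply_nonneg _ _)]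
        simpa using pow_mul_sup_seminorm_slice_le q 0 s e) (fun e => by
        rw [Real.norm_of_nonneg (apply_nonneg _ _)]
        exact pow_mul_sup_seminorm_slice_le q _ s e) hc.aestronglyMeasurable
  refine this.congr (Filter.Eventually.of_forall fun e => ?_)
  simp only [pow_zero, one_mul]
  exact Real.norm_of_nonneg (apply_nonneg _ _)

lemma integrable_clm_slice (W : 𝓢(Y, V) →L[ℂ] H) (q : 𝓢(E × Y, V)) :
    Integrable fun e => W (sliceCLM e q) := by
  obtain ⟨s, C, -, h⟩ := exists_bound_clm W
  refine ((integrable_sup_seminorm_slice q s).const_mul C).mono'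
    (W.continuous.comp (continuous_slice q)).aestronglyMeasurable
    (Filter.Eventually.of_forall fun e => h _)

/-- A continuous linear map on Schwartz functions commutes with the integration over a
parameter. -/
theorem clm_integrate [CompleteSpace V] [CompleteSpace H] (W : 𝓢(Y, V) →L[ℂ] H) (q : 𝓢(E × Y, V)) :
    W (integrateCLM q) = ∫ e, W (sliceCLM e q) := by
  obtain ⟨s, C, hC, h⟩ := exists_bound_clm W
  -- `J` records the seminorms that dominate `W`, and `S` consists of the pairs `(J F, W F)`. On
  -- `S`, and hence on its closure, the second entry is controlled by the first.
  let J := (weightedDerivs s : 𝓢(Y, V) →ₗ[ℝ] _)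
  let S := LinearMap.range (J.prod (W.toLinearMap.restrictScalars ℝ))
  have hJint : Integrable fun e => J (sliceCLM e q) :=
    (integrable_sup_seminorm_slice q s).mono'
      ((continuous_weightedDerivs s).comp (continuous_slice q)).aestronglyMeasurable
      (Filter.Eventually.of_forall fun e => (sup_seminorm_eq_norm s _).ge)
  have hWint := integrable_clm_slice W q
  have hpair : Integrable fun e => (J (sliceCLM e q), W (sliceCLM e q)) := hJint.prodMk hWint
  have hJ : ∫ e, J (sliceCLM e q) = J (integrateCLM q) := by
    funext p
    ext1 y
    let ev : ((q : s) → Y →ᵇ Jet Y V q.1.2) →L[ℝ]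
        Jet Y V p.1.2 :=
      (BoundedContinuousFunction.evalCLM ℝ y).comp (ContinuousLinearMap.proj p)
    have h1 := ev.integral_comp_comm hJint
    change ev (∫ e, J (sliceCLM e q)) = _
    rw [← h1]
    change ∫ e, ‖y‖ ^ p.1.1 • jet p.1.2 (sliceCLM e q) y =
      ‖y‖ ^ p.1.1 • jet p.1.2 (integrateCLM q) y
    rw [integral_smul]
    congr 1
    refine (iteratedFDeriv_integral_slice p.1.2 q y).symm.trans ?_
    rw [jet]
    congr 1
    funext y
    exact (integrateCLM_apply q y).symm
  -- The integral of an `S`-valued function lies in the closure of `S`, since the quotient map by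
  -- that closure commutes with the integral and kills the integrand.
  have hmem : (∫ e, (J (sliceCLM e q), W (sliceCLM e q))) ∈ S.topologicalClosure := by
    have hcl := S.isClosed_topologicalClosure
    have h1 := S.topologicalClosure.mkQL.integral_comp_comm hpair
    rw [← Submodule.Quotient.mk_eq_zero]
    change S.topologicalClosure.mkQL (∫ e, (J (sliceCLM e q), W (sliceCLM e q))) = 0
    rw [← h1]
    refine integral_eq_zero_of_ae (Filter.Eventually.of_forall fun e => ?_)
    exact (Submodule.Quotient.mk_eq_zero _).2 (S.le_topologicalClosure ⟨sliceCLM e q, rfl⟩)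
  rw [integral_pair hJint hWint, hJ] at hmem
  have hmem' : (J (integrateCLM q), W (integrateCLM q)) ∈ S.topologicalClosure :=
    S.le_topologicalClosure ⟨integrateCLM q, rfl⟩
  have hdiff := S.topologicalClosure.sub_mem hmem' hmem
  have hbound : ∀ p ∈ S.topologicalClosure, ‖p.2‖ ≤ C * ‖p.1‖ := by
    have hclosed : IsClosed {p : ((q : s) → Y →ᵇ Jet Y V q.1.2) × H | ‖p.2‖ ≤ C * ‖p.1‖} :=
      isClosed_le (continuous_norm.comp continuous_snd)
        (continuous_const.mul (continuous_norm.comp continuous_fst))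
    have hsub : (S : Set (((q : s) → Y →ᵇ Jet Y V q.1.2) × H)) ⊆ {p | ‖p.2‖ ≤ C * ‖p.1‖} := by
      rintro _ ⟨F, rfl⟩
      change ‖W F‖ ≤ C * ‖weightedDerivs s F‖
      rw [← sup_seminorm_eq_norm]
      exact h F
    exact fun p hp => closure_minimal hsub hclosed hp
  -- The two pairs have the same first entry, so the bound forces their second entries to agree.
  have h3 := hbound _ hdiff
  simp only [Prod.mk_sub_mk, sub_self, norm_zero, mul_zero, norm_le_zero_iff] at h3
  exact sub_eq_zero.1 h3

end Integration

/-! ### Mollification, and density of tensor products -/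

section Mollify

/-- The product of a scalar Schwartz function and a Schwartz function of other variables. -/
abbrev smulTensor {X Y V : Type} [NormedAddCommGroup X] [NormedSpace ℝ X] [NormedAddCommGroup Y]
    [NormedSpace ℝ Y] [NormedAddCommGroup V] [NormedSpace ℂ V] (f : 𝓢(X, ℂ)) :
    𝓢(Y, V) →L[ℂ] 𝓢(X × Y, V) := tensorCLM (ContinuousLinearMap.lsmul ℂ ℂ) f

lemma exists_schwartz_eq_one (X : Type) [NormedAddCommGroup X] [InnerProductSpace ℝ X]
    [FiniteDimensional ℝ X] (R : ℝ) : ∃ χ : 𝓢(X, ℂ), ∀ x, ‖x‖ ≤ R → χ x = 1 := by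
  let f : ContDiffBump (0 : X) := ⟨|R| + 1, |R| + 2, by positivity, by linarith⟩
  have h1 : HasCompactSupport fun x => (f x : ℂ) := f.hasCompactSupport.comp_left Complex.ofReal_zero
  have h2 : ContDiff ℝ ∞ fun x => (f x : ℂ) := Complex.ofRealCLM.contDiff.comp f.contDiff
  refine ⟨h1.toSchwartzMap h2, fun x hx => ?_⟩
  change (f x : ℂ) = 1
  rw [f.one_of_mem_closedBall, Complex.ofReal_one]
  rw [mem_closedBall_zero_iff]
  change ‖x‖ ≤ |R| + 1
  linarith [le_abs_self R]

variable {E : Type} [NormedAddCommGroup E] [InnerProductSpace ℝ E] [FiniteDimensional ℝ E]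
  [MeasurableSpace E] [BorelSpace E]

lemma exists_schwartz_integral_eq_one (E : Type) [NormedAddCommGroup E] [InnerProductSpace ℝ E]
    [FiniteDimensional ℝ E] [MeasurableSpace E] [BorelSpace E] :
    ∃ ρ : 𝓢(E, ℂ), ∫ x, ρ x = 1 := by
  let f : ContDiffBump (0 : E) := ⟨1, 2, one_pos, one_lt_two⟩
  have h1 : HasCompactSupport fun x => (f.normed volume x : ℂ) :=
    f.hasCompactSupport_normed.comp_left Complex.ofReal_zero
  have h2 : ContDiff ℝ ∞ fun x => (f.normed volume x : ℂ) :=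
    Complex.ofRealCLM.contDiff.comp f.contDiff_normed
  refine ⟨h1.toSchwartzMap h2, ?_⟩
  change ∫ x, (f.normed volume x : ℂ) = 1
  rw [integral_complex_ofReal, f.integral_normed, Complex.ofReal_one]

/-- A Schwartz function of integral one. -/
def mollifier (E : Type) [NormedAddCommGroup E] [InnerProductSpace ℝ E]
    [FiniteDimensional ℝ E] [MeasurableSpace E] [BorelSpace E] : 𝓢(E, ℂ) :=
  (exists_schwartz_integral_eq_one E).choose

lemma integral_mollifier : ∫ x, mollifier E x = 1 := (exists_schwartz_integral_eq_one E).choose_spec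

lemma dilation_upper {ε : ℝ} (hε : ε ≠ 0) (u : E) :
    ∃ (k : ℕ) (C : ℝ), ∀ x : E, ‖x‖ ≤ C * (1 + ‖ε⁻¹ • (x - u)‖) ^ k := by
  refine ⟨1, |ε| + ‖u‖, fun x => ?_⟩
  have h : x = ε • (ε⁻¹ • (x - u)) + u := by rw [smul_inv_smul₀ hε]; abel
  calc ‖x‖ = ‖ε • (ε⁻¹ • (x - u)) + u‖ := by rw [← h]
    _ ≤ |ε| * ‖ε⁻¹ • (x - u)‖ + ‖u‖ := (norm_add_le _ _).trans (by rw [norm_smul, Real.norm_eq_abs])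
    _ ≤ (|ε| + ‖u‖) * (1 + ‖ε⁻¹ • (x - u)‖) ^ 1 := by
      rw [pow_one]
      nlinarith [norm_nonneg u, norm_nonneg (ε⁻¹ • (x - u)), abs_nonneg ε,
        mul_nonneg (norm_nonneg u) (norm_nonneg (ε⁻¹ • (x - u)))]

/-- The scaled mollifier, centred at `u`. -/
def scaledMollifier {ε : ℝ} (hε : ε ≠ 0) (u : E) : 𝓢(E, ℂ) :=
  ((|ε ^ Module.finrank ℝ E|⁻¹ : ℝ) : ℂ) • SchwartzMap.compCLM (g := fun x => ε⁻¹ • (x - u)) ℂ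
    (by fun_prop) (dilation_upper hε u) (mollifier E)

lemma scaledMollifier_apply {ε : ℝ} (hε : ε ≠ 0) (u x : E) :
    scaledMollifier hε u x =
      ((|ε ^ Module.finrank ℝ E|⁻¹ : ℝ) : ℂ) * mollifier E (ε⁻¹ • (x - u)) := rfl

variable {Y V : Type} [NormedAddCommGroup Y] [NormedSpace ℝ Y] [NormedAddCommGroup V]
  [NormedSpace ℂ V]

lemma convolution_upper {ε : ℝ} (hε : ε ≠ 0) : ∃ (k : ℕ) (C : ℝ), ∀ w : E × (E × Y),
    ‖w‖ ≤ C * (1 + ‖((ε⁻¹ • (w.2.1 - w.1), (w.1, w.2.2)) : E × (E × Y))‖) ^ k := by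
  refine ⟨1, |ε| + 1, fun w => ?_⟩
  set N := ‖((ε⁻¹ • (w.2.1 - w.1), (w.1, w.2.2)) : E × (E × Y))‖
  have h1 : ‖ε⁻¹ • (w.2.1 - w.1)‖ ≤ N := norm_fst_le (E := E) (F := E × Y) (_, _)
  have h23 : ‖((w.1, w.2.2) : E × Y)‖ ≤ N := norm_snd_le (E := E) (F := E × Y) (_, _)
  have h2 : ‖w.1‖ ≤ N := (norm_fst_le ((w.1, w.2.2) : E × Y)).trans h23
  have h3 : ‖w.2.2‖ ≤ N := (norm_snd_le ((w.1, w.2.2) : E × Y)).trans h23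
  have hN : 0 ≤ N := norm_nonneg _
  have h : w.2.1 = ε • (ε⁻¹ • (w.2.1 - w.1)) + w.1 := by rw [smul_inv_smul₀ hε]; abel
  have h4 : ‖w.2.1‖ ≤ |ε| * N + N := by
    rw [h]
    refine (norm_add_le _ _).trans ?_
    rw [norm_smul, Real.norm_eq_abs]
    gcongr
  have h5 : N ≤ (|ε| + 1) * (1 + N) ^ 1 := by
    rw [pow_one]
    nlinarith [abs_nonneg ε, mul_nonneg (abs_nonneg ε) hN]
  rw [Prod.norm_def, Prod.norm_def]
  refine max_le (h2.trans h5) (max_le ?_ (h3.trans h5))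
  rw [pow_one]
  nlinarith [abs_nonneg ε, mul_nonneg (abs_nonneg ε) hN]

/-- The family `u ↦ ρ_ε(· - u) ⊗ F(u, ·)` as one Schwartz function. -/
def mollifyKernel {ε : ℝ} (hε : ε ≠ 0) (F : 𝓢(E × Y, V)) : 𝓢(E × (E × Y), V) :=
  ((|ε ^ Module.finrank ℝ E|⁻¹ : ℝ) : ℂ) • SchwartzMap.compCLM
    (g := fun w : E × (E × Y) => ((ε⁻¹ • (w.2.1 - w.1), (w.1, w.2.2)) : E × (E × Y))) ℂ
    (by fun_prop) (convolution_upper hε) (smulTensor (mollifier E) F)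

lemma mollifyKernel_apply {ε : ℝ} (hε : ε ≠ 0) (F : 𝓢(E × Y, V)) (u x : E) (y : Y) :
    mollifyKernel hε F (u, (x, y)) = ((|ε ^ Module.finrank ℝ E|⁻¹ : ℝ) : ℂ) •
      mollifier E (ε⁻¹ • (x - u)) • F (u, y) := rfl

lemma slice_mollifyKernel {ε : ℝ} (hε : ε ≠ 0) (F : 𝓢(E × Y, V)) (u : E) :
    sliceCLM u (mollifyKernel hε F) = smulTensor (scaledMollifier hε u) (sliceCLM u F) := by
  ext ⟨x, y⟩
  rw [sliceCLM_apply, mollifyKernel_apply, tensorCLM_apply, scaledMollifier_apply, sliceCLM_apply,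
    smul_smul]
  rfl

lemma shear_upper : ∃ (k : ℕ) (C : ℝ), ∀ w : E × (ℝ × (E × Y)),
    ‖w‖ ≤ C * (1 + ‖((w.1, (w.2.1, (w.2.2.1 - w.2.1 • w.1, w.2.2.2))) :
      E × (ℝ × (E × Y)))‖) ^ k := by
  -- Undoing the shear adds the product `w.2.1 • w.1`, which is quadratic; hence the exponent two.
  refine ⟨2, 1, fun w => ?_⟩
  set z : E × (ℝ × (E × Y)) := (w.1, (w.2.1, (w.2.2.1 - w.2.1 • w.1, w.2.2.2)))
  have hz : ‖z.2‖ ≤ ‖z‖ := norm_snd_le z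
  have hz2 : ‖z.2.2‖ ≤ ‖z‖ := (norm_snd_le z.2).trans hz
  have h1 : ‖w.1‖ ≤ ‖z‖ := norm_fst_le z
  have h2 : ‖w.2.1‖ ≤ ‖z‖ := (norm_fst_le z.2).trans hz
  have h3 : ‖w.2.2.1 - w.2.1 • w.1‖ ≤ ‖z‖ := (norm_fst_le z.2.2).trans hz2
  have h4 : ‖w.2.2.2‖ ≤ ‖z‖ := (norm_snd_le z.2.2).trans hz2
  have hN : 0 ≤ ‖z‖ := norm_nonneg _
  have h5 : ‖w.2.2.1‖ ≤ ‖z‖ + ‖z‖ * ‖z‖ := by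
    have : w.2.2.1 = (w.2.2.1 - w.2.1 • w.1) + w.2.1 • w.1 := by abel
    rw [this]
    refine (norm_add_le _ _).trans ?_
    rw [norm_smul]
    gcongr
  have h6 : ‖z‖ ≤ 1 * (1 + ‖z‖) ^ 2 := by nlinarith
  rw [Prod.norm_def, Prod.norm_def, Prod.norm_def]
  refine max_le (h1.trans h6) (max_le (h2.trans h6) (max_le ?_ (h4.trans h6)))
  nlinarith

/-- The mollifications of `F` at all scales `t`, with `F` itself at `t = 0`, are slices of the
Schwartz function `η(t) ∫ ρ(z) F(x - t z, y) dz`. Their convergence in the Schwartz topology then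
reduces to continuity of slices. The cutoff `η` provides decay in `t`. -/
lemma exists_mollify_family (F : 𝓢(E × Y, V)) [CompleteSpace V] : ∃ Q : 𝓢(ℝ × (E × Y), V),
    sliceCLM 0 Q = F ∧ ∀ (m : ℝ) (hm : m ≠ 0), |m| ≤ 1 →
      sliceCLM m Q = integrateCLM (mollifyKernel hm F) := by
  obtain ⟨η, hη⟩ := exists_schwartz_eq_one ℝ 1
  let Q : 𝓢(ℝ × (E × Y), V) := integrateCLM (SchwartzMap.compCLM
    (g := fun w : E × (ℝ × (E × Y)) =>
      ((w.1, (w.2.1, (w.2.2.1 - w.2.1 • w.1, w.2.2.2))) : E × (ℝ × (E × Y)))) ℂ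
    (by fun_prop) shear_upper (smulTensor (mollifier E) (smulTensor η F)))
  have hQ : ∀ t x y, Q (t, (x, y)) = ∫ z, mollifier E z • η t • F (x - t • z, y) := fun t x y =>
    integrateCLM_apply _ _
  refine ⟨Q, ?_, fun m hm hm1 => ?_⟩
  · ext ⟨x, y⟩
    rw [sliceCLM_apply, hQ, hη 0 (by simp)]
    simp only [one_smul, zero_smul, sub_zero]
    rw [integral_smul_const, integral_mollifier, one_smul]
  · ext ⟨x, y⟩
    rw [sliceCLM_apply, hQ, hη m (by simpa using hm1), integrateCLM_apply]
    simp only [mollifyKernel_apply, one_smul]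
    rw [integral_smul]
    -- The substitution is `u = x - m z`; the reflection comes first, and the dilation then produces
    -- the Jacobian in the normalization of the mollifier.
    have h1 := integral_sub_left_eq_self (μ := (volume : Measure E))
      (fun u => mollifier E (m⁻¹ • (x - u)) • F (u, y)) x
    rw [← h1]
    simp only [sub_sub_cancel]
    have h2 := Measure.integral_comp_smul (volume : Measure E)
      (fun u => mollifier E (m⁻¹ • u) • F (x - u, y)) m
    simp only [inv_smul_smul₀ hm] at h2
    rw [h2, ← Complex.coe_smul]
    congr 1
    rw [abs_inv]

/-- The parameter of the `m`-th mollifier. -/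
def mollifyStep (m : ℕ) : ℝ := 1 / ((m : ℝ) + 1)

lemma mollifyStep_ne_zero (m : ℕ) : mollifyStep m ≠ 0 := by unfold mollifyStep; positivity

variable {H : Type*} [NormedAddCommGroup H] [NormedSpace ℂ H] [CompleteSpace H] [CompleteSpace V]

/-- The value of a continuous linear map on a Schwartz function of `(x, y)` is the limit of
integrals over its values on tensor products. -/
theorem tendsto_integral_mollify (W : 𝓢(E × Y, V) →L[ℂ] H) (F : 𝓢(E × Y, V)) :
    Filter.Tendsto (fun m => ∫ u, W (smulTensor (scaledMollifier (mollifyStep_ne_zero m) u)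
      (sliceCLM u F))) Filter.atTop (𝓝 (W F)) := by
  obtain ⟨Q, hQ0, hQ⟩ := exists_mollify_family F
  have h1 : Filter.Tendsto (fun m => W (sliceCLM (mollifyStep m) Q)) Filter.atTop (𝓝 (W F)) := by
    have hc : Continuous fun t => W (sliceCLM t Q) := W.continuous.comp (continuous_slice Q)
    have := (hc.tendsto 0).comp tendsto_one_div_add_atTop_nhds_zero_nat
    rw [hQ0] at this
    exact this
  refine h1.congr fun m => ?_
  rw [hQ _ (mollifyStep_ne_zero m), clm_integrate]
  · simp only [slice_mollifyKernel]
  · unfold mollifyStep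
    rw [abs_of_nonneg (by positivity), div_le_one (by positivity)]
    linarith [(Nat.cast_nonneg m : (0 : ℝ) ≤ m)]

/-- A continuous linear map that vanishes on all tensor products vanishes. -/
theorem clm_eq_zero_of_tensor (W : 𝓢(E × Y, V) →L[ℂ] H)
    (h : ∀ f g, W (smulTensor f g) = 0) : W = 0 := by
  ext F
  have := tendsto_integral_mollify W F
  simp only [h, integral_zero] at this
  exact (tendsto_nhds_unique this tendsto_const_nhds)

lemma continuous_mollify (W : 𝓢(E × Y, V) →L[ℂ] H) (F : 𝓢(E × Y, V)) {ε : ℝ} (hε : ε ≠ 0) :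
    Continuous fun u => W (smulTensor (scaledMollifier hε u) (sliceCLM u F)) := by
  simp only [← slice_mollifyKernel]
  exact W.continuous.comp (continuous_slice _)

/-- The measurability of a family of Schwartz functions of `(x, y)` follows from the one of its
slices. -/
theorem stronglyMeasurable_clm_prod {Θ : Type*} [MeasurableSpace Θ] (g : Θ → 𝓢(E × Y, V))
    (hY : ∀ (W : 𝓢(Y, V) →L[ℂ] H) (u : E), StronglyMeasurable fun θ => W (sliceCLM u (g θ)))
    (W : 𝓢(E × Y, V) →L[ℂ] H) : StronglyMeasurable fun θ => W (g θ) := by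
  -- By mollification `W (g θ)` is a limit of integrals over `u` of functionals of the slices at
  -- `u`. These integrands are continuous in `u` and measurable in `θ`, hence jointly measurable.
  refine stronglyMeasurable_of_tendsto Filter.atTop (f := fun (m : ℕ) θ => ∫ u, W
    (smulTensor (scaledMollifier (mollifyStep_ne_zero m) u) (sliceCLM u (g θ)))) (fun m => ?_)
    (tendsto_pi_nhds.2 fun θ => tendsto_integral_mollify W (g θ))
  refine StronglyMeasurable.integral_prod_left (f := fun u θ => W
    (smulTensor (scaledMollifier (mollifyStep_ne_zero m) u) (sliceCLM u (g θ)))) ?_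
  exact stronglyMeasurable_uncurry_of_continuous_of_stronglyMeasurable
    (fun θ => continuous_mollify W (g θ) (mollifyStep_ne_zero m))
    (fun u => hY (W.comp (smulTensor (scaledMollifier (mollifyStep_ne_zero m) u))) u)

end Mollify

/-! ### Test functions of several spacetime variables -/

section SeveralVariables

variable {V : Type} [NormedAddCommGroup V] [NormedSpace ℂ V]

/-- Separating the first of `n + 1` spacetime variables. -/
def consCLE (n : ℕ) : (Mink × (Fin n → Mink)) ≃L[ℝ] (Fin (n + 1) → Mink) :=
  Fin.consEquivL ℝ fun _ => Mink

/-- A Schwartz function of `n + 1` variables as a function of the first and the other ones. -/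
def uncons (n : ℕ) : 𝓢(Fin (n + 1) → Mink, V) →L[ℂ] 𝓢(Mink × (Fin n → Mink), V) :=
  SchwartzMap.compCLMOfContinuousLinearEquiv ℂ (consCLE n)

/-- The inverse of `uncons`. -/
def recons (n : ℕ) : 𝓢(Mink × (Fin n → Mink), V) →L[ℂ] 𝓢(Fin (n + 1) → Mink, V) :=
  SchwartzMap.compCLMOfContinuousLinearEquiv ℂ (consCLE n).symm

lemma uncons_apply {n : ℕ} (F : 𝓢(Fin (n + 1) → Mink, V)) (z : Mink × (Fin n → Mink)) :
    uncons n F z = F (Fin.cons z.1 z.2) := rfl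

lemma recons_apply {n : ℕ} (F : 𝓢(Mink × (Fin n → Mink), V)) (x : Fin (n + 1) → Mink) :
    recons n F x = F (x 0, Fin.tail x) := rfl

lemma recons_uncons {n : ℕ} (F : 𝓢(Fin (n + 1) → Mink, V)) : recons n (uncons n F) = F := by
  ext x
  simp [recons_apply, uncons_apply]

/-- The constant function on a space of dimension zero. -/
def constZero (v : V) : 𝓢(Fin 0 → Mink, V) :=
  HasCompactSupport.toSchwartzMap (f := fun _ => v)
    (HasCompactSupport.of_compactSpace _) contDiff_const

lemma constZero_apply (v : V) (x : Fin 0 → Mink) : constZero v x = v := rfl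

lemma eq_constZero (F : 𝓢(Fin 0 → Mink, V)) : F = constZero (F 0) := by
  ext x
  rw [constZero_apply, Subsingleton.elim x 0]

variable {H : Type*} [NormedAddCommGroup H] [NormedSpace ℂ H] [CompleteSpace H]

/-- A family of Schwartz functions that is measurable pointwise is weakly measurable. -/
theorem stronglyMeasurable_clm [FiniteDimensional ℂ V] {Θ : Type*} [MeasurableSpace Θ] {n : ℕ}
    (g : Θ → 𝓢(Fin n → Mink, V)) (hg : ∀ x, StronglyMeasurable fun θ => g θ x)
    (W : 𝓢(Fin n → Mink, V) →L[ℂ] H) : StronglyMeasurable fun θ => W (g θ) := by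
  have : CompleteSpace V := FiniteDimensional.complete ℂ V
  induction n with
  | zero =>
    -- Without variables a Schwartz function is a constant, and the linear embedding of the
    -- finite-dimensional `V` is automatically continuous.
    let c : V →ₗ[ℂ] 𝓢(Fin 0 → Mink, V) :=
      { toFun := constZero
        map_add' := fun _ _ => rfl
        map_smul' := fun _ _ => rfl }
    have hc : Continuous c := c.continuous_of_finiteDimensional
    have : (fun θ => W (g θ)) = fun θ => (W ∘ c) (g θ 0) := by
      funext θ
      exact congrArg W (eq_constZero (g θ))
    rw [this]
    exact (W.continuous.comp hc).comp_stronglyMeasurable (hg 0)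
  | succ n ih =>
    have : (fun θ => W (g θ)) = fun θ => (W.comp (recons n)) (uncons n (g θ)) := by
      funext θ
      rw [ContinuousLinearMap.comp_apply, recons_uncons]
    rw [this]
    refine stronglyMeasurable_clm_prod (fun θ => uncons n (g θ)) (fun W u => ?_) _
    exact ih (fun θ => sliceCLM u (uncons n (g θ))) (fun x => hg _) W

end SeveralVariables

/-! ### Tensor products of multi-component test functions -/

section Tensors

variable {K : ℕ}

/-- The product of components, `(a, b) ↦ (k ↦ a_{k₀} b_{k₁ … kₙ})`. -/
def mulComponents (K n : ℕ) :
    (Fin K → ℂ) →L[ℂ] ((Fin n → Fin K) → ℂ) →L[ℂ] ((Fin (n + 1) → Fin K) → ℂ) :=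
  LinearMap.mkContinuous₂
    (LinearMap.mk₂ ℂ (fun a b k => a (k 0) * b (Fin.tail k))
      (fun _ _ _ => by ext; simp [add_mul]) (fun _ _ _ => by ext; simp [mul_assoc])
      (fun _ _ _ => by ext; simp [mul_add]) (fun _ _ _ => by ext; simp; ring)) 1
    (fun a b => by
      rw [one_mul]
      refine (pi_norm_le_iff_of_nonneg (by positivity)).2 fun k => ?_
      change ‖a (k 0) * b (Fin.tail k)‖ ≤ _
      rw [norm_mul]
      gcongr
      · exact norm_le_pi_norm a _
      · exact norm_le_pi_norm b _)

@[simp]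
lemma mulComponents_apply {n : ℕ} (a : Fin K → ℂ) (b : (Fin n → Fin K) → ℂ)
    (k : Fin (n + 1) → Fin K) : mulComponents K n a b k = a (k 0) * b (Fin.tail k) := rfl

/-- `f ⊗ G`, with the variable of `f` first. -/
def consTensor {n : ℕ} (f : Test K) : TestN K n →L[ℂ] TestN K (n + 1) :=
  (recons n).comp (tensorCLM (mulComponents K n) f)

lemma consTensor_apply {n : ℕ} (f : Test K) (G : TestN K n) (x : Fin (n + 1) → Mink)
    (k : Fin (n + 1) → Fin K) :
    consTensor f G x k = f (x 0) (k 0) * G (Fin.tail x) (Fin.tail k) := rfl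

lemma IsTensor.cons {n : ℕ} {f : Fin (n + 1) → Test K} {G : TestN K n}
    (h : IsTensor (fun j => f j.succ) G) : IsTensor f (consTensor (f 0) G) := by
  intro x k
  rw [consTensor_apply, h, Fin.prod_univ_succ]
  rfl

lemma exists_isTensor : ∀ {n : ℕ} (f : Fin n → Test K), ∃ F : TestN K n, IsTensor f F := by
  intro n
  induction n with
  | zero => exact fun f => ⟨constZero fun _ => 1, fun x k => by simp [constZero_apply]⟩
  | succ n ih =>
    intro f
    obtain ⟨G, hG⟩ := ih fun j => f j.succ
    exact ⟨_, hG.cons⟩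

/-- The Schwartz function `f e_k` with values in `ℂᴷ`. -/
def singleComponent {ι X : Type} [Fintype ι] [DecidableEq ι] [NormedAddCommGroup X]
    [NormedSpace ℝ X] (k : ι) : 𝓢(X, ℂ) →L[ℂ] 𝓢(X, ι → ℂ) :=
  SchwartzMap.postcompCLM (ContinuousLinearMap.single ℂ (fun _ : ι => ℂ) k)

lemma singleComponent_apply {ι X : Type} [Fintype ι] [DecidableEq ι] [NormedAddCommGroup X]
    [NormedSpace ℝ X] (k l : ι) (f : 𝓢(X, ℂ)) (x : X) :
    singleComponent k f x l = if l = k then f x else 0 := by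
  change (Pi.single k (f x) : ι → ℂ) l = _
  rw [Pi.single_apply]

/-- The component `F_k`. -/
def component {ι X : Type} [Fintype ι] [NormedAddCommGroup X]
    [NormedSpace ℝ X] (k : ι) : 𝓢(X, ι → ℂ) →L[ℂ] 𝓢(X, ℂ) :=
  SchwartzMap.postcompCLM (ContinuousLinearMap.proj k)

lemma component_apply {ι X : Type} [Fintype ι] [NormedAddCommGroup X]
    [NormedSpace ℝ X] (k : ι) (F : 𝓢(X, ι → ℂ)) (x : X) : component k F x = F x k := rfl

variable {H : Type*} [NormedAddCommGroup H] [NormedSpace ℂ H] [CompleteSpace H]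

/-- Reduces to products of a scalar function with a multi-component one: expanding in components and
splitting each multi-index into head and tail writes such a product as a finite sum of
`consTensor`s. -/
lemma clm_eq_zero_of_consTensor {n : ℕ} (W : TestN K (n + 1) →L[ℂ] H)
    (h : ∀ f G, W (consTensor f G) = 0) : W = 0 := by
  have h0 : W.comp (recons n) = 0 := by
    refine clm_eq_zero_of_tensor _ fun f g => ?_
    have hsum : recons n (smulTensor f g) = ∑ k : Fin (n + 1) → Fin K,
        consTensor (singleComponent (k 0) f) (singleComponent (Fin.tail k) (component k g)) := by
      ext x l
      rw [show (∑ k : Fin (n + 1) → Fin K, consTensor (singleComponent (k 0) f)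
        (singleComponent (Fin.tail k) (component k g))) x l = ∑ k : Fin (n + 1) → Fin K,
        consTensor (singleComponent (k 0) f) (singleComponent (Fin.tail k) (component k g)) x l by
          simp]
      rw [Finset.sum_eq_single l]
      · simp [consTensor_apply, recons_apply, singleComponent_apply, component_apply]
      · intro k _ hk
        rw [consTensor_apply, singleComponent_apply, singleComponent_apply]
        by_cases h1 : l 0 = k 0
        · have h2 : Fin.tail l ≠ Fin.tail k := fun h2 => hk (by
            rw [← Fin.cons_self_tail k, ← Fin.cons_self_tail l, h1, h2])
          rw [if_neg h2, mul_zero]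
        · rw [if_neg h1, zero_mul]
      · simp
    rw [ContinuousLinearMap.comp_apply, hsum, map_sum]
    exact Finset.sum_eq_zero fun k _ => h _ _
  ext F
  rw [← recons_uncons F]
  exact congrArg (fun T => T (uncons n F)) h0

/-- A continuous linear map that vanishes on `f₁ ⊗ ⋯ ⊗ fₙ` for all `f₁, …, fₙ` vanishes. -/
theorem clm_eq_zero_of_isTensor : ∀ {n : ℕ} (W : TestN K n →L[ℂ] H),
    (∀ (f : Fin n → Test K) F, IsTensor f F → W F = 0) → W = 0 := by
  intro n
  induction n with
  | zero =>
    intro W h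
    ext F
    have hF : F = (F 0 default) • constZero fun _ => 1 := by
      ext x k
      rw [Subsingleton.elim x 0, Subsingleton.elim k default]
      simp [constZero_apply]
    rw [hF, map_smul, h Fin.elim0 _ fun x k => by simp [constZero_apply], smul_zero]
    rfl
  | succ n ih =>
    intro W h
    refine clm_eq_zero_of_consTensor W fun f G => ?_
    have := ih (W.comp (consTensor f)) fun f' G' hG' =>
      h (Fin.cons f f') _ (IsTensor.cons (f := Fin.cons f f') (by simpa using hG'))
    exact congrArg (fun T => T G) this

end Tensors

/-! ### The undeformed theory -/

namespace Theory

variable {K : ℕ} {H : Type*} [NormedAddCommGroup H] [InnerProductSpace ℂ H] (T : Theory K H)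

lemma Ψ_mem (n : ℕ) (F : TestN K n) : T.Ψ n F ∈ T.D := by
  rw [T.D_eq]
  exact Submodule.subset_span ⟨n, F, rfl⟩

lemma Ψ_zero (F : TestN K 0) : T.Ψ 0 F = F 0 default • T.Ω := by
  have hF : F = (F 0 default) • constZero fun _ => 1 := by
    ext x k
    rw [Subsingleton.elim x 0, Subsingleton.elim k default]
    simp [constZero_apply]
  conv_lhs => rw [hF]
  rw [map_smul, T.Ψ_tensor 0 Fin.elim0 _ fun x k => by simp [constZero_apply]]
  simp

lemma φ_Ψ_of_isTensor {n : ℕ} {f : Fin n → Test K} {G : TestN K n} (h : IsTensor f G)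
    (f₀ : Test K) : (T.φ f₀ ⟨T.Ψ n G, T.Ψ_mem n G⟩ : H) = T.Ψ (n + 1) (consTensor f₀ G) := by
  have h1 := T.Ψ_tensor (n + 1) (Fin.cons f₀ f) (consTensor f₀ G)
    (IsTensor.cons (f := Fin.cons f₀ f) (by simpa using h))
  rw [h1, List.ofFn_succ]
  simp only [Fin.cons_zero, Fin.cons_succ, List.foldr_cons]
  congr 2
  exact Subtype.ext (T.Ψ_tensor n f G h)

variable [CompleteSpace H]

/-- `φ(f) Ψⁿ(G) = Ψⁿ⁺¹(f ⊗ G)`. -/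
theorem φ_Ψ {n : ℕ} (f : Test K) (G : TestN K n) :
    (T.φ f ⟨T.Ψ n G, T.Ψ_mem n G⟩ : H) = T.Ψ (n + 1) (consTensor f G) := by
  -- The operator `φ f` need not be continuous, so tensor products do not suffice directly. Against
  -- `w` in the domain the field moves to `w` by the adjoint relation, and both sides become
  -- continuous in `G`.
  refine T.D_dense.eq_of_inner_right ℂ fun w hw => ?_
  have h0 : (innerSL ℂ w).comp ((T.Ψ (n + 1)).comp (consTensor f)) -
      (innerSL ℂ (T.φ (starTest T.bar f) ⟨w, hw⟩ : H)).comp (T.Ψ n) = 0 := by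
    refine clm_eq_zero_of_isTensor _ fun f' G' hG' => ?_
    have h1 := T.φ_adjoint f ⟨w, hw⟩ ⟨T.Ψ n G', T.Ψ_mem n G'⟩
    rw [T.φ_Ψ_of_isTensor hG'] at h1
    exact sub_eq_zero.2 h1
  have h1 := sub_eq_zero.1 (congrArg (fun T => T G) h0)
  rw [T.φ_adjoint f ⟨w, hw⟩ ⟨T.Ψ n G, T.Ψ_mem n G⟩]
  exact h1.symm

lemma foldr_translate (y : Mink) (l : List (Test K)) :
    T.U y ((l.foldr (fun g v => T.φ g v) ⟨T.Ω, T.Ω_mem⟩ : T.D) : H) =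
      (((l.map (SchwartzMap.compSubConstCLM ℂ y)).foldr (fun g v => T.φ g v)
        ⟨T.Ω, T.Ω_mem⟩ : T.D) : H) := by
  induction l with
  | nil => exact T.U_Ω y
  | cons f l ih =>
    simp only [List.foldr_cons, List.map_cons]
    rw [T.φ_covariant]
    congr 2
    exact Subtype.ext ih

/-- Translation invariance of the `n`-point functions. -/
theorem npoint_translate {n : ℕ} (y : Mink) (F : TestN K n) :
    T.npoint n (SchwartzMap.compSubConstCLM ℂ (fun _ => y) F) = T.npoint n F := by
  have h0 : (innerSL ℂ T.Ω).comp ((T.Ψ n).comp (SchwartzMap.compSubConstCLM ℂ fun _ => y)) -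
      (innerSL ℂ T.Ω).comp (T.Ψ n) = 0 := by
    refine clm_eq_zero_of_isTensor _ fun f G hG => ?_
    have hG' : IsTensor (fun j => SchwartzMap.compSubConstCLM ℂ y (f j))
        (SchwartzMap.compSubConstCLM ℂ (fun _ => y) G) := fun x k => by
      rw [SchwartzMap.compSubConstCLM_apply, hG]
      rfl
    have h1 := T.Ψ_tensor n _ _ hG'
    have h2 := T.foldr_translate y (List.ofFn f)
    rw [List.map_ofFn] at h2
    have h3 : T.Ψ n (SchwartzMap.compSubConstCLM ℂ (fun _ => y) G) = T.U y (T.Ψ n G) := by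
      rw [h1, T.Ψ_tensor n f G hG, h2]
      rfl
    refine sub_eq_zero.2 ?_
    change ⟪T.Ω, T.Ψ n (SchwartzMap.compSubConstCLM ℂ (fun _ => y) G)⟫_ℂ = ⟪T.Ω, T.Ψ n G⟫_ℂ
    rw [h3]
    conv_lhs => rw [← T.U_Ω y]
    exact (T.U y).inner_map_map _ _
  exact sub_eq_zero.1 (congrArg (fun T => T F) h0)

end Theory

/-! ### Fourier transformation in spacetime variables -/

section Transform

variable {P X E V : Type} [NormedAddCommGroup P] [NormedSpace ℝ P]
  [NormedAddCommGroup X] [NormedSpace ℝ X]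
  [NormedAddCommGroup E] [InnerProductSpace ℝ E] [FiniteDimensional ℝ E] [MeasurableSpace E]
  [BorelSpace E] [NormedAddCommGroup V] [NormedSpace ℂ V]

/-- The Fourier transformation `F ↦ c 𝓕(F ∘ e⁻¹) ∘ A` in coordinates `e` of the positions and `A`
of the momenta. -/
def transform (e A : X ≃L[ℝ] E) (c : ℂ) : 𝓢(X, V) →L[ℂ] 𝓢(X, V) :=
  c • (SchwartzMap.compCLMOfContinuousLinearEquiv ℂ A).comp
    ((FourierTransform.fourierCLM ℂ 𝓢(E, V)).comp
      (SchwartzMap.compCLMOfContinuousLinearEquiv ℂ e.symm))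

/-- The inverse of `transform`. -/
def invTransform (e A : X ≃L[ℝ] E) (c : ℂ) [CompleteSpace V] : 𝓢(X, V) →L[ℂ] 𝓢(X, V) :=
  c⁻¹ • (SchwartzMap.compCLMOfContinuousLinearEquiv ℂ e).comp
    ((FourierTransform.fourierInvCLM ℂ 𝓢(E, V)).comp
      (SchwartzMap.compCLMOfContinuousLinearEquiv ℂ A.symm))

/-- `transform` in the second variable. -/
def partialTransform (e A : X ≃L[ℝ] E) (c : ℂ) : 𝓢(P × X, V) →L[ℂ] 𝓢(P × X, V) :=
  c • (SchwartzMap.compCLMOfContinuousLinearEquiv ℂ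
      ((ContinuousLinearEquiv.refl ℝ P).prodCongr A)).comp (partialFourierCLM.comp
      (SchwartzMap.compCLMOfContinuousLinearEquiv ℂ
        ((ContinuousLinearEquiv.refl ℝ P).prodCongr e.symm)))

/-- `invTransform` in the second variable. -/
def partialInvTransform (e A : X ≃L[ℝ] E) (c : ℂ) : 𝓢(P × X, V) →L[ℂ] 𝓢(P × X, V) :=
  c⁻¹ • (SchwartzMap.compCLMOfContinuousLinearEquiv ℂ
      ((ContinuousLinearEquiv.refl ℝ P).prodCongr
        -- The inverse Fourier transform is the Fourier transform at the reflected argument.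
        (e.trans (ContinuousLinearEquiv.neg ℝ)))).comp (partialFourierCLM.comp
      (SchwartzMap.compCLMOfContinuousLinearEquiv ℂ
        ((ContinuousLinearEquiv.refl ℝ P).prodCongr A.symm)))

lemma transform_apply (e A : X ≃L[ℝ] E) (c : ℂ) (F : 𝓢(X, V)) (p : X) :
    transform e A c F p = c • ∫ y, Complex.exp (↑(-2 * Real.pi * ⟪y, A p⟫_ℝ) * Complex.I) •
      F (e.symm y) := by
  rw [← Real.fourier_eq' (fun y => F (e.symm y))]
  rfl

lemma slice_partialTransform (e A : X ≃L[ℝ] E) (c : ℂ) (s : P) (G : 𝓢(P × X, V)) :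
    sliceCLM s (partialTransform e A c G) = transform e A c (sliceCLM s G) := by
  ext x
  rfl

variable [CompleteSpace V]

lemma slice_partialInvTransform (e A : X ≃L[ℝ] E) (c : ℂ) (s : P) (G : 𝓢(P × X, V)) :
    sliceCLM s (partialInvTransform e A c G) = invTransform e A c (sliceCLM s G) := by
  ext x
  have h := congrArg (fun F : E → V => F (e x)) (SchwartzMap.fourierInv_coe
    (SchwartzMap.compCLMOfContinuousLinearEquiv ℂ A.symm (sliceCLM s G)))
  simp only [Real.fourierInv_eq_fourier_neg] at h
  exact congrArg (c⁻¹ • ·) h.symm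

lemma transform_invTransform (e A : X ≃L[ℝ] E) {c : ℂ} (hc : c ≠ 0) (F : 𝓢(X, V)) :
    transform e A c (invTransform e A c F) = F := by
  have h0 : ∀ G : 𝓢(E, V), SchwartzMap.compCLMOfContinuousLinearEquiv ℂ e.symm
      (SchwartzMap.compCLMOfContinuousLinearEquiv ℂ e G) = G := fun G => by ext; simp
  have h1 : ∀ G : 𝓢(X, V), SchwartzMap.compCLMOfContinuousLinearEquiv ℂ A
      (SchwartzMap.compCLMOfContinuousLinearEquiv ℂ A.symm G) = G := fun G => by ext; simp
  simp only [transform, invTransform, smul_apply,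
    ContinuousLinearMap.comp_apply, map_smul, h0, FourierTransform.fourierCLM_apply,
    FourierTransform.fourierInvCLM_apply, FourierTransform.fourier_fourierInv_eq, h1, smul_smul,
    inv_mul_cancel₀ hc, one_smul]

lemma invTransform_transform (e A : X ≃L[ℝ] E) {c : ℂ} (hc : c ≠ 0) (F : 𝓢(X, V)) :
    invTransform e A c (transform e A c F) = F := by
  have h0 : ∀ G : 𝓢(X, V), SchwartzMap.compCLMOfContinuousLinearEquiv ℂ e
      (SchwartzMap.compCLMOfContinuousLinearEquiv ℂ e.symm G) = G := fun G => by ext; simp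
  have h1 : ∀ G : 𝓢(E, V), SchwartzMap.compCLMOfContinuousLinearEquiv ℂ A.symm
      (SchwartzMap.compCLMOfContinuousLinearEquiv ℂ A G) = G := fun G => by ext; simp
  simp only [transform, invTransform, smul_apply,
    ContinuousLinearMap.comp_apply, map_smul, h0, FourierTransform.fourierCLM_apply,
    FourierTransform.fourierInvCLM_apply, FourierTransform.fourierInv_fourier_eq, h1, smul_smul,
    mul_inv_cancel₀ hc, one_smul]

/-- The volumes of `X` and `E` differ by a constant. -/
lemma exists_volume_factor {X : Type} [NormedAddCommGroup X] [NormedSpace ℝ X] [MeasureSpace X]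
    [BorelSpace X] [(volume : Measure X).IsAddHaarMeasure] (e : X ≃L[ℝ] E) :
    ∃ c : ℂ, c ≠ 0 ∧ ∀ {V : Type} [NormedAddCommGroup V] [NormedSpace ℂ V] (F : X → V),
      ∫ x, F x = c • ∫ y, F (e.symm y) := by
  have : FiniteDimensional ℝ X := e.symm.toLinearEquiv.finiteDimensional
  have : (Measure.map e.symm (volume : Measure E)).IsAddHaarMeasure :=
    e.symm.isAddHaarMeasure_map volume
  -- Uniqueness of Haar measure. The factor is needed because the Fourier transform lives on an
  -- inner product space, whereas `Fin n → Mink` carries the sup norm; its value never matters.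
  have h := Measure.isAddLeftInvariant_eq_smul (volume : Measure X)
    (Measure.map e.symm (volume : Measure E))
  have hpos := Measure.addHaarScalarFactor_pos_of_isAddHaarMeasure (volume : Measure X)
    (Measure.map e.symm (volume : Measure E))
  set d := Measure.addHaarScalarFactor (volume : Measure X)
    (Measure.map e.symm (volume : Measure E))
  refine ⟨((d : ℝ) : ℂ), by exact_mod_cast hpos.ne', fun F => ?_⟩
  conv_lhs => rw [h]
  rw [integral_smul_nnreal_measure]
  refine Eq.trans ?_ (Complex.coe_smul _ _).symm
  exact congrArg (d • ·) (e.symm.toHomeomorph.measurableEmbedding.integral_map F)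

end Transform

/-! ### Minkowski momenta -/

/-- `p ↦ (2π)⁻¹ η p`. -/
def momentum : Mink ≃L[ℝ] Mink :=
  LinearEquiv.toContinuousLinearEquiv
    { toFun := fun p => WithLp.toLp 2 fun μ => (2 * Real.pi)⁻¹ * (eta μ * p μ)
      map_add' := fun p q => by ext μ; simp; ring
      map_smul' := fun c p => by ext μ; simp; ring
      invFun := fun p => WithLp.toLp 2 fun μ => (2 * Real.pi) * (eta μ * p μ)
      left_inv := fun p => by
        ext μ
        have : eta μ * eta μ = 1 := by unfold eta; split_ifs <;> norm_num
        simp only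
        field_simp
        linear_combination p μ * this
      right_inv := fun p => by
        ext μ
        have : eta μ * eta μ = 1 := by unfold eta; split_ifs <;> norm_num
        simp only
        field_simp
        linear_combination p μ * this }

lemma momentum_apply (p : Mink) (μ : Fin 4) :
    momentum p μ = (2 * Real.pi)⁻¹ * (eta μ * p μ) := rfl

/-- Converts the kernel `exp(-2πi⟨x, ξ⟩)` of the Euclidean Fourier transform into the Minkowski
kernel `exp(-ip·x)`. -/
lemma inner_momentum (p x : Mink) : 2 * Real.pi * ⟪x, momentum p⟫_ℝ = mdot p x := by
  simp only [PiLp.inner_apply, momentum_apply, mdot, Finset.mul_sum]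
  refine Finset.sum_congr rfl fun μ _ => ?_
  simp
  field_simp

/-- `n` spacetime variables with the Euclidean norm. -/
abbrev euclid (n : ℕ) : (Fin n → Mink) ≃L[ℝ] PiLp 2 (fun _ : Fin n => Mink) :=
  (PiLp.continuousLinearEquiv 2 ℝ fun _ : Fin n => Mink).symm

/-- `momentum` for each of `n` variables. -/
def momentumN (n : ℕ) : (Fin n → Mink) ≃L[ℝ] PiLp 2 (fun _ : Fin n => Mink) :=
  (ContinuousLinearEquiv.piCongrRight fun _ => momentum).trans (euclid n)

lemma inner_momentumN {n : ℕ} (p : Fin n → Mink) (y : PiLp 2 (fun _ : Fin n => Mink)) :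
    2 * Real.pi * ⟪y, momentumN n p⟫_ℝ = ∑ j, mdot (p j) ((euclid n).symm y j) := by
  rw [PiLp.inner_apply, Finset.mul_sum]
  exact Finset.sum_congr rfl fun j _ => inner_momentum _ _

/-- The normalization of the Fourier transform in `n` variables. -/
def normalization (n : ℕ) : ℂ :=
  (((2 * Real.pi) ^ (2 * n))⁻¹ : ℝ) * (exists_volume_factor (euclid n)).choose

lemma normalization_ne_zero (n : ℕ) : normalization n ≠ 0 := by
  refine mul_ne_zero ?_ (exists_volume_factor (euclid n)).choose_spec.1
  exact_mod_cast (by positivity : ((2 * Real.pi) ^ (2 * n))⁻¹ ≠ 0)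

/-- The Fourier transformation in `n` variables. -/
def ftN {V : Type} [NormedAddCommGroup V] [NormedSpace ℂ V] (n : ℕ) :
    𝓢(Fin n → Mink, V) →L[ℂ] 𝓢(Fin n → Mink, V) :=
  transform (euclid n) (momentumN n) (normalization n)

/-- The Fourier transformation in one variable. -/
def ft {V : Type} [NormedAddCommGroup V] [NormedSpace ℂ V] : 𝓢(Mink, V) →L[ℂ] 𝓢(Mink, V) :=
  transform (ContinuousLinearEquiv.refl ℝ Mink) momentum ((((2 * Real.pi) ^ 2)⁻¹ : ℝ) : ℂ)

lemma ftN_apply {V : Type} [NormedAddCommGroup V] [NormedSpace ℂ V] {n : ℕ}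
    (F : 𝓢(Fin n → Mink, V)) (p : Fin n → Mink) :
    ftN n F p = ((((2 * Real.pi) ^ (2 * n))⁻¹ : ℝ) : ℂ) • ∫ x : Fin n → Mink,
      Complex.exp (-Complex.I * (∑ j, mdot (p j) (x j) : ℝ)) • F x := by
  rw [ftN, transform_apply, normalization, mul_smul,
    (exists_volume_factor (euclid n)).choose_spec.2]
  congr 3
  funext y
  rw [← inner_momentumN]
  congr 2
  push_cast
  ring

lemma ft_apply {V : Type} [NormedAddCommGroup V] [NormedSpace ℂ V] (F : 𝓢(Mink, V)) (p : Mink) :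
    ft F p = ((((2 * Real.pi) ^ 2)⁻¹ : ℝ) : ℂ) • ∫ x : Mink,
      Complex.exp (-Complex.I * (mdot p x : ℝ)) • F x := by
  rw [ft, transform_apply]
  congr 2
  funext y
  rw [← inner_momentum]
  congr 2
  push_cast
  ring

lemma integrable_cexp_smul {X V : Type} [NormedAddCommGroup X] [NormedSpace ℝ X]
    [FiniteDimensional ℝ X] [MeasureSpace X] [BorelSpace X]
    [(volume : Measure X).IsAddHaarMeasure] [NormedAddCommGroup V] [NormedSpace ℂ V]
    (F : 𝓢(X, V)) {u : X → ℝ} (hu : Continuous u) :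
    Integrable fun x => Complex.exp (-Complex.I * (u x : ℝ)) • F x := by
  refine (F.integrable (μ := volume)).norm.mono'
    (Continuous.aestronglyMeasurable (by fun_prop)) (.of_forall fun x => ?_)
  rw [norm_smul, show -Complex.I * (u x : ℂ) = ((-u x : ℝ) : ℂ) * Complex.I by push_cast; ring,
    Complex.norm_exp_ofReal_mul_I, one_mul]

lemma continuous_mdot (p : Mink) : Continuous fun x => mdot p x := by unfold mdot; fun_prop

lemma fourierN_eq {K n : ℕ} (F : TestN K n) (p : Fin n → Mink) (k : Fin n → Fin K) :
    fourierN F p k = ftN n F p k := by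
  rw [ftN_apply, fourierN, Pi.smul_apply, smul_eq_mul]
  congr 1
  refine Eq.trans ?_ ((ContinuousLinearMap.proj (R := ℂ) (φ := fun _ => ℂ) k).integral_comp_comm
    (integrable_cexp_smul F (by unfold mdot; fun_prop)))
  exact integral_congr_ae (.of_forall fun x => mul_comm _ _)

lemma fourier_eq {K : ℕ} (f : Test K) (p : Mink) (k : Fin K) : fourier f p k = ft f p k := by
  rw [ft_apply, fourier, Pi.smul_apply, smul_eq_mul]
  congr 1
  refine Eq.trans ?_ ((ContinuousLinearMap.proj (R := ℂ) (φ := fun _ => ℂ) k).integral_comp_comm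
    (integrable_cexp_smul f (continuous_mdot p)))
  exact integral_congr_ae (.of_forall fun x => mul_comm _ _)

section Inverse

variable {P V : Type} [NormedAddCommGroup P] [NormedSpace ℝ P] [NormedAddCommGroup V]
  [NormedSpace ℂ V]

/-- The Fourier transformation in `n` variables of functions with a parameter. -/
def pftN (n : ℕ) : 𝓢(P × (Fin n → Mink), V) →L[ℂ] 𝓢(P × (Fin n → Mink), V) :=
  partialTransform (euclid n) (momentumN n) (normalization n)

/-- The inverse Fourier transformation in `n` variables of functions with a parameter. -/
def piftN (n : ℕ) : 𝓢(P × (Fin n → Mink), V) →L[ℂ] 𝓢(P × (Fin n → Mink), V) :=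
  partialInvTransform (euclid n) (momentumN n) (normalization n)

/-- The inverse Fourier transformation in one variable of functions with a parameter. -/
def pift : 𝓢(P × Mink, V) →L[ℂ] 𝓢(P × Mink, V) :=
  partialInvTransform (ContinuousLinearEquiv.refl ℝ Mink) momentum
    ((((2 * Real.pi) ^ 2)⁻¹ : ℝ) : ℂ)

lemma slice_pftN {n : ℕ} (s : P) (G : 𝓢(P × (Fin n → Mink), V)) :
    sliceCLM s (pftN n G) = ftN n (sliceCLM s G) := slice_partialTransform _ _ _ s G

variable [CompleteSpace V]

/-- The inverse Fourier transformation in `n` variables. -/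
def iftN (n : ℕ) : 𝓢(Fin n → Mink, V) →L[ℂ] 𝓢(Fin n → Mink, V) :=
  invTransform (euclid n) (momentumN n) (normalization n)

lemma ftN_iftN {n : ℕ} (F : 𝓢(Fin n → Mink, V)) : ftN n (iftN n F) = F :=
  transform_invTransform _ _ (normalization_ne_zero n) F

lemma ftN_slice_piftN {n : ℕ} (s : P) (G : 𝓢(P × (Fin n → Mink), V)) :
    ftN n (sliceCLM s (piftN n G)) = sliceCLM s G := by
  rw [piftN, slice_partialInvTransform]
  exact transform_invTransform _ _ (normalization_ne_zero n) _

lemma ft_slice_pift (s : P) (G : 𝓢(P × Mink, V)) : ft (sliceCLM s (pift G)) = sliceCLM s G := by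
  rw [pift, slice_partialInvTransform]
  refine transform_invTransform _ _ ?_ _
  exact_mod_cast (by positivity : ((2 * Real.pi) ^ 2)⁻¹ ≠ 0)

lemma ftN_injective {n : ℕ} : Function.Injective (ftN (V := V) n) :=
  Function.LeftInverse.injective (g := iftN n)
    fun F => invTransform_transform _ _ (normalization_ne_zero n) F

lemma ft_injective : Function.Injective (ft (V := V)) :=
  Function.LeftInverse.injective (g := invTransform (ContinuousLinearEquiv.refl ℝ Mink) momentum
    ((((2 * Real.pi) ^ 2)⁻¹ : ℝ) : ℂ)) fun F => invTransform_transform _ _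
      (by exact_mod_cast (by positivity : ((2 * Real.pi) ^ 2)⁻¹ ≠ 0)) F

end Inverse

lemma fourierN_injective {K n : ℕ} {F G : TestN K n}
    (h : ∀ p k, fourierN F p k = fourierN G p k) : F = G := by
  refine ftN_injective ?_
  ext p k
  rw [← fourierN_eq, h, fourierN_eq]

lemma fourier_injective {K : ℕ} {f g : Test K} (h : ∀ p k, fourier f p k = fourier g p k) :
    f = g := by
  refine ft_injective ?_
  ext p k
  rw [← fourier_eq, h, fourier_eq]

lemma integral_fin_succ {n : ℕ} {V : Type} [NormedAddCommGroup V] [NormedSpace ℝ V]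
    (F : (Fin (n + 1) → Mink) → V) :
    ∫ x, F x = ∫ z : Mink × (Fin n → Mink), F (Fin.cons z.1 z.2) := by
  have h := (volume_preserving_piFinSuccAbove (fun _ : Fin (n + 1) => Mink) 0).symm
  rw [← h.integral_comp (MeasurableEquiv.measurableEmbedding _)]
  refine integral_congr_ae (.of_forall fun z => congrArg F ?_)
  exact Fin.insertNth_zero' z.1 z.2

lemma fourierN_consTensor {K n : ℕ} (f : Test K) (G : TestN K n) (p : Fin (n + 1) → Mink)
    (k : Fin (n + 1) → Fin K) :
    fourierN (consTensor f G) p k =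
      fourier f (p 0) (k 0) * fourierN G (Fin.tail p) (Fin.tail k) := by
  rw [fourierN, integral_fin_succ, fourier, fourierN, mul_mul_mul_comm,
    ← integral_prod_mul (μ := (volume : Measure Mink))
      (ν := (volume : Measure (Fin n → Mink))), ← Measure.volume_eq_prod]
  congr 1
  · push_cast
    rw [mul_add, pow_add]
    field_simp
    ring
  · refine integral_congr_ae (.of_forall fun z => ?_)
    simp only [consTensor_apply, Fin.sum_univ_succ, Fin.cons_zero, Fin.cons_succ, Fin.tail_cons]
    rw [mul_mul_mul_comm, ← Complex.exp_add]
    congr 2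
    simp only [Fin.tail]
    push_cast
    ring

lemma mdot_neg_left (p x : Mink) : mdot (-p) x = -mdot p x := by
  simp [mdot, Finset.sum_neg_distrib]

lemma fourier_starTest {K : ℕ} (bar : Fin K → Fin K) (f : Test K) (p : Mink) (k : Fin K) :
    fourier (starTest bar f) p k = (starRingEnd ℂ) (fourier f (-p) (bar k)) := by
  rw [fourier, fourier, map_mul, Complex.conj_ofReal, ← integral_conj]
  congr 1
  refine integral_congr_ae (.of_forall fun x => ?_)
  simp only [map_mul, ← Complex.exp_conj, mdot_neg_left, map_neg, Complex.conj_I,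
    Complex.conj_ofReal]
  congr 2
  push_cast
  ring

/-! ### The action of the Weyl operators on Schwartz functions -/

section Coordinates

variable {D : Type*} [NormedAddCommGroup D] [NormedSpace ℝ D]

@[fun_prop]
lemma hasTemperateGrowth_coord {ι : Type*} [Fintype ι] {f : D → EuclideanSpace ℝ ι}
    (hf : f.HasTemperateGrowth) (i : ι) : (fun x => f x i).HasTemperateGrowth :=
  (EuclideanSpace.proj (𝕜 := ℝ) i).hasTemperateGrowth.comp hf

lemma hasTemperateGrowth_toLp {ι : Type*} [Fintype ι] {f : D → ι → ℝ}
    (hf : ∀ i, (fun x => f x i).HasTemperateGrowth) :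
    (fun x => (WithLp.toLp 2 (f x) : EuclideanSpace ℝ ι)).HasTemperateGrowth :=
  (EuclideanSpace.equiv ι ℝ).symm.toContinuousLinearMap.hasTemperateGrowth.comp
    (hasTemperateGrowth_pi hf)

@[fun_prop]
lemma hasTemperateGrowth_coeff {f : D → MatSpace} {g : D → Mink} (hf : f.HasTemperateGrowth)
    (hg : g.HasTemperateGrowth) (ν : Fin 4) :
    (fun x => coeff (toMat (f x)) (g x) ν).HasTemperateGrowth := by
  simp only [coeff, toMat, Matrix.of_apply, Fin.sum_univ_four]
  fun_prop

@[fun_prop]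
lemma hasTemperateGrowth_shift (κe κm : ℝ) {f : D → MatSpace} {g : D → Mink}
    (hf : f.HasTemperateGrowth) (hg : g.HasTemperateGrowth) :
    (fun x => shift κe κm (toMat (f x)) (g x)).HasTemperateGrowth := by
  refine hasTemperateGrowth_toLp fun i => ?_
  fin_cases i
  · exact (Function.HasTemperateGrowth.const κe).mul (hasTemperateGrowth_coeff hf hg 1)
  · exact (Function.HasTemperateGrowth.const κm).mul (hasTemperateGrowth_coeff hf hg 3)

/-- The phase of `e^{ip·X}`. -/
def weylPhase (κe κm : ℝ) (L : Matrix (Fin 4) (Fin 4) ℝ) (p : Mink) (s : Plane) : ℝ :=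
  coeff L p 0 * s 0 + coeff L p 2 * s 1 +
      (κe * coeff L p 0 * coeff L p 1 + κm * coeff L p 2 * coeff L p 3) / 2

lemma weyl_eq (κe κm : ℝ) (L : Matrix (Fin 4) (Fin 4) ℝ) (p : Mink) (w : Plane → ℂ) (s : Plane) :
    weyl κe κm L p w s =
      Complex.exp (Complex.I * (weylPhase κe κm L p s : ℂ)) * w (s + shift κe κm L p) := rfl

@[fun_prop]
lemma hasTemperateGrowth_weylPhase (κe κm : ℝ) {f : D → MatSpace} {g : D → Mink} {h : D → Plane}
    (hf : f.HasTemperateGrowth) (hg : g.HasTemperateGrowth) (hh : h.HasTemperateGrowth) :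
    (fun x => weylPhase κe κm (toMat (f x)) (g x) (h x)).HasTemperateGrowth := by
  unfold weylPhase
  simp only [div_eq_mul_inv]
  fun_prop

/-- The upper bound on the growth of the inverse that is needed for compositions. -/
lemma upper_of_leftInverse {D' : Type*} [NormedAddCommGroup D'] [NormedSpace ℝ D'] {Φ : D → D'}
    {Ψ : D' → D} (hΨ : Ψ.HasTemperateGrowth) (h : ∀ x, Ψ (Φ x) = x) :
    ∃ (k : ℕ) (C : ℝ), ∀ x, ‖x‖ ≤ C * (1 + ‖Φ x‖) ^ k := by
  obtain ⟨k, C, hC⟩ := hΨ.2 0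
  refine ⟨k, C, fun x => ?_⟩
  simpa [h] using hC (Φ x)

end Coordinates

section Kernel

variable (κe κm : ℝ) {Y A B V : Type} [NormedAddCommGroup Y] [NormedSpace ℝ Y]
  [NormedAddCommGroup A] [NormedSpace ℂ A] [NormedAddCommGroup B] [NormedSpace ℂ B]
  [NormedAddCommGroup V] [NormedSpace ℂ V]

/-- The map `(L, p, s, y) ↦ (L, p, s + shift, y)`. -/
def weylShear (z : MatSpace × (Mink × (Plane × Y))) : MatSpace × (Mink × (Plane × Y)) :=
  (z.1, (z.2.1, (z.2.2.1 + shift κe κm (toMat z.1) z.2.1, z.2.2.2)))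

lemma weylShear_temperate :
    (weylShear κe κm : MatSpace × (Mink × (Plane × Y)) → _).HasTemperateGrowth := by
  unfold weylShear
  fun_prop

lemma weylShear_upper : ∃ (k : ℕ) (C : ℝ), ∀ z : MatSpace × (Mink × (Plane × Y)),
    ‖z‖ ≤ C * (1 + ‖weylShear κe κm z‖) ^ k :=
  upper_of_leftInverse (Ψ := fun z : MatSpace × (Mink × (Plane × Y)) =>
    (z.1, (z.2.1, (z.2.2.1 - shift κe κm (toMat z.1) z.2.1, z.2.2.2)))) (by fun_prop)
    fun z => by simp [weylShear]

/-- The function `χ(L) f(p) (e^{ip·X} G)(s, y)` of `(L, p, s, y)`. -/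
def weylKernel (M : A →L[ℂ] B →L[ℂ] V) (χ : 𝓢(MatSpace, ℂ)) (f : 𝓢(Mink, A)) :
    𝓢(Plane × Y, B) →L[ℂ] 𝓢(MatSpace × (Mink × (Plane × Y)), V) :=
  -- The phase, the shear and the inverse shear are polynomial in `(L, p, s)`, so these operations
  -- preserve Schwartz functions. Having `L` as a variable makes bounds uniform in `Λ_θ` a matter of
  -- slicing.
  (SchwartzMap.smulLeftCLM V fun z : MatSpace × (Mink × (Plane × Y)) =>
      Complex.exp (Complex.I * (weylPhase κe κm (toMat z.1) z.2.1 z.2.2.1 : ℂ))).comp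
    ((SchwartzMap.compCLM ℂ (weylShear_temperate κe κm) (weylShear_upper κe κm)).comp
      ((smulTensor χ).comp (tensorCLM M f)))

lemma weylKernel_apply (M : A →L[ℂ] B →L[ℂ] V) (χ : 𝓢(MatSpace, ℂ)) (f : 𝓢(Mink, A))
    (G : 𝓢(Plane × Y, B)) (ℓ : MatSpace) (p : Mink) (s : Plane) (y : Y) :
    weylKernel κe κm M χ f G (ℓ, (p, (s, y))) =
      Complex.exp (Complex.I * (weylPhase κe κm (toMat ℓ) p s : ℂ)) •
        χ ℓ • M (f p) (G (s + shift κe κm (toMat ℓ) p, y)) := by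
  rw [weylKernel, ContinuousLinearMap.comp_apply, SchwartzMap.smulLeftCLM_apply_apply (by fun_prop)]
  rfl

end Kernel

/-! ### The operation `f × g` in a single fibre: bounds and measurability -/

section Action

variable (κe κm : ℝ) {K : ℕ}

/-- Moving the first of `n + 1` variables to the front. -/
def frontCLE (n : ℕ) : (Plane × (Fin (n + 1) → Mink)) ≃L[ℝ] Mink × (Plane × (Fin n → Mink)) :=
  LinearEquiv.toContinuousLinearEquiv
    { toFun := fun z => (z.2 0, (z.1, Fin.tail z.2))
      map_add' := fun _ _ => rfl
      map_smul' := fun _ _ => rfl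
      invFun := fun z => (z.2.1, Fin.cons z.1 z.2.2)
      left_inv := fun z => by simp
      right_inv := fun z => by simp }

/-- The operation `g ↦ f × g` in momentum space, in the fibre with `Λ_θ = ℓ` and cut off by `χ`. -/
def momentumAction (χ : 𝓢(MatSpace, ℂ)) (ℓ : MatSpace) (f : Test K) (n : ℕ) :
    𝓢(Plane × (Fin n → Mink), (Fin n → Fin K) → ℂ) →L[ℂ]
      𝓢(Plane × (Fin (n + 1) → Mink), (Fin (n + 1) → Fin K) → ℂ) :=
  (SchwartzMap.compCLMOfContinuousLinearEquiv ℂ (frontCLE n)).comp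
    ((sliceCLM ℓ).comp (weylKernel κe κm (mulComponents K n) χ (ft f)))

/-- The operation `g ↦ f × g` in the fibre with `Λ_θ = ℓ`, cut off by `χ`. -/
def action (χ : 𝓢(MatSpace, ℂ)) (ℓ : MatSpace) (f : Test K) (n : ℕ) :
    𝓢(Plane × (Fin n → Mink), (Fin n → Fin K) → ℂ) →L[ℂ]
      𝓢(Plane × (Fin (n + 1) → Mink), (Fin (n + 1) → Fin K) → ℂ) :=
  (piftN (n + 1)).comp ((momentumAction κe κm χ ℓ f n).comp (pftN n))

lemma momentumAction_apply (χ : 𝓢(MatSpace, ℂ)) (ℓ : MatSpace) (f : Test K) (n : ℕ)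
    (G : 𝓢(Plane × (Fin n → Mink), (Fin n → Fin K) → ℂ)) (s : Plane) (p : Fin (n + 1) → Mink) :
    momentumAction κe κm χ ℓ f n G (s, p) =
      Complex.exp (Complex.I * (weylPhase κe κm (toMat ℓ) (p 0) s : ℂ)) •
        χ ℓ • mulComponents K n (ft f (p 0)) (G (s + shift κe κm (toMat ℓ) (p 0), Fin.tail p)) :=
  weylKernel_apply κe κm _ χ (ft f) G ℓ (p 0) s (Fin.tail p)

lemma fourierN_slice_action {χ : 𝓢(MatSpace, ℂ)} {ℓ : MatSpace} (hχ : χ ℓ = 1) (f : Test K)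
    {n : ℕ} (G : 𝓢(Plane × (Fin n → Mink), (Fin n → Fin K) → ℂ)) (s : Plane)
    (p : Fin (n + 1) → Mink) (k : Fin (n + 1) → Fin K) :
    fourierN (slice s (action κe κm χ ℓ f n G)) p k = fourier f (p 0) (k 0) *
      weyl κe κm (toMat ℓ) (p 0)
        (fun s' => fourierN (slice s' G) (Fin.tail p) (Fin.tail k)) s := by
  change fourierN (sliceCLM s (action κe κm χ ℓ f n G)) p k = fourier f (p 0) (k 0) *
      weyl κe κm (toMat ℓ) (p 0)
        (fun s' => fourierN (sliceCLM s' G) (Fin.tail p) (Fin.tail k)) s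
  have h1 : ∀ s', ftN n (sliceCLM s' G) (Fin.tail p) (Fin.tail k) =
      pftN n G (s', Fin.tail p) (Fin.tail k) := fun s' => by
    rw [← slice_pftN, sliceCLM_apply]
  simp only [fourierN_eq, fourier_eq, h1, action, ContinuousLinearMap.comp_apply]
  rw [ftN_slice_piftN, sliceCLM_apply, momentumAction_apply, hχ, one_smul, weyl_eq, Pi.smul_apply,
    mulComponents_apply, smul_eq_mul]
  ring

/-- The matrix `ℓ i` enters only through a slice, which does not increase seminorms; every other
step is a continuous linear map independent of `i`. -/
lemma seminorm_action_bounded {ι : Type*} (χ : 𝓢(MatSpace, ℂ)) (ℓ : ι → MatSpace) (f : Test K)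
    {n : ℕ} (g : ι → 𝓢(Plane × (Fin n → Mink), (Fin n → Fin K) → ℂ))
    (hg : ∀ a b : ℕ, ∃ C, ∀ i, SchwartzMap.seminorm ℂ a b (g i) ≤ C) (a b : ℕ) :
    ∃ C, ∀ i, SchwartzMap.seminorm ℂ a b (action κe κm χ (ℓ i) f n (g i)) ≤ C := by
  have h1 := bounded_family_map ((weylKernel κe κm (mulComponents K n) χ (ft f)).comp (pftN n)) g hg
  have h2 : ∀ a b : ℕ, ∃ C, ∀ i, SchwartzMap.seminorm ℂ a b (sliceCLM (ℓ i)
      (weylKernel κe κm (mulComponents K n) χ (ft f) (pftN n (g i)))) ≤ C := fun a b => by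
    obtain ⟨C, hC⟩ := h1 a b
    exact ⟨C, fun i => (seminorm_slice_le _ a b _).trans (hC i)⟩
  exact bounded_family_map ((piftN (n + 1)).comp
    (SchwartzMap.compCLMOfContinuousLinearEquiv ℂ (frontCLE n))) _ h2 a b

/-- A family of Schwartz functions that is measurable pointwise is weakly measurable. -/
theorem stronglyMeasurable_clm_plane {V : Type} [NormedAddCommGroup V] [NormedSpace ℂ V]
    [FiniteDimensional ℂ V] {H : Type*} [NormedAddCommGroup H] [NormedSpace ℂ H] [CompleteSpace H]
    {Θ : Type*} [MeasurableSpace Θ] {n : ℕ} (g : Θ → 𝓢(Plane × (Fin n → Mink), V))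
    (hg : ∀ z, StronglyMeasurable fun θ => g θ z) (W : 𝓢(Plane × (Fin n → Mink), V) →L[ℂ] H) :
    StronglyMeasurable fun θ => W (g θ) := by
  have : CompleteSpace V := FiniteDimensional.complete ℂ V
  refine stronglyMeasurable_clm_prod g (fun W u => ?_) W
  exact stronglyMeasurable_clm (fun θ => sliceCLM u (g θ)) (fun x => hg _) W

/-- Evaluation at a point. -/
def evalCLM {X V : Type} [NormedAddCommGroup X] [NormedSpace ℝ X] [NormedAddCommGroup V]
    [NormedSpace ℂ V] (x : X) : 𝓢(X, V) →L[ℂ] V :=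
  (BoundedContinuousFunction.evalCLM ℂ x).comp (SchwartzMap.toBoundedContinuousFunctionCLM ℂ X V)

lemma continuous_shift (p : Mink) : Continuous fun ℓ : MatSpace => shift κe κm (toMat ℓ) p :=
  (hasTemperateGrowth_shift κe κm (f := fun ℓ : MatSpace => ℓ) (g := fun _ => p)
      (by fun_prop) (by fun_prop)).1.continuous

lemma continuous_cexp_weylPhase (p : Mink) (s : Plane) : Continuous fun ℓ : MatSpace =>
    Complex.exp (Complex.I * (weylPhase κe κm (toMat ℓ) p s : ℂ)) := by
  have h : (fun ℓ : MatSpace => Complex.exp (Complex.I *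
    (weylPhase κe κm (toMat ℓ) p s : ℂ))).HasTemperateGrowth := by fun_prop
  exact h.1.continuous

/-- The family is evaluated at a point that itself depends on `θ`. This is harmless because
continuity in `s` and measurability in `θ` give joint measurability. -/
lemma stronglyMeasurable_momentumAction {Θ : Type*} [MeasurableSpace Θ] (χ : 𝓢(MatSpace, ℂ))
    {ℓ : Θ → MatSpace} (hℓ : Measurable ℓ) (f : Test K) {n : ℕ}
    (g : Θ → 𝓢(Plane × (Fin n → Mink), (Fin n → Fin K) → ℂ))
    (hg : ∀ z, StronglyMeasurable fun θ => g θ z) (z : Plane × (Fin (n + 1) → Mink)) :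
    StronglyMeasurable fun θ => momentumAction κe κm χ (ℓ θ) f n (g θ) z := by
  have h2 : StronglyMeasurable fun w : Plane × Θ => g w.2 (w.1, Fin.tail z.2) :=
    stronglyMeasurable_uncurry_of_continuous_of_stronglyMeasurable
      (u := fun (s : Plane) θ => g θ (s, Fin.tail z.2))
      (fun θ => (g θ).continuous.comp (by fun_prop)) (fun s => hg _)
  have h3 : Measurable fun θ => (z.1 + shift κe κm (toMat (ℓ θ)) (z.2 0), θ) :=
    Measurable.prodMk (Measurable.const_add ((continuous_shift κe κm _).measurable.comp hℓ) _)
      measurable_id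
  have h4 : StronglyMeasurable fun θ => mulComponents K n (ft f (z.2 0))
      (g θ (z.1 + shift κe κm (toMat (ℓ θ)) (z.2 0), Fin.tail z.2)) :=
    (mulComponents K n (ft f (z.2 0))).continuous.comp_stronglyMeasurable (h2.comp_measurable h3)
  have h5 : (fun θ => momentumAction κe κm χ (ℓ θ) f n (g θ) z) = fun θ =>
      Complex.exp (Complex.I * (weylPhase κe κm (toMat (ℓ θ)) (z.2 0) z.1 : ℂ)) •
        χ (ℓ θ) • mulComponents K n (ft f (z.2 0))
          (g θ (z.1 + shift κe κm (toMat (ℓ θ)) (z.2 0), Fin.tail z.2)) :=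
    funext fun θ => momentumAction_apply κe κm χ (ℓ θ) f n _ z.1 z.2
  rw [h5]
  have h6 : StronglyMeasurable fun θ => χ (ℓ θ) :=
    χ.continuous.comp_stronglyMeasurable hℓ.stronglyMeasurable
  have h7 : StronglyMeasurable fun θ =>
      Complex.exp (Complex.I * (weylPhase κe κm (toMat (ℓ θ)) (z.2 0) z.1 : ℂ)) :=
    (continuous_cexp_weylPhase κe κm (z.2 0) z.1).comp_stronglyMeasurable hℓ.stronglyMeasurable
  exact h7.smul (h6.smul h4)

/-- A value of a Fourier transform is a continuous functional, so weak measurability carries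
pointwise measurability through the transform and its inverse. -/
lemma stronglyMeasurable_action {Θ : Type*} [MeasurableSpace Θ] (χ : 𝓢(MatSpace, ℂ))
    {ℓ : Θ → MatSpace} (hℓ : Measurable ℓ) (f : Test K) {n : ℕ}
    (g : Θ → 𝓢(Plane × (Fin n → Mink), (Fin n → Fin K) → ℂ))
    (hg : ∀ z, StronglyMeasurable fun θ => g θ z) (z : Plane × (Fin (n + 1) → Mink)) :
    StronglyMeasurable fun θ => action κe κm χ (ℓ θ) f n (g θ) z := by
  have h1 : ∀ z, StronglyMeasurable fun θ => pftN n (g θ) z := fun z =>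
    stronglyMeasurable_clm_plane g hg ((evalCLM z).comp (pftN n))
  exact stronglyMeasurable_clm_plane _
    (stronglyMeasurable_momentumAction κe κm χ hℓ f _ h1) ((evalCLM z).comp (piftN (n + 1)))

end Action

/-! ### Existence and uniqueness of `f × g` -/

section Existence

variable {κe κm : ℝ} {K : ℕ} {Λ : Spec κe κm → Matrix (Fin 4) (Fin 4) ℝ}

/-- A matrix as a point of `ℝ¹⁶`. -/
def ofMat (L : Matrix (Fin 4) (Fin 4) ℝ) : MatSpace := WithLp.toLp 2 fun i => L i.1 i.2

lemma IsFrame.measurable_ofMat (hΛ : IsFrame κe κm Λ) : Measurable fun θ => ofMat (Λ θ) := by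
  refine (EuclideanSpace.equiv (Fin 4 × Fin 4) ℝ).symm.continuous.measurable.comp
    (g := (EuclideanSpace.equiv (Fin 4 × Fin 4) ℝ).symm) (f := fun θ i => Λ θ i.1 i.2) ?_
  exact measurable_pi_lambda _ fun i => hΛ.measurable i.1 i.2

lemma IsFrame.exists_cutoff (hΛ : IsFrame κe κm Λ) {C : Set (Spec κe κm)} (hC : IsCompact C) :
    ∃ χ : 𝓢(MatSpace, ℂ), ∀ θ ∈ C, χ (ofMat (Λ θ)) = 1 := by
  obtain ⟨B, hB⟩ := hΛ.bounded C hC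
  -- The radius is the Euclidean norm of a matrix whose sixteen entries all equal `B`.
  obtain ⟨χ, hχ⟩ := exists_schwartz_eq_one MatSpace (Real.sqrt (∑ _i : Fin 4 × Fin 4, B ^ 2))
  refine ⟨χ, fun θ hθ => hχ _ ?_⟩
  rw [EuclideanSpace.norm_eq]
  refine Real.sqrt_le_sqrt (Finset.sum_le_sum fun i _ => ?_)
  exact pow_le_pow_left₀ (norm_nonneg _) (hB θ hθ i.1 i.2) 2

lemma slice_injective {n : ℕ} {G G' : 𝓢(Plane × (Fin n → Mink), (Fin n → Fin K) → ℂ)}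
    (h : ∀ s, slice s G = slice s G') : G = G' := by
  ext z : 1
  exact congrArg (fun F => F z.2) (h z.1)

lemma IsAction.unique {f : Test K} {g h h' : BigTest κe κm K} (hh : IsAction Λ f g h)
    (hh' : IsAction Λ f g h') : h = h' := by
  funext n
  cases n with
  | zero => rw [hh.1, hh'.1]
  | succ n =>
    funext θ
    refine slice_injective fun s => fourierN_injective fun p k => ?_
    rw [hh.2, hh'.2]

lemma weyl_zero_fun (L : Matrix (Fin 4) (Fin 4) ℝ) (p : Mink) (s : Plane) :
    weyl κe κm L p (fun _ => 0) s = 0 := by simp [weyl]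

lemma fourierN_zero {n : ℕ} (p : Fin n → Mink) (k : Fin n → Fin K) :
    fourierN (0 : TestN K n) p k = 0 := by simp [fourierN]

/-- Existence of `f × g`. -/
theorem exists_isAction (hΛ : IsFrame κe κm Λ) (f : Test K) {g : BigTest κe κm K}
    (hg : IsBigTest g) : ∃ h : BigTest κe κm K, IsBigTest h ∧ IsAction Λ f g h := by
  choose C hC hgC using hg.support
  -- One cutoff for each degree, equal to one on the frames over the support of `g n`. Off this
  -- support both sides of the defining equation vanish, so the cutoff leaves no trace.
  choose χ hχ using fun n => hΛ.exists_cutoff (hC n)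
  let h : BigTest κe κm K := fun n => match n with
    | 0 => 0
    | n + 1 => fun θ => action κe κm (χ n) (ofMat (Λ θ)) f n (g n θ)
  obtain ⟨N, hN⟩ := hg.terminating
  refine ⟨h, ⟨⟨N + 1, fun n hn => ?_⟩, fun n z => ?_, fun n a b => ?_, fun n => ?_⟩, rfl, ?_⟩
  · obtain ⟨m, rfl⟩ : ∃ m, n = m + 1 := ⟨n - 1, by omega⟩
    funext θ
    change action κe κm (χ m) (ofMat (Λ θ)) f m (g m θ) = 0
    rw [hN m (by omega)]
    exact map_zero _
  · cases n with
    | zero => exact measurable_const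
    | succ n =>
      exact (stronglyMeasurable_action κe κm (χ n) hΛ.measurable_ofMat f (g n)
        (fun z => (hg.measurable n z).stronglyMeasurable) z).measurable
  · cases n with
    | zero => exact ⟨0, fun θ => (map_zero _).le⟩
    | succ n =>
      exact seminorm_action_bounded κe κm (χ n) (fun θ => ofMat (Λ θ)) f (g n) (hg.bounded n) a b
  · cases n with
    | zero => exact ⟨∅, isCompact_empty, fun _ _ => rfl⟩
    | succ n =>
      refine ⟨C n, hC n, fun θ hθ => ?_⟩
      change action κe κm (χ n) (ofMat (Λ θ)) f n (g n θ) = 0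
      rw [hgC n θ hθ]
      exact map_zero _
  · intro n θ s p k
    by_cases hθ : θ ∈ C n
    · exact fourierN_slice_action κe κm (hχ n θ hθ) f (g n θ) s p k
    · have h1 : h (n + 1) θ = 0 := by
        change action κe κm (χ n) (ofMat (Λ θ)) f n (g n θ) = 0
        rw [hgC n θ hθ]
        exact map_zero _
      rw [h1, hgC n θ hθ]
      simp only [map_zero, fourierN_zero, weyl_zero_fun, mul_zero]

end Existence

/-! ### The adjoint relation in a single fibre -/

section WeylTest

variable (κe κm : ℝ) {K : ℕ}

/-- A function of `s` as a function of `s` and no further variables. -/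
def planeCLE : (Plane × (Fin 0 → Mink)) ≃L[ℝ] Plane :=
  LinearEquiv.toContinuousLinearEquiv
    { toFun := fun z => z.1
      map_add' := fun _ _ => rfl
      map_smul' := fun _ _ => rfl
      invFun := fun s => (s, 0)
      left_inv := fun _ => Prod.ext rfl (Subsingleton.elim _ _)
      right_inv := fun _ => rfl }

/-- Moving the spacetime variable to the front. -/
def planeFrontCLE : (Plane × Mink) ≃L[ℝ] Mink × (Plane × (Fin 0 → Mink)) :=
  LinearEquiv.toContinuousLinearEquiv
    { toFun := fun z => (z.2, (z.1, 0))
      map_add' := fun _ _ => by simp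
      map_smul' := fun _ _ => by simp
      invFun := fun z => (z.2.1, z.1)
      left_inv := fun _ => rfl
      right_inv := fun z => Prod.ext rfl (Prod.ext rfl (Subsingleton.elim _ _)) }

/-- The test functions, depending on `s`, with Fourier transform `f̃(p) (e^{ip·X} u)(s)`. -/
def weylTest (χ : 𝓢(MatSpace, ℂ)) (ℓ : MatSpace) (f : Test K) (u : 𝓢(Plane, ℂ)) :
    𝓢(Plane × Mink, Fin K → ℂ) :=
  pift (SchwartzMap.compCLMOfContinuousLinearEquiv ℂ planeFrontCLE (sliceCLM ℓ
    (weylKernel κe κm (ContinuousLinearMap.lsmul ℂ ℂ).flip χ (ft f)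
      (SchwartzMap.compCLMOfContinuousLinearEquiv ℂ planeCLE u))))

lemma fourier_slice_weylTest {χ : 𝓢(MatSpace, ℂ)} {ℓ : MatSpace} (hχ : χ ℓ = 1) (f : Test K)
    (u : 𝓢(Plane, ℂ)) (s : Plane) (p : Mink) (k : Fin K) :
    fourier (sliceCLM s (weylTest κe κm χ ℓ f u)) p k =
      fourier f p k * weyl κe κm (toMat ℓ) p u s := by
  rw [fourier_eq, weylTest, ft_slice_pift, sliceCLM_apply]
  change weylKernel κe κm (ContinuousLinearMap.lsmul ℂ ℂ).flip χ (ft f)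
      (SchwartzMap.compCLMOfContinuousLinearEquiv ℂ planeCLE u) (ℓ, (p, (s, 0))) k = _
  rw [weylKernel_apply, hχ, one_smul, fourier_eq, weyl_eq]
  change _ * (u (s + shift κe κm (toMat ℓ) p) * ft f p k) = _
  ring

/-- On a product the Weyl operator touches only `u`. The noncommutativity is thus shifted into an
`s`-dependent test function for one undeformed field, and `G` is left alone. -/
lemma slice_action_smulTensor {χ : 𝓢(MatSpace, ℂ)} {ℓ : MatSpace} (hχ : χ ℓ = 1) (f : Test K)
    {n : ℕ} (u : 𝓢(Plane, ℂ)) (G : TestN K n) (s : Plane) :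
    sliceCLM s (action κe κm χ ℓ f n (smulTensor u G)) =
      consTensor (sliceCLM s (weylTest κe κm χ ℓ f u)) G := by
  refine fourierN_injective fun p k => ?_
  rw [fourierN_consTensor, fourier_slice_weylTest κe κm hχ]
  refine (fourierN_slice_action κe κm hχ f _ s p k).trans ?_
  have h : ∀ s', fourierN (slice s' (smulTensor u G)) (Fin.tail p) (Fin.tail k) =
      u s' * fourierN G (Fin.tail p) (Fin.tail k) := fun s' => by
    have : slice s' (smulTensor u G) = u s' • G := rfl
    rw [this, fourierN_eq, fourierN_eq, map_smul]
    rfl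
  simp only [h, weyl_eq]
  ring

lemma conj_temperate (u : 𝓢(Plane, ℂ)) :
    (fun z : Plane × Mink => (starRingEnd ℂ) (u z.1)).HasTemperateGrowth :=
  (Complex.conjCLE : ℂ →L[ℝ] ℂ).hasTemperateGrowth.comp
    (u.hasTemperateGrowth.comp (by fun_prop))

/-- The average of `weylTest` over `s` with the weight `conj u'`. -/
def weylAverage (χ : 𝓢(MatSpace, ℂ)) (ℓ : MatSpace) (f : Test K) (u u' : 𝓢(Plane, ℂ)) : Test K :=
  integrateCLM (SchwartzMap.smulLeftCLM (Fin K → ℂ)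
    (fun z : Plane × Mink => (starRingEnd ℂ) (u' z.1)) (weylTest κe κm χ ℓ f u))

lemma clm_weylAverage {H : Type*} [NormedAddCommGroup H] [NormedSpace ℂ H] [CompleteSpace H]
    (χ : 𝓢(MatSpace, ℂ)) (ℓ : MatSpace) (f : Test K) (u u' : 𝓢(Plane, ℂ)) (W : Test K →L[ℂ] H) :
    W (weylAverage κe κm χ ℓ f u u') =
      ∫ s, (starRingEnd ℂ) (u' s) • W (sliceCLM s (weylTest κe κm χ ℓ f u)) := by
  rw [weylAverage, clm_integrate]
  refine integral_congr_ae (.of_forall fun s => ?_)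
  simp only
  rw [← map_smul]
  congr 1
  ext x : 1
  rw [sliceCLM_apply, SchwartzMap.smulLeftCLM_apply_apply (conj_temperate u')]
  rfl

lemma fourier_weylAverage {χ : 𝓢(MatSpace, ℂ)} {ℓ : MatSpace} (hχ : χ ℓ = 1) (f : Test K)
    (u u' : 𝓢(Plane, ℂ)) (p : Mink) (k : Fin K) :
    fourier (weylAverage κe κm χ ℓ f u u') p k = fourier f p k *
      ∫ s, (starRingEnd ℂ) (u' s) * weyl κe κm (toMat ℓ) p u s := by
  have h := clm_weylAverage κe κm χ ℓ f u u'
    ((ContinuousLinearMap.proj (R := ℂ) (φ := fun _ : Fin K => ℂ) k).comp ((evalCLM p).comp ft))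
  rw [fourier_eq]
  refine h.trans ?_
  rw [← integral_const_mul]
  refine integral_congr_ae (.of_forall fun s => ?_)
  have h1 := fourier_slice_weylTest κe κm hχ f u s p k
  rw [fourier_eq] at h1
  change _ • (ft (sliceCLM s (weylTest κe κm χ ℓ f u)) p k) = _
  rw [h1, smul_eq_mul]
  ring

lemma coeff_neg (L : Matrix (Fin 4) (Fin 4) ℝ) (p : Mink) (ν : Fin 4) :
    coeff L (-p) ν = -coeff L p ν := by
  have := coeff_smul L (-1) p ν
  simpa using this

lemma shift_neg (L : Matrix (Fin 4) (Fin 4) ℝ) (p : Mink) :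
    shift κe κm L (-p) = -shift κe κm L p := by
  have := shift_smul κe κm L (-1) p
  simpa using this

/-- The adjoint of `e^{ip·X}` is `e^{-ip·X}`. -/
lemma integral_conj_mul_weyl (L : Matrix (Fin 4) (Fin 4) ℝ) (p : Mink) (u u' : Plane → ℂ) :
    ∫ s, (starRingEnd ℂ) (u s) * weyl κe κm L p u' s =
      (starRingEnd ℂ) (∫ s, (starRingEnd ℂ) (u' s) * weyl κe κm L (-p) u s) := by
  -- Translation invariance of Lebesgue measure moves the shift from one factor to the other; the
  -- two phases then match.
  rw [← integral_conj, ← integral_add_right_eq_self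
    (fun s => (starRingEnd ℂ) ((starRingEnd ℂ) (u' s) * weyl κe κm L (-p) u s)) (shift κe κm L p)]
  refine integral_congr_ae (.of_forall fun s => ?_)
  simp only [weyl_eq, shift_neg, add_neg_cancel_right, map_mul, Complex.conj_conj,
    ← Complex.exp_conj, Complex.conj_I, Complex.conj_ofReal]
  have h : -Complex.I * (weylPhase κe κm L (-p) (s + shift κe κm L p) : ℂ) =
      Complex.I * (weylPhase κe κm L p s : ℂ) := by
    simp only [weylPhase, coeff_neg, shift]
    simp
    ring
  rw [h]
  ring

/-- The involution conjugates Fourier transforms and reverses the momentum, and so does exchanging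
`u` and `u'` in the matrix element of `e^{ip·X}`. Here the adjoint of the Weyl operator and that of
the field meet. -/
lemma weylAverage_starTest {χ : 𝓢(MatSpace, ℂ)} {ℓ : MatSpace} (hχ : χ ℓ = 1)
    (bar : Fin K → Fin K) (f : Test K) (u u' : 𝓢(Plane, ℂ)) :
    weylAverage κe κm χ ℓ (starTest bar f) u' u =
      starTest bar (weylAverage κe κm χ ℓ f u u') := by
  refine fourier_injective fun p k => ?_
  rw [fourier_weylAverage κe κm hχ, fourier_starTest, fourier_starTest,
    fourier_weylAverage κe κm hχ, map_mul, integral_conj_mul_weyl]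

end WeylTest

/-! ### The pairing of test functions in a single fibre -/

section Pairing

variable {Y V : Type} [NormedAddCommGroup Y] [NormedSpace ℝ Y] [NormedAddCommGroup V]
  [NormedSpace ℂ V] {H : Type*} [NormedAddCommGroup H] [InnerProductSpace ℂ H]
  {Y' V' : Type} [NormedAddCommGroup Y'] [NormedSpace ℝ Y'] [NormedAddCommGroup V']
  [NormedSpace ℂ V'] 

lemma exists_slice_bound (W : 𝓢(Y, V) →L[ℂ] H) : ∃ (s : Finset (ℕ × ℕ)) (C : ℝ), 0 ≤ C ∧
    ∀ (G : 𝓢(Plane × Y, V)) (x : Plane),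
      ‖W (sliceCLM x G)‖ ≤ C * s.sup (schwartzSeminormFamily ℂ (Plane × Y) V) G := by
  obtain ⟨s, C, hC, h⟩ := exists_bound_clm W
  refine ⟨s, C, hC, fun G x => (h _).trans ?_⟩
  gcongr
  refine Seminorm.finset_sup_apply_le (apply_nonneg _ _) fun q hq => ?_
  exact (seminorm_slice_le G q.1 q.2 x).trans
    (Seminorm.le_finset_sup_apply (p := schwartzSeminormFamily ℂ (Plane × Y) V) hq)

lemma integrable_inner_slice (W' : 𝓢(Y', V') →L[ℂ] H) (F : 𝓢(Plane × Y', V'))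
    (W : 𝓢(Y, V) →L[ℂ] H) (G : 𝓢(Plane × Y, V)) :
    Integrable fun s => ⟪W' (sliceCLM s F), W (sliceCLM s G)⟫_ℂ := by
  obtain ⟨t, C, hC, h⟩ := exists_slice_bound W
  refine ((integrable_clm_slice W' F).norm.mul_const
    (C * t.sup (schwartzSeminormFamily ℂ (Plane × Y) V) G)).mono'
    (Continuous.aestronglyMeasurable ?_) (.of_forall fun s => ?_)
  · exact (W'.continuous.comp (continuous_slice F)).inner (W.continuous.comp (continuous_slice G))
  · exact (norm_inner_le_norm _ _).trans (mul_le_mul_of_nonneg_left (h G s) (norm_nonneg _))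

/-- The continuous functional `G ↦ ∫ ds ⟨W'(F_s), W(G_s)⟩`. -/
def pairing (W' : 𝓢(Y', V') →L[ℂ] H) (F : 𝓢(Plane × Y', V')) (W : 𝓢(Y, V) →L[ℂ] H) :
    𝓢(Plane × Y, V) →L[ℂ] ℂ :=
  SchwartzMap.mkCLMtoNormedSpace (fun G => ∫ s, ⟪W' (sliceCLM s F), W (sliceCLM s G)⟫_ℂ)
    (fun G G' => by
      simp only [map_add, inner_add_right]
      exact integral_add (integrable_inner_slice W' F W G) (integrable_inner_slice W' F W G'))
    (fun c G => by
      simp only [map_smul, inner_smul_right]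
      exact integral_const_mul _ _)
    (by
      obtain ⟨t, C, hC, h⟩ := exists_slice_bound W
      refine ⟨t, (∫ s, ‖W' (sliceCLM s F)‖) * C, by positivity, fun G => ?_⟩
      rw [mul_assoc, ← integral_mul_const]
      refine norm_integral_le_of_norm_le ((integrable_clm_slice W' F).norm.mul_const _)
        (.of_forall fun s => ?_)
      exact (norm_inner_le_norm _ _).trans (mul_le_mul_of_nonneg_left (h G s) (norm_nonneg _)))

lemma pairing_apply (W' : 𝓢(Y', V') →L[ℂ] H) (F : 𝓢(Plane × Y', V')) (W : 𝓢(Y, V) →L[ℂ] H)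
    (G : 𝓢(Plane × Y, V)) :
    pairing W' F W G = ∫ s, ⟪W' (sliceCLM s F), W (sliceCLM s G)⟫_ℂ := rfl

lemma conj_pairing (W' : 𝓢(Y', V') →L[ℂ] H) (F : 𝓢(Plane × Y', V')) (W : 𝓢(Y, V) →L[ℂ] H)
    (G : 𝓢(Plane × Y, V)) : (starRingEnd ℂ) (pairing W' F W G) = pairing W G W' F := by
  rw [pairing_apply, pairing_apply, ← integral_conj]
  simp only [inner_conj_symm]

end Pairing

/-! ### The adjoint relation for the undeformed vectors in a single fibre -/

section Fibre

variable (κe κm : ℝ) {K : ℕ} {H : Type*} [NormedAddCommGroup H] [InnerProductSpace ℂ H]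
  [CompleteSpace H] (T : Theory K H)

/-- The matrix elements `f ↦ ⟨v, φ(f) w⟩`. -/
def Theory.matrixElement (v w : T.D) : Test K →L[ℂ] ℂ where
  toFun f := ⟪(v : H), (T.φ f w : H)⟫_ℂ
  map_add' f g := by simp
  map_smul' c f := by simp
  cont := T.φ_tempered v w

/-- Since matrix elements of `φ` are tempered, the integral over `s` passes into the argument of the
field, where it becomes the averaged test function. -/
lemma pairing_smulTensor_action {χ : 𝓢(MatSpace, ℂ)} {ℓ : MatSpace} (hχ : χ ℓ = 1) (f : Test K)
    {m n : ℕ} (u u' : 𝓢(Plane, ℂ)) (F : TestN K m) (G : TestN K n) :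
    pairing (T.Ψ m) (smulTensor u' F) (T.Ψ (n + 1)) (action κe κm χ ℓ f n (smulTensor u G)) =
      ⟪T.Ψ m F, (T.φ (weylAverage κe κm χ ℓ f u u') ⟨T.Ψ n G, T.Ψ_mem n G⟩ : H)⟫_ℂ := by
  have h := clm_weylAverage κe κm χ ℓ f u u'
    (T.matrixElement ⟨T.Ψ m F, T.Ψ_mem m F⟩ ⟨T.Ψ n G, T.Ψ_mem n G⟩)
  refine Eq.trans ?_ h.symm
  rw [pairing_apply]
  refine integral_congr_ae (.of_forall fun s => ?_)
  change ⟪T.Ψ m (u' s • F), T.Ψ (n + 1) (sliceCLM s (action κe κm χ ℓ f n (smulTensor u G)))⟫_ℂ =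
    (starRingEnd ℂ) (u' s) • ⟪T.Ψ m F, (T.φ (sliceCLM s (weylTest κe κm χ ℓ f u))
      ⟨T.Ψ n G, T.Ψ_mem n G⟩ : H)⟫_ℂ
  rw [slice_action_smulTensor κe κm hχ, T.φ_Ψ, map_smul, inner_smul_left, smul_eq_mul]

/-- `∫ ds ⟨Ψ(F_s), Ψ((f × G)_s)⟩ = ∫ ds ⟨Ψ((f* × F)_s), Ψ(G_s)⟩`. -/
theorem pairing_action {χ : 𝓢(MatSpace, ℂ)} {ℓ : MatSpace} (hχ : χ ℓ = 1) (f : Test K)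
    {m n : ℕ} (F : 𝓢(Plane × (Fin m → Mink), (Fin m → Fin K) → ℂ))
    (G : 𝓢(Plane × (Fin n → Mink), (Fin n → Fin K) → ℂ)) :
    pairing (T.Ψ m) F (T.Ψ (n + 1)) (action κe κm χ ℓ f n G) =
      pairing (T.Ψ (m + 1)) (action κe κm χ ℓ (starTest T.bar f) m F) (T.Ψ n) G := by
  suffices h : (pairing (T.Ψ m) F (T.Ψ (n + 1))).comp (action κe κm χ ℓ f n) -
      pairing (T.Ψ (m + 1)) (action κe κm χ ℓ (starTest T.bar f) m F) (T.Ψ n) = 0 from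
    sub_eq_zero.1 (congrArg (fun W => W G) h)
  refine clm_eq_zero_of_tensor _ fun u G => sub_eq_zero.2 ?_
  change pairing (T.Ψ m) F (T.Ψ (n + 1)) (action κe κm χ ℓ f n (smulTensor u G)) =
    pairing (T.Ψ (m + 1)) (action κe κm χ ℓ (starTest T.bar f) m F) (T.Ψ n) (smulTensor u G)
  -- `G` is now a product. The pairing is antilinear in its first entry, so conjugation exchanges
  -- the entries before the same density argument is applied to `F`.
  rw [← conj_pairing, ← conj_pairing (T.Ψ n)]
  congr 1
  suffices h : pairing (T.Ψ (n + 1)) (action κe κm χ ℓ f n (smulTensor u G)) (T.Ψ m) -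
      (pairing (T.Ψ n) (smulTensor u G) (T.Ψ (m + 1))).comp
        (action κe κm χ ℓ (starTest T.bar f) m) = 0 from
    sub_eq_zero.1 (congrArg (fun W => W F) h)
  refine clm_eq_zero_of_tensor _ fun u' F => sub_eq_zero.2 ?_
  change pairing (T.Ψ (n + 1)) (action κe κm χ ℓ f n (smulTensor u G)) (T.Ψ m) (smulTensor u' F) =
    pairing (T.Ψ n) (smulTensor u G) (T.Ψ (m + 1))
      (action κe κm χ ℓ (starTest T.bar f) m (smulTensor u' F))
  rw [← conj_pairing, pairing_smulTensor_action κe κm T hχ, pairing_smulTensor_action κe κm T hχ,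
    weylAverage_starTest κe κm hχ, inner_conj_symm]
  have := T.φ_adjoint (weylAverage κe κm χ ℓ f u u') ⟨T.Ψ m F, T.Ψ_mem m F⟩ ⟨T.Ψ n G, T.Ψ_mem n G⟩
  rw [← inner_conj_symm, this, inner_conj_symm]

end Fibre

/-! ### The surface measure of the joint spectrum -/

section Measure

lemma perm_fin_four_values : (Finset.univ : Finset (Equiv.Perm (Fin 4))).val.map
    (fun τ => (((Equiv.Perm.sign τ : ℤˣ) : ℤ), τ 0, τ 1, τ 2, τ 3)) =
    ([(1, 0, 1, 2, 3), (-1, 0, 1, 3, 2), (-1, 0, 2, 1, 3), (1, 0, 2, 3, 1), (1, 0, 3, 1, 2),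
      (-1, 0, 3, 2, 1), (-1, 1, 0, 2, 3), (1, 1, 0, 3, 2), (1, 1, 2, 0, 3), (-1, 1, 2, 3, 0),
      (-1, 1, 3, 0, 2), (1, 1, 3, 2, 0), (1, 2, 0, 1, 3), (-1, 2, 0, 3, 1), (-1, 2, 1, 0, 3),
      (1, 2, 1, 3, 0), (1, 2, 3, 0, 1), (-1, 2, 3, 1, 0), (-1, 3, 0, 1, 2), (1, 3, 0, 2, 1),
      (1, 3, 1, 0, 2), (-1, 3, 1, 2, 0), (-1, 3, 2, 0, 1), (1, 3, 2, 1, 0)] :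
      List (ℤ × Fin 4 × Fin 4 × Fin 4 × Fin 4)) := by
  decide +kernel

/-- The three terms are those of the Pfaffian; each corresponds to eight of the twenty-four
permutations. -/
lemma sum_sign_mul {a : Fin 4 → Fin 4 → ℝ} (ha : ∀ i j, a j i = -a i j) :
    ∑ τ : Equiv.Perm (Fin 4), (Equiv.Perm.sign τ : ℝ) * (a (τ 0) (τ 1) * a (τ 2) (τ 3)) =
      8 * (a 0 1 * a 2 3 - a 0 2 * a 1 3 + a 0 3 * a 1 2) := by
  have h := congrArg (fun m => (Multiset.map (fun e : ℤ × Fin 4 × Fin 4 × Fin 4 × Fin 4 =>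
    (e.1 : ℝ) * (a e.2.1 e.2.2.1 * a e.2.2.2.1 e.2.2.2.2)) m).sum) perm_fin_four_values
  simp only [Multiset.map_map, Function.comp_def] at h
  refine h.trans ?_
  simp only [Multiset.map_coe, List.map_cons, List.map_nil, Multiset.sum_coe, List.sum_cons,
    List.sum_nil, ha 0 1, ha 0 2, ha 0 3, ha 1 2, ha 1 3, ha 2 3]
  push_cast
  ring

/-- The complex field strength `E + iB` of an antisymmetric matrix. -/
def fieldStrength (θ : MatSpace) : Fin 3 → ℂ :=
  ![⟨θ (0, 1), θ (2, 3)⟩, ⟨θ (0, 2), θ (3, 1)⟩, ⟨θ (0, 3), θ (1, 2)⟩]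

lemma continuous_fieldStrength (k : Fin 3) : Continuous fun θ => fieldStrength θ k := by
  have h : ∀ i j : Fin 4 × Fin 4, Continuous fun θ : MatSpace => (⟨θ i, θ j⟩ : ℂ) := fun i j => by
    simp only [Complex.mk_eq_add_mul_I]
    fun_prop
  fin_cases k <;> exact h _ _

variable {κe κm : ℝ}

lemma Spec.antisymm {θ : MatSpace} (hθ : θ ∈ Spec κe κm) (i j : Fin 4) :
    θ (j, i) = -θ (i, j) := by
  simpa [toMat] using congrFun (congrFun hθ.1 i) j

/-- The two real equations of `Σ` read `E² - B² = κe² - κm²` and `E·B = κe κm`, the real and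
imaginary parts of one complex quadric. -/
lemma Spec.sum_sq_fieldStrength {θ : MatSpace} (hθ : θ ∈ Spec κe κm) :
    fieldStrength θ 0 ^ 2 + fieldStrength θ 1 ^ 2 + fieldStrength θ 2 ^ 2 =
      ((κe : ℂ) + κm * Complex.I) ^ 2 := by
  have ha := Spec.antisymm hθ
  have h1 := hθ.2.1
  have h2 := hθ.2.2
  rw [sum_sign_mul (a := raise (toMat θ)) (fun i j => by simp [raise, toMat, ha i j]; ring)] at h2
  have hd : ∀ i, θ (i, i) = 0 := fun i => by linarith [ha i i]
  simp [raise, toMat, eta, Fin.sum_univ_four, ha 0 1, ha 0 2, ha 0 3, ha 1 2, ha 1 3, ha 2 3,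
    hd] at h1 h2
  have ha31 := ha 1 3
  simp only [fieldStrength, Matrix.cons_val_zero, Matrix.cons_val_one, Matrix.cons_val]
  apply Complex.ext
  · simp [pow_two, ha31]
    linarith
  · simp [pow_two, ha31]
    linarith

lemma Spec.dist_le {θ θ' : MatSpace} (hθ : θ ∈ Spec κe κm) (hθ' : θ' ∈ Spec κe κm) :
    dist θ θ' ≤ 2 * (‖fieldStrength θ 0 - fieldStrength θ' 0‖ +
      ‖fieldStrength θ 1 - fieldStrength θ' 1‖ + ‖fieldStrength θ 2 - fieldStrength θ' 2‖) := by
  have ha := Spec.antisymm hθ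
  have ha' := Spec.antisymm hθ'
  have hd : ∀ i, θ (i, i) = 0 := fun i => by linarith [ha i i]
  have hd' : ∀ i, θ' (i, i) = 0 := fun i => by linarith [ha' i i]
  have hs : ∀ z : ℂ, ‖z‖ ^ 2 = z.re ^ 2 + z.im ^ 2 := fun z => by
    rw [Complex.sq_norm, Complex.normSq_apply]
    ring
  have e0 := hs (fieldStrength θ 0 - fieldStrength θ' 0)
  have e1 := hs (fieldStrength θ 1 - fieldStrength θ' 1)
  have e2 := hs (fieldStrength θ 2 - fieldStrength θ' 2)
  simp only [fieldStrength, Matrix.cons_val_zero, Matrix.cons_val_one, Matrix.cons_val,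
    Complex.sub_re, Complex.sub_im] at e0 e1 e2
  rw [EuclideanSpace.dist_eq]
  refine Real.sqrt_le_iff.2 ⟨by positivity, ?_⟩
  have n0 := norm_nonneg (fieldStrength θ 0 - fieldStrength θ' 0)
  have n1 := norm_nonneg (fieldStrength θ 1 - fieldStrength θ' 1)
  have n2 := norm_nonneg (fieldStrength θ 2 - fieldStrength θ' 2)
  simp only [fieldStrength, Matrix.cons_val_zero, Matrix.cons_val_one, Matrix.cons_val] at n0 n1 n2 ⊢
  have hsum : ∑ i : Fin 4 × Fin 4, dist (θ i) (θ' i) ^ 2 =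
      2 * ((θ (0, 1) - θ' (0, 1)) ^ 2 + (θ (2, 3) - θ' (2, 3)) ^ 2 +
      ((θ (0, 2) - θ' (0, 2)) ^ 2 + (θ (3, 1) - θ' (3, 1)) ^ 2) +
      ((θ (0, 3) - θ' (0, 3)) ^ 2 + (θ (1, 2) - θ' (1, 2)) ^ 2)) := by
    simp only [Fintype.sum_prod_type, Fin.sum_univ_four, Real.dist_eq, sq_abs, ha 0 1, ha 0 2,
      ha 0 3, ha 1 2, ha 1 3, ha 2 3, hd, ha' 0 1, ha' 0 2, ha' 0 3, ha' 1 2, ha' 1 3, ha' 2 3, hd']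
    ring
  rw [hsum, ← e0, ← e1, ← e2]
  nlinarith [mul_nonneg n0 n1, mul_nonneg n0 n2, mul_nonneg n1 n2]

/-- The local coordinates of `Σ`: two of the components of the field strength. -/
def chart (j : Fin 3) (θ : MatSpace) : Fin 4 → ℝ :=
  ![(fieldStrength θ (j + 1)).re, (fieldStrength θ (j + 1)).im,
    (fieldStrength θ (j + 2)).re, (fieldStrength θ (j + 2)).im]

lemma norm_sub_le_dist_chart (j : Fin 3) (θ θ' : MatSpace) :
    ‖fieldStrength θ (j + 1) - fieldStrength θ' (j + 1)‖ ≤ 2 * dist (chart j θ) (chart j θ') ∧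
    ‖fieldStrength θ (j + 2) - fieldStrength θ' (j + 2)‖ ≤ 2 * dist (chart j θ) (chart j θ') := by
  have h := fun i => dist_le_pi_dist (chart j θ) (chart j θ') i
  have h0 := h 0
  have h1 := h 1
  have h2 := h 2
  have h3 := h 3
  simp only [chart, Real.dist_eq, Matrix.cons_val_zero, Matrix.cons_val_one, Matrix.cons_val]
    at h0 h1 h2 h3
  constructor
  · refine (Complex.norm_le_abs_re_add_abs_im _).trans ?_
    simp only [Complex.sub_re, Complex.sub_im, chart]
    linarith
  · refine (Complex.norm_le_abs_re_add_abs_im _).trans ?_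
    simp only [Complex.sub_re, Complex.sub_im, chart]
    linarith

lemma sum_fin_three_rotate {M : Type*} [AddCommMonoid M] (x : Fin 3 → M) (j : Fin 3) :
    x 0 + x 1 + x 2 = x j + x (j + 1) + x (j + 2) := by
  fin_cases j
  · rfl
  · change x 0 + x 1 + x 2 = x 1 + x 2 + x 0
    rw [add_comm (x 1 + x 2), add_assoc]
  · change x 0 + x 1 + x 2 = x 2 + x 0 + x 1
    rw [add_comm, add_assoc]

/-- A neighbourhood on which `chart` is a coordinate system. -/
def chartDomain (j : Fin 3) (a : ℂ) (R : ℝ) : Set (Spec κe κm) :=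
  {θ | ‖fieldStrength θ j - a‖ < ‖a‖ / 2 ∧ ∀ k, ‖fieldStrength θ k‖ < R}

lemma isOpen_chartDomain (j : Fin 3) (a : ℂ) (R : ℝ) :
    IsOpen (chartDomain j a R : Set (Spec κe κm)) := by
  have h : ∀ k, Continuous fun θ : Spec κe κm => fieldStrength θ k := fun k =>
    (continuous_fieldStrength k).comp continuous_subtype_val
  refine IsOpen.and ?_ ?_
  · exact isOpen_lt (((h j).sub continuous_const).norm) continuous_const
  · simp only [Set.ofPred_forall]
    exact isOpen_iInter_of_finite fun k => isOpen_lt (h k).norm continuous_const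

/-- Subtracting the quadric equations at the two points factors as `(z_j - z_j')(z_j + z_j')` in
terms of differences of the other two components. Since `z_j + z_j'` stays away from zero, the
remaining component is a Lipschitz function of the chart. -/
lemma dist_le_dist_chart {j : Fin 3} {a : ℂ} {R : ℝ} (ha : a ≠ 0) {θ θ' : Spec κe κm}
    (hθ : θ ∈ chartDomain j a R) (hθ' : θ' ∈ chartDomain j a R) :
    dist θ θ' ≤ (8 + 16 * R / ‖a‖) * dist (chart j θ) (chart j θ') := by
  set D := dist (chart j θ) (chart j θ') with hD
  obtain ⟨h1, h2⟩ := norm_sub_le_dist_chart j (θ : MatSpace) θ'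
  rw [← hD] at h1 h2
  have ha0 : 0 < ‖a‖ := norm_pos_iff.2 ha
  have hsq := (Spec.sum_sq_fieldStrength θ.2).trans (Spec.sum_sq_fieldStrength θ'.2).symm
  rw [sum_fin_three_rotate (fun k => fieldStrength θ k ^ 2) j,
    sum_fin_three_rotate (fun k => fieldStrength θ' k ^ 2) j] at hsq
  have hfac : (fieldStrength θ j - fieldStrength θ' j) * (fieldStrength θ j + fieldStrength θ' j) =
      -((fieldStrength θ (j + 1) - fieldStrength θ' (j + 1)) *
        (fieldStrength θ (j + 1) + fieldStrength θ' (j + 1)) +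
      (fieldStrength θ (j + 2) - fieldStrength θ' (j + 2)) *
        (fieldStrength θ (j + 2) + fieldStrength θ' (j + 2))) := by
    linear_combination hsq
  have hplus : ∀ k, ‖fieldStrength θ k + fieldStrength θ' k‖ ≤ 2 * R := fun k =>
    (norm_add_le _ _).trans (by linarith [(hθ.2 k).le, (hθ'.2 k).le])
  have hR : 0 ≤ R := (norm_nonneg _).trans (hθ.2 j).le
  -- Each summand is within `‖a‖ / 2` of `a`, so the sum is within `‖a‖` of `2a`.
  have hlow : ‖a‖ ≤ ‖fieldStrength θ j + fieldStrength θ' j‖ := by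
    have : ‖2 * a‖ ≤ ‖fieldStrength θ j + fieldStrength θ' j‖ + ‖fieldStrength θ j - a‖ +
        ‖fieldStrength θ' j - a‖ := by
      calc ‖2 * a‖ = ‖(fieldStrength θ j + fieldStrength θ' j) - (fieldStrength θ j - a) -
            (fieldStrength θ' j - a)‖ := by congr 1; ring
        _ ≤ _ := (norm_sub_le _ _).trans (by gcongr; exact norm_sub_le _ _)
    rw [norm_mul, Complex.norm_ofNat] at this
    linarith [hθ.1, hθ'.1]
  have h3 : ‖fieldStrength θ j - fieldStrength θ' j‖ * ‖a‖ ≤ 8 * R * D := by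
    calc ‖fieldStrength θ j - fieldStrength θ' j‖ * ‖a‖
        ≤ ‖fieldStrength θ j - fieldStrength θ' j‖ * ‖fieldStrength θ j + fieldStrength θ' j‖ := by
          gcongr
      _ = ‖(fieldStrength θ (j + 1) - fieldStrength θ' (j + 1)) *
            (fieldStrength θ (j + 1) + fieldStrength θ' (j + 1)) +
          (fieldStrength θ (j + 2) - fieldStrength θ' (j + 2)) *
            (fieldStrength θ (j + 2) + fieldStrength θ' (j + 2))‖ := by
          rw [← norm_mul, hfac, norm_neg]
      _ ≤ 2 * D * (2 * R) + 2 * D * (2 * R) := by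
          refine (norm_add_le _ _).trans ?_
          rw [norm_mul, norm_mul]
          have := hplus (j + 1)
          have := hplus (j + 2)
          gcongr
      _ = 8 * R * D := by ring
  have h4 : ‖fieldStrength θ j - fieldStrength θ' j‖ ≤ 8 * R * D / ‖a‖ := (le_div_iff₀ ha0).2 h3
  have h5 := Spec.dist_le θ.2 θ'.2
  have h6 := sum_fin_three_rotate (fun k => ‖fieldStrength θ k - fieldStrength θ' k‖) j
  rw [h6] at h5
  refine h5.trans ?_
  calc _ ≤ 2 * (8 * R * D / ‖a‖ + 2 * D + 2 * D) := by gcongr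
    _ = _ := by ring

/-- The chart is antilipschitz, so up to a constant the measure is at most that of its image. The
image is a bounded set in `ℝ⁴`, where four-dimensional Hausdorff measure is Lebesgue measure. -/
lemma hausdorffMeasure_chartDomain_lt_top {j : Fin 3} {a : ℂ} {R : ℝ} (ha : a ≠ 0) :
    (μH[(4 : ℕ)] : Measure (Spec κe κm)) (chartDomain j a R) < ⊤ := by
  rcases (chartDomain j a R : Set (Spec κe κm)).eq_empty_or_nonempty with h0 | ⟨θ₀, hθ₀⟩
  · simp [h0]
  have hR : 0 ≤ R := (norm_nonneg _).trans (hθ₀.2 j).le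
  let f : chartDomain (κe := κe) (κm := κm) j a R → Fin 4 → ℝ := fun θ => chart j θ
  have hf : AntilipschitzWith (Real.toNNReal (8 + 16 * R / ‖a‖)) f :=
    AntilipschitzWith.of_le_mul_dist fun θ θ' => by
      rw [Real.coe_toNNReal _ (by positivity)]
      exact dist_le_dist_chart ha θ.2 θ'.2
  have h1 := isometry_subtype_coe.hausdorffMeasure_image (d := ((4 : ℕ) : ℝ)) (Or.inl (by norm_num))
    (Set.univ : Set (chartDomain (κe := κe) (κm := κm) j a R))
  rw [Set.image_univ, Subtype.range_coe] at h1
  rw [h1]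
  refine (hf.le_hausdorffMeasure_image (by norm_num) Set.univ).trans_lt ?_
  refine ENNReal.mul_lt_top (ENNReal.rpow_lt_top_of_nonneg (by norm_num) ENNReal.coe_ne_top) ?_
  have h2 : (μH[(4 : ℕ)] : Measure (Fin 4 → ℝ)) = volume := by
    simpa using hausdorffMeasure_pi_real (ι := Fin 4)
  rw [h2]
  refine (Metric.isBounded_iff_subset_closedBall (0 : Fin 4 → ℝ)).2 ⟨R, ?_⟩ |>.measure_lt_top
  rintro _ ⟨θ, -, rfl⟩
  rw [mem_closedBall_zero_iff, pi_norm_le_iff_of_nonneg hR]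
  have h3 : ∀ k, |(fieldStrength θ k).re| ≤ R ∧ |(fieldStrength θ k).im| ≤ R := fun k =>
    ⟨(Complex.abs_re_le_norm _).trans (θ.2.2 k).le, (Complex.abs_im_le_norm _).trans (θ.2.2 k).le⟩
  intro i
  fin_cases i
  · exact (h3 _).1
  · exact (h3 _).2
  · exact (h3 _).1
  · exact (h3 _).2

/-- The surface measure of `Σ` is locally finite. -/
theorem isLocallyFiniteMeasure_spec (hκ : ¬(κe = 0 ∧ κm = 0)) :
    IsLocallyFiniteMeasure (μHE[4] : Measure (Spec κe κm)) := by
  refine ⟨fun θ => ?_⟩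
  -- This keeps the zero matrix, the vertex of the cone `z₀² + z₁² + z₂² = 0`, off `Σ`: at every
  -- point some component of the field strength is nonzero and provides a chart.
  have hne : ((κe : ℂ) + κm * Complex.I) ^ 2 ≠ 0 := fun h => hκ (by
    have h' := pow_eq_zero_iff (two_ne_zero) |>.1 h
    exact ⟨by simpa using congrArg Complex.re h', by simpa using congrArg Complex.im h'⟩)
  obtain ⟨j, hj⟩ : ∃ j, fieldStrength θ j ≠ 0 := by
    by_contra! h
    apply hne
    rw [← Spec.sum_sq_fieldStrength θ.2, h, h, h]
    norm_num
  refine ⟨chartDomain j (fieldStrength θ j) (∑ k, ‖fieldStrength θ k‖ + 1),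
    (isOpen_chartDomain _ _ _).mem_nhds ⟨?_, fun k => ?_⟩, ?_⟩
  · simpa using hj
  · have := Finset.single_le_sum (f := fun k => ‖fieldStrength θ k‖) (fun _ _ => norm_nonneg _)
      (Finset.mem_univ k)
    linarith
  · rw [Measure.euclideanHausdorffMeasure_def, Measure.smul_apply, ENNReal.smul_def, smul_eq_mul]
    exact ENNReal.mul_lt_top ENNReal.coe_lt_top (hausdorffMeasure_chartDomain_lt_top hj)

end Measure

/-! ### The vectors `Ψ^⊗(𝐠)` -/

section Vectors

variable {κe κm : ℝ} {K : ℕ} {H : Type*} [NormedAddCommGroup H] [InnerProductSpace ℂ H]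
  [CompleteSpace H] (T : Theory K H)

/-- Continuity of slices in `s` together with weak measurability in `θ` gives joint measurability.
-/
lemma stronglyMeasurable_Ψ_slice {g : BigTest κe κm K} (hg : IsBigTest g) (n : ℕ) :
    StronglyMeasurable fun z : Plane × Spec κe κm => T.Ψ n (slice z.1 (g n z.2)) :=
  stronglyMeasurable_uncurry_of_continuous_of_stronglyMeasurable
    (u := fun s θ => T.Ψ n (slice s (g n θ)))
    (fun θ => (T.Ψ n).continuous.comp (continuous_slice (g n θ)))
    (fun s => stronglyMeasurable_clm_plane (g n)
      (fun z => (hg.measurable n z).stronglyMeasurable) ((T.Ψ n).comp (slice s)))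

lemma exists_pow_mul_norm_Ψ_slice_le {g : BigTest κe κm K} (hg : IsBigTest g) (n m : ℕ) :
    ∃ B, ∀ s θ, ‖s‖ ^ m * ‖T.Ψ n (slice s (g n θ))‖ ≤ B := by
  obtain ⟨t, C, hC, h⟩ := exists_bound_clm (T.Ψ n)
  choose B hB using fun a b => hg.bounded n a b
  set t' := t.image fun q => (m + q.1, q.2)
  refine ⟨C * ∑ q ∈ t', |B q.1 q.2|, fun s θ => ?_⟩
  calc ‖s‖ ^ m * ‖T.Ψ n (slice s (g n θ))‖
      ≤ ‖s‖ ^ m * (C * t.sup (schwartzSeminormFamily ℂ _ _) (sliceCLM s (g n θ))) := by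
        gcongr
        exact h _
    _ = C * (‖s‖ ^ m * t.sup (schwartzSeminormFamily ℂ _ _) (sliceCLM s (g n θ))) := by ring
    _ ≤ C * t'.sup (schwartzSeminormFamily ℂ _ _) (g n θ) := by
        gcongr
        exact pow_mul_sup_seminorm_slice_le (g n θ) m t s
    _ ≤ C * ∑ q ∈ t', |B q.1 q.2| := by
        gcongr
        refine Seminorm.finset_sup_apply_le (Finset.sum_nonneg fun _ _ => abs_nonneg _)
          fun q hq => ?_
        refine ((hB q.1 q.2 θ).trans (le_abs_self _)).trans ?_
        exact Finset.single_le_sum (f := fun q : ℕ × ℕ => |B q.1 q.2|) (fun _ _ => abs_nonneg _) hq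

/-- Square integrability over the plane requires a decay exponent above one; three is comfortably
enough. -/
lemma exists_norm_Ψ_slice_le {g : BigTest κe κm K} (hg : IsBigTest g) (n : ℕ) :
    ∃ B, ∀ s θ, ‖T.Ψ n (slice s (g n θ))‖ ≤ B * (1 + ‖s‖) ^ (-3 : ℝ) := by
  obtain ⟨B₀, h₀⟩ := exists_pow_mul_norm_Ψ_slice_le T hg n 0
  obtain ⟨B₃, h₃⟩ := exists_pow_mul_norm_Ψ_slice_le T hg n 3
  refine ⟨4 * (B₀ + B₃), fun s θ => ?_⟩
  have h0 := h₀ s θ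
  have h3 := h₃ s θ
  rw [Real.rpow_neg (by positivity), ← div_eq_mul_inv, le_div_iff₀ (by positivity),
    show (3 : ℝ) = ((3 : ℕ) : ℝ) by norm_num, Real.rpow_natCast]
  have hs := norm_nonneg s
  have h1 : (1 + ‖s‖) ^ 3 ≤ 4 * (‖s‖ ^ 0 + ‖s‖ ^ 3) := by
    rw [pow_zero]
    nlinarith [mul_nonneg (by positivity : 0 ≤ 1 + ‖s‖) (sq_nonneg (1 - ‖s‖))]
  calc ‖T.Ψ n (slice s (g n θ))‖ * (1 + ‖s‖) ^ 3
      ≤ ‖T.Ψ n (slice s (g n θ))‖ * (4 * (‖s‖ ^ 0 + ‖s‖ ^ 3)) := by gcongr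
    _ = 4 * (‖s‖ ^ 0 * ‖T.Ψ n (slice s (g n θ))‖ + ‖s‖ ^ 3 * ‖T.Ψ n (slice s (g n θ))‖) := by ring
    _ ≤ _ := by gcongr

variable [IsLocallyFiniteMeasure (μHE[4] : Measure (Spec κe κm))]

lemma memLp_Ψ_slice {g : BigTest κe κm K} (hg : IsBigTest g) (n : ℕ) :
    MemLp (fun z : Plane × Spec κe κm => T.Ψ n (slice z.1 (g n z.2))) 2 (specMeasure κe κm) := by
  obtain ⟨B, hB⟩ := exists_norm_Ψ_slice_le T hg n
  obtain ⟨C, hC, hgC⟩ := hg.support n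
  have hm := (stronglyMeasurable_Ψ_slice T hg n).aestronglyMeasurable (μ := specMeasure κe κm)
  rw [memLp_two_iff_integrable_sq_norm hm]
  have h1 : Integrable fun s : Plane => (B ^ 2) * (1 + ‖s‖) ^ (-6 : ℝ) :=
    (integrable_one_add_norm (by simp; norm_num)).const_mul _
  have h2 : Integrable (C.indicator fun _ => (1 : ℝ)) (μHE[4] : Measure (Spec κe κm)) :=
    (integrable_indicator_iff hC.measurableSet).2
      (integrableOn_const hC.measure_lt_top.ne)
  refine (h1.mul_prod h2).mono' (hm.norm.pow 2) (.of_forall fun z => ?_)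
  rw [Real.norm_of_nonneg (by positivity)]
  by_cases hz : z.2 ∈ C
  · rw [Set.indicator_of_mem hz, mul_one,
      show (1 + ‖z.1‖) ^ (-6 : ℝ) = ((1 + ‖z.1‖) ^ (-3 : ℝ)) ^ 2 by
        rw [← Real.rpow_natCast, ← Real.rpow_mul (by positivity)]; norm_num, ← mul_pow]
    exact pow_le_pow_left₀ (norm_nonneg _) (hB z.1 z.2) 2
  · rw [hgC _ hz]
    simp [Set.indicator_of_notMem hz]

lemma bigPsi_eq_sum {g : BigTest κe κm K} {N : ℕ} (hN : ∀ n, N ≤ n → g n = 0) :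
    bigPsi T g = fun z => ∑ n ∈ Finset.range N, T.Ψ n (slice z.1 (g n z.2)) := by
  funext z
  refine finsum_eq_sum_of_support_subset _ fun n hn => ?_
  by_contra h
  refine hn ?_
  change T.Ψ n (slice z.1 (g n z.2)) = 0
  rw [hN n (by simpa using h)]
  simp

/-- The vectors `Ψ^⊗(𝐠)` are square integrable. -/
theorem memLp_bigPsi {g : BigTest κe κm K} (hg : IsBigTest g) :
    MemLp (bigPsi T g) 2 (specMeasure κe κm) := by
  obtain ⟨N, hN⟩ := hg.terminating
  rw [bigPsi_eq_sum T hN]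
  exact memLp_finsetSum _ fun n _ => memLp_Ψ_slice T hg n

end Vectors

/-! ### The deformed fields as operators -/

section Operators

variable {κe κm : ℝ} {K : ℕ} {H : Type*} [NormedAddCommGroup H] [InnerProductSpace ℂ H]
  [CompleteSpace H] (T : Theory K H) {Λ : Spec κe κm → Matrix (Fin 4) (Fin 4) ℝ}

lemma IsAction.eq_action {f : Test K} {g h : BigTest κe κm K} (hh : IsAction Λ f g h)
    {χ : 𝓢(MatSpace, ℂ)} {θ : Spec κe κm} (hχ : χ (ofMat (Λ θ)) = 1) (n : ℕ) :
    h (n + 1) θ = action κe κm χ (ofMat (Λ θ)) f n (g n θ) := by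
  refine slice_injective fun s => fourierN_injective fun p k => ?_
  rw [hh.2, fourierN_slice_action κe κm hχ]
  rfl

lemma IsAction.pairing_eq {f : Test K} {g h g' h' : BigTest κe κm K} (hh : IsAction Λ f g h)
    (hh' : IsAction Λ (starTest T.bar f) g' h') (θ : Spec κe κm) (m n : ℕ) :
    pairing (T.Ψ m) (g' m θ) (T.Ψ (n + 1)) (h (n + 1) θ) =
      pairing (T.Ψ (m + 1)) (h' (m + 1) θ) (T.Ψ n) (g n θ) := by
  obtain ⟨χ, hχ⟩ := exists_schwartz_eq_one MatSpace ‖ofMat (Λ θ)‖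
  have h1 := hχ _ le_rfl
  rw [hh.eq_action h1, hh'.eq_action h1, pairing_action κe κm T h1]

variable [IsLocallyFiniteMeasure (μHE[4] : Measure (Spec κe κm))]

lemma integrable_inner_Ψ {g g' : BigTest κe κm K} (hg : IsBigTest g) (hg' : IsBigTest g')
    (m n : ℕ) : Integrable (fun z : Plane × Spec κe κm =>
      ⟪T.Ψ m (slice z.1 (g' m z.2)), T.Ψ n (slice z.1 (g n z.2))⟫_ℂ) (specMeasure κe κm) := by
  have h1 := memLp_Ψ_slice T hg' m
  have h2 := memLp_Ψ_slice T hg n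
  refine (L2.integrable_inner (𝕜 := ℂ) (h1.toLp _) (h2.toLp _)).congr ?_
  filter_upwards [h1.coeFn_toLp, h2.coeFn_toLp] with z e1 e2
  rw [e1, e2]

lemma integral_inner_Ψ {g g' : BigTest κe κm K} (hg : IsBigTest g) (hg' : IsBigTest g')
    (m n : ℕ) : ∫ z, ⟪T.Ψ m (slice z.1 (g' m z.2)), T.Ψ n (slice z.1 (g n z.2))⟫_ℂ
      ∂(specMeasure κe κm) = ∫ θ, pairing (T.Ψ m) (g' m θ) (T.Ψ n) (g n θ) ∂μHE[4] :=
  integral_prod_symm _ (integrable_inner_Ψ T hg hg' m n)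

lemma inner_eq_sum {g g' : BigTest κe κm K} (hg : IsBigTest g) (hg' : IsBigTest g') {M N : ℕ}
    (hN : ∀ n, N ≤ n → g n = 0) (hM : ∀ n, M ≤ n → g' n = 0) {ξ ξ' : BigHilbert κe κm H}
    (hξ : ξ =ᵐ[specMeasure κe κm] bigPsi T g) (hξ' : ξ' =ᵐ[specMeasure κe κm] bigPsi T g') :
    ⟪ξ', ξ⟫_ℂ = ∑ m ∈ Finset.range M, ∑ n ∈ Finset.range N,
      ∫ θ, pairing (T.Ψ m) (g' m θ) (T.Ψ n) (g n θ) ∂μHE[4] := by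
  simp only [← integral_inner_Ψ T hg hg']
  rw [L2.inner_def]
  have h : (fun z => ⟪ξ' z, ξ z⟫_ℂ) =ᵐ[specMeasure κe κm] fun z =>
      ∑ m ∈ Finset.range M, ∑ n ∈ Finset.range N,
        ⟪T.Ψ m (slice z.1 (g' m z.2)), T.Ψ n (slice z.1 (g n z.2))⟫_ℂ := by
    filter_upwards [hξ, hξ'] with z e1 e2
    rw [e1, e2, bigPsi_eq_sum T hN, bigPsi_eq_sum T hM]
    simp only [sum_inner, inner_sum]
    exact Finset.sum_comm
  rw [integral_congr_ae h, integral_finsetSum _ fun m _ => integrable_finsetSum _ fun n _ =>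
    integrable_inner_Ψ T hg hg' m n]
  refine Finset.sum_congr rfl fun m _ => ?_
  exact integral_finsetSum _ fun n _ => integrable_inner_Ψ T hg hg' m n

lemma IsAction.inner_eq {f : Test K} {g h g' h' : BigTest κe κm K} (hg : IsBigTest g)
    (hhb : IsBigTest h) (hh : IsAction Λ f g h) (hg' : IsBigTest g') (hhb' : IsBigTest h')
    (hh' : IsAction Λ (starTest T.bar f) g' h') {ξ η ξ' η' : BigHilbert κe κm H}
    (hξ : ξ =ᵐ[specMeasure κe κm] bigPsi T g) (hη : η =ᵐ[specMeasure κe κm] bigPsi T h)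
    (hξ' : ξ' =ᵐ[specMeasure κe κm] bigPsi T g') (hη' : η' =ᵐ[specMeasure κe κm] bigPsi T h') :
    ⟪ξ', η⟫_ℂ = ⟪η', ξ⟫_ℂ := by
  obtain ⟨N₁, h₁⟩ := hg.terminating
  obtain ⟨N₂, h₂⟩ := hhb.terminating
  obtain ⟨N₃, h₃⟩ := hg'.terminating
  obtain ⟨N₄, h₄⟩ := hhb'.terminating
  -- A common truncation. Since `f ×` raises the degree by one, the images are summed up to `N + 1`;
  -- their degree-zero terms vanish, and shifting the index aligns the two double sums.
  set N := N₁ + N₂ + N₃ + N₄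
  rw [inner_eq_sum T hhb hg' (N := N + 1) (M := N) (fun n hn => h₂ n (by omega))
      (fun n hn => h₃ n (by omega)) hη hξ',
    inner_eq_sum T hg hhb' (N := N) (M := N + 1) (fun n hn => h₁ n (by omega))
      (fun n hn => h₄ n (by omega)) hξ hη']
  have e1 : ∀ m, ∫ θ, pairing (T.Ψ m) (g' m θ) (T.Ψ 0) (h 0 θ) ∂μHE[4] = 0 := fun m => by
    simp [hh.1]
  have e2 : ∀ n, ∫ θ, pairing (T.Ψ 0) (h' 0 θ) (T.Ψ n) (g n θ) ∂μHE[4] = 0 := fun n => by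
    simp [hh'.1, pairing_apply]
  rw [Finset.sum_range_succ' _ N, Finset.sum_eq_zero fun n _ => e2 n, add_zero]
  refine Finset.sum_congr rfl fun m _ => ?_
  rw [Finset.sum_range_succ', e1, add_zero]
  exact Finset.sum_congr rfl fun n _ => by simp only [hh.pairing_eq T hh']

/-- The adjoint relation on the level of graphs. -/
theorem inner_fieldGraph {f : Test K} {ξ ξ' : BigHilbert κe κm H × BigHilbert κe κm H}
    (hξ : ξ ∈ fieldGraph Λ T f) (hξ' : ξ' ∈ fieldGraph Λ T (starTest T.bar f)) :
    ⟪ξ'.1, ξ.2⟫_ℂ = ⟪ξ'.2, ξ.1⟫_ℂ := by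
  induction hξ using Submodule.span_induction with
  | zero => simp
  | add x y _ _ hx hy => simp [inner_add_right, hx, hy]
  | smul c x _ hx => simp [inner_smul_right, hx]
  | mem ξ hξ =>
    obtain ⟨g, h, hg, hhb, hh, e1, e2⟩ := hξ
    induction hξ' using Submodule.span_induction with
    | zero => simp
    | add x y _ _ hx hy => simp [inner_add_left, hx, hy]
    | smul c x _ hx => simp [inner_smul_left, hx]
    | mem ξ' hξ' =>
      obtain ⟨g', h', hg', hhb', hh', e1', e2'⟩ := hξ'
      exact IsAction.inner_eq T hg hhb hh hg' hhb' hh' e1 e2 e1' e2'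

lemma map_fst_fieldGraph (hΛ : IsFrame κe κm Λ) (f : Test K) :
    (fieldGraph Λ T f).map (LinearMap.fst ℂ (BigHilbert κe κm H) (BigHilbert κe κm H)) =
      bigDomain κe κm T := by
  rw [fieldGraph, Submodule.map_span, bigDomain]
  congr 1
  ext ξ
  constructor
  · rintro ⟨η, ⟨g, h, hg, -, -, e, -⟩, rfl⟩
    exact ⟨g, hg, e⟩
  · rintro ⟨g, hg, e⟩
    obtain ⟨h, hhb, hh⟩ := exists_isAction hΛ f hg
    exact ⟨(ξ, (memLp_bigPsi T hhb).toLp _),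
      ⟨g, h, hg, hhb, hh, e, (memLp_bigPsi T hhb).coeFn_toLp⟩, rfl⟩

lemma map_snd_fieldGraph_le (f : Test K) :
    (fieldGraph Λ T f).map (LinearMap.snd ℂ (BigHilbert κe κm H) (BigHilbert κe κm H)) ≤
      bigDomain κe κm T := by
  rw [fieldGraph, Submodule.map_span, bigDomain]
  refine Submodule.span_mono ?_
  rintro _ ⟨η, ⟨g, h, -, hh, -, -, e⟩, rfl⟩
  exact ⟨h, hh, e⟩

/-- The inner product of `ξ.2` with any domain vector equals, by the adjoint relation, an inner
product with `ξ.1 = 0`; density of the domain concludes. -/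
lemma fieldGraph_single_valued (hΛ : IsFrame κe κm Λ)
    (hd : Dense (bigDomain κe κm T : Set (BigHilbert κe κm H))) (f : Test K)
    (ξ : BigHilbert κe κm H × BigHilbert κe κm H) (hξ : ξ ∈ fieldGraph Λ T f) (h0 : ξ.1 = 0) :
    ξ.2 = 0 := by
  refine hd.eq_zero_of_inner_right ℂ fun η hη => ?_
  have hη' : η ∈ bigDomain κe κm T := hη
  rw [← map_fst_fieldGraph T hΛ (starTest T.bar f)] at hη'
  obtain ⟨ξ', hξ', rfl⟩ := hη'
  have := inner_fieldGraph T hξ hξ'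
  rw [h0, inner_zero_right] at this
  exact this

lemma field_domain (hΛ : IsFrame κe κm Λ) (f : Test K) :
    (field Λ T f).domain = bigDomain κe κm T := map_fst_fieldGraph T hΛ f

lemma mem_fieldGraph (hΛ : IsFrame κe κm Λ)
    (hd : Dense (bigDomain κe κm T : Set (BigHilbert κe κm H))) (f : Test K)
    (ξ : (field Λ T f).domain) : ((ξ : BigHilbert κe κm H), field Λ T f ξ) ∈ fieldGraph Λ T f :=
  Submodule.mem_graph_toLinearPMap (fieldGraph_single_valued T hΛ hd f) ξ

lemma field_mem (hΛ : IsFrame κe κm Λ)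
    (hd : Dense (bigDomain κe κm T : Set (BigHilbert κe κm H))) (f : Test K)
    (ξ : (field Λ T f).domain) : field Λ T f ξ ∈ bigDomain κe κm T :=
  map_snd_fieldGraph_le T f ⟨_, mem_fieldGraph T hΛ hd f ξ, rfl⟩

/-- `φ^⊗(f)* ⊃ φ^⊗(f*)`. -/
theorem field_starTest_le_adjoint (hΛ : IsFrame κe κm Λ)
    (hd : Dense (bigDomain κe κm T : Set (BigHilbert κe κm H))) (f : Test K) :
    field Λ T (starTest T.bar f) ≤ (field Λ T f).adjoint := by
  refine LinearPMap.IsFormalAdjoint.le_adjoint ?_ fun x y => ?_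
  · rw [field_domain T hΛ]
    exact hd
  · have h := inner_fieldGraph T (mem_fieldGraph T hΛ hd f x)
      (mem_fieldGraph T hΛ hd (starTest T.bar f) y)
    rw [← inner_conj_symm]
    exact (congrArg (starRingEnd ℂ) h).trans (inner_conj_symm _ _)

/-- The value of the field at a vector `Ψ^⊗(𝐠)`. -/
lemma field_apply (hΛ : IsFrame κe κm Λ)
    (hd : Dense (bigDomain κe κm T : Set (BigHilbert κe κm H))) {f : Test K}
    {g h : BigTest κe κm K} (hg : IsBigTest g) (hhb : IsBigTest h) (hh : IsAction Λ f g h)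
    {ξ η : BigHilbert κe κm H} (hξ : ξ =ᵐ[specMeasure κe κm] bigPsi T g)
    (hη : η =ᵐ[specMeasure κe κm] bigPsi T h) :
    ∃ hξ' : ξ ∈ (field Λ T f).domain, η = field Λ T f ⟨ξ, hξ'⟩ := by
  have hmem : (ξ, η) ∈ fieldGraph Λ T f := Submodule.subset_span ⟨g, h, hg, hhb, hh, hξ, hη⟩
  have hξ' : ξ ∈ (field Λ T f).domain := ⟨_, hmem, rfl⟩
  refine ⟨hξ', ?_⟩
  have h0 := Submodule.sub_mem _ hmem (mem_fieldGraph T hΛ hd f ⟨ξ, hξ'⟩)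
  exact sub_eq_zero.1 (fieldGraph_single_valued T hΛ hd f _ h0 (sub_self _))

end Operators

/-! ### Density -/

section Density

variable {κe κm : ℝ} {K : ℕ}

lemma isClosed_spec : IsClosed (Spec κe κm) := by
  have h : ∀ i j, Continuous fun θ : MatSpace => toMat θ i j := fun i j => by
    simp only [toMat, Matrix.of_apply]
    fun_prop
  have h' : ∀ i j, Continuous fun θ : MatSpace => raise (toMat θ) i j := fun i j =>
    (continuous_const.mul (h i j)).mul continuous_const
  refine IsClosed.and ?_ (IsClosed.and ?_ ?_)
  · refine isClosed_eq ?_ ?_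
    · exact continuous_pi fun i => continuous_pi fun j => h j i
    · exact continuous_pi fun i => continuous_pi fun j => (h i j).neg
  · refine isClosed_eq ?_ continuous_const
    exact continuous_finsetSum _ fun i _ => continuous_finsetSum _ fun j _ => (h i j).mul (h' i j)
  · refine isClosed_eq ?_ continuous_const
    exact continuous_finsetSum _ fun τ _ => continuous_const.mul ((h' _ _).mul (h' _ _))

/-- The inclusion of `ℝ² × Σ` into `ℝ² × ℝ¹⁶`. -/
def specInclusion (z : Plane × Spec κe κm) : Plane × MatSpace := (z.1, z.2)

lemma isClosedEmbedding_specInclusion :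
    Topology.IsClosedEmbedding (specInclusion (κe := κe) (κm := κm)) :=
  Topology.IsClosedEmbedding.id.prodMap isClosed_spec.isClosedEmbedding_subtypeVal

/-- The function `v ⊗ F` as an element of the enlarged test function space. -/
theorem exists_pureTest {v : Plane × Spec κe κm → ℂ} (hv : IsSmoothCompact v) (n : ℕ)
    (F : TestN K n) : ∃ g : BigTest κe κm K, IsBigTest g ∧ (∀ m, m ≠ n → g m = 0) ∧
      ∀ s θ, slice s (g n θ) = v (s, θ) • F := by
  obtain ⟨V, hV, hVc, hvV⟩ := hv
  have hVc' : HasCompactSupport fun z : MatSpace × Plane => V (z.2, z.1) :=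
    hVc.comp_homeomorph (Homeomorph.prodComm MatSpace Plane)
  -- With the matrix variable in front, the fibre over `θ` is a slice of one ambient Schwartz
  -- function, which yields bounds uniform in `θ`.
  let VS : 𝓢(MatSpace × Plane, ℂ) := hVc'.toSchwartzMap (by fun_prop)
  let A : 𝓢(Plane, ℂ) →L[ℂ] 𝓢(Plane × (Fin n → Mink), (Fin n → Fin K) → ℂ) :=
    swapCLM.comp (tensorCLM (ContinuousLinearMap.lsmul ℂ ℂ).flip F)
  let G : Spec κe κm → 𝓢(Plane × (Fin n → Mink), (Fin n → Fin K) → ℂ) := fun θ =>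
    A (sliceCLM (θ : MatSpace) VS)
  have hG : ∀ θ s x, G θ (s, x) = V (s, θ) • F x := fun _ _ _ => rfl
  let g : BigTest κe κm K := Function.update 0 n G
  have hgn : g n = G := Function.update_self ..
  have hgm : ∀ m, m ≠ n → g m = 0 := fun m hm => Function.update_of_ne hm ..
  refine ⟨g, ⟨⟨n + 1, fun m hm => hgm m (by omega)⟩, fun m z => ?_, fun m a b => ?_, fun m => ?_⟩,
    hgm, fun s θ => ?_⟩
  · rcases eq_or_ne m n with rfl | hm
    · rw [hgn]
      have : Continuous fun θ : Spec κe κm => G θ z := by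
        change Continuous fun θ : Spec κe κm => V (z.1, θ) • F z.2
        have := hV.continuous
        fun_prop
      exact this.measurable
    · rw [hgm m hm]
      exact measurable_const
  · rcases eq_or_ne m n with rfl | hm
    · rw [hgn]
      exact bounded_family_map A (fun θ : Spec κe κm => sliceCLM (θ : MatSpace) VS)
        (fun a b => ⟨_, fun θ => seminorm_slice_le VS a b θ⟩) a b
    · rw [hgm m hm]
      exact ⟨0, fun θ => (map_zero _).le⟩
  · rcases eq_or_ne m n with rfl | hm
    · rw [hgn]
      refine ⟨Subtype.val ⁻¹' (Prod.snd '' tsupport V),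
        isClosed_spec.isClosedEmbedding_subtypeVal.isCompact_preimage
          (hVc.image continuous_snd), fun θ hθ => ?_⟩
      ext z : 1
      change V (z.1, θ) • F z.2 = 0
      rw [image_eq_zero_of_notMem_tsupport fun h => hθ ⟨_, h, rfl⟩, zero_smul]
    · exact ⟨∅, isCompact_empty, fun θ _ => by rw [hgm m hm]; rfl⟩
  · rw [hgn]
    ext x : 1
    rw [slice_apply, hG, hvV]
    rfl

variable {H : Type*} [NormedAddCommGroup H] [InnerProductSpace ℂ H] [CompleteSpace H]
  (T : Theory K H)

lemma bigPsi_pureTest {v : Plane × Spec κe κm → ℂ} {n : ℕ} {F : TestN K n} {g : BigTest κe κm K}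
    (hg0 : ∀ m, m ≠ n → g m = 0) (hg : ∀ s θ, slice s (g n θ) = v (s, θ) • F) :
    bigPsi T g = fun z => v z • T.Ψ n F := by
  funext z
  rw [bigPsi, finsum_eq_single _ n fun m hm => by rw [hg0 m hm]; simp, hg, map_smul]

lemma smoothDomain_le : smoothDomain κe κm T ≤ bigDomain κe κm T := by
  refine Submodule.span_mono ?_
  rintro ξ ⟨v, hv, n, F, hξ⟩
  obtain ⟨g, hg, hg0, hgn⟩ := exists_pureTest hv n F
  exact ⟨g, hg, by rw [bigPsi_pureTest T hg0 hgn]; exact hξ⟩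

variable [IsLocallyFiniteMeasure (μHE[4] : Measure (Spec κe κm))]

lemma memLp_smul_Ψ {v : Plane × Spec κe κm → ℂ} (hv : IsSmoothCompact v) (n : ℕ)
    (F : TestN K n) : MemLp (fun z => v z • T.Ψ n F) 2 (specMeasure κe κm) := by
  obtain ⟨g, hg, hg0, hgn⟩ := exists_pureTest hv n F
  rw [← bigPsi_pureTest T hg0 hgn]
  exact memLp_bigPsi T hg

/-- Pushing forward along the closed embedding keeps compact sets of finite measure. It transfers
the density question to a Euclidean space, where smooth test functions determine locally integrable
functions. -/
lemma isLocallyFiniteMeasure_map_specInclusion :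
    IsLocallyFiniteMeasure ((specMeasure κe κm).map specInclusion) := by
  have hι := isClosedEmbedding_specInclusion (κe := κe) (κm := κm)
  have : IsFiniteMeasureOnCompacts (specMeasure κe κm) := by
    unfold specMeasure
    infer_instance
  have : IsFiniteMeasureOnCompacts ((specMeasure κe κm).map specInclusion) := by
    refine ⟨fun C hC => ?_⟩
    rw [hι.measurableEmbedding.map_apply]
    exact (hι.isCompact_preimage hC).measure_lt_top
  infer_instance

/-- The vectors `v ⊗ Ψⁿ(F)` are total. -/
theorem dense_smoothDomain : Dense (smoothDomain κe κm T : Set (BigHilbert κe κm H)) := by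
  rw [Submodule.dense_iff_topologicalClosure_eq_top, Submodule.topologicalClosure_eq_top_iff,
    Submodule.eq_bot_iff]
  intro ξ hξ
  have hι := (isClosedEmbedding_specInclusion (κe := κe) (κm := κm))
  have hloc := isLocallyFiniteMeasure_map_specInclusion (κe := κe) (κm := κm)
  set ν := (specMeasure κe κm).map specInclusion
  -- The extension by zero is immaterial, since `ν` is concentrated on the image of the inclusion.
  let ξ' : Plane × MatSpace → H := Function.extend specInclusion ξ 0
  have hξ' : ∀ z, ξ' (specInclusion z) = ξ z := fun z => hι.injective.extend_apply _ _ z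
  have hmem : MemLp ξ' 2 ν := by
    rw [hι.measurableEmbedding.memLp_map_measure_iff]
    refine (Lp.memLp ξ).ae_eq (.of_forall fun z => (hξ' z).symm)
  have hlocint : LocallyIntegrable ξ' ν := hmem.locallyIntegrable (by norm_num)
  have key := ae_eq_zero_of_integral_contDiff_smul_eq_zero hlocint fun w hw hwc => ?_
  · rw [hι.measurableEmbedding.ae_map_iff] at key
    refine (Lp.eq_zero_iff_ae_eq_zero).2 ?_
    filter_upwards [key] with z hz
    rw [← hξ', hz]
    rfl
  · have hint : Integrable (fun z => w z • ξ' z) ν :=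
      hlocint.integrable_smul_left_of_hasCompactSupport hw.continuous hwc
    rw [hι.measurableEmbedding.integral_map]
    have hint' := hι.measurableEmbedding.integrable_map_iff.1 hint
    simp only [Function.comp_def, hξ'] at hint' ⊢
    have hv : IsSmoothCompact (κe := κe) (κm := κm) fun z => ((w (specInclusion z) : ℝ) : ℂ) :=
      ⟨fun z => (w z : ℂ), Complex.ofRealCLM.contDiff.comp hw,
        hwc.comp_left Complex.ofReal_zero, fun s θ => rfl⟩
    -- The integral is an element of `H`. Its inner product with `Ψⁿ(F)` is that of `ξ` with `w ⊗
    -- Ψⁿ(F)`, which vanishes by orthogonality, and such vectors span a dense subspace.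
    refine T.D_dense.eq_zero_of_inner_right ℂ fun η hη => ?_
    have hη' : η ∈ T.D := hη
    rw [T.D_eq] at hη'
    induction hη' using Submodule.span_induction with
    | zero => simp
    | add x y hx hy ex ey =>
      rw [inner_add_left, ex (by rw [T.D_eq]; exact hx) , ey (by rw [T.D_eq]; exact hy), add_zero]
    | smul c x hx ex => rw [inner_smul_left, ex (by rw [T.D_eq]; exact hx), mul_zero]
    | mem x hx =>
      obtain ⟨n, F, rfl⟩ := hx
      have hm := memLp_smul_Ψ T hv n F
      have h0 := hξ (hm.toLp _) (Submodule.subset_span ⟨_, hv, n, F, hm.coeFn_toLp⟩)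
      rw [L2.inner_def] at h0
      rw [← integral_inner hint', ← h0]
      refine integral_congr_ae ?_
      filter_upwards [hm.coeFn_toLp] with z hz
      rw [hz, inner_smul_left, Complex.conj_ofReal, ← inner_smul_right]
      rfl

lemma dense_bigDomain : Dense (bigDomain κe κm T : Set (BigHilbert κe κm H)) :=
  (dense_smoothDomain T).mono (smoothDomain_le T)

end Density

/-! ### Translations and multipliers in the total momentum -/

section Convolution

variable {n : ℕ} {V : Type} [NormedAddCommGroup V] [NormedSpace ℂ V]

/-- The map `(y, x) ↦ (y, x₁ - y, …, xₙ - y)`. -/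
def translateCLE (n : ℕ) : (Mink × (Fin n → Mink)) ≃L[ℝ] Mink × (Fin n → Mink) :=
  LinearEquiv.toContinuousLinearEquiv
    { toFun := fun z => (z.1, z.2 - fun _ => z.1)
      map_add' := fun z w => by ext <;> simp; ring
      map_smul' := fun c z => by ext <;> simp; ring
      invFun := fun z => (z.1, z.2 + fun _ => z.1)
      left_inv := fun z => by simp
      right_inv := fun z => by simp }

/-- The average `∫ dy c(y) F(x₁ - y, …, xₙ - y)` over translations. -/
def translationAverage (c : 𝓢(Mink, ℂ)) (F : 𝓢(Fin n → Mink, V)) : 𝓢(Fin n → Mink, V) :=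
  integrateCLM (SchwartzMap.compCLMOfContinuousLinearEquiv ℂ (translateCLE n) (smulTensor c F))

lemma clm_translationAverage [CompleteSpace V] {H : Type*} [NormedAddCommGroup H] [NormedSpace ℂ H]
    [CompleteSpace H] (W : 𝓢(Fin n → Mink, V) →L[ℂ] H) (c : 𝓢(Mink, ℂ))
    (F : 𝓢(Fin n → Mink, V)) : W (translationAverage c F) =
      ∫ y, c y • W (SchwartzMap.compSubConstCLM ℂ (fun _ => y) F) := by
  rw [translationAverage, clm_integrate]
  refine integral_congr_ae (.of_forall fun y => ?_)
  simp only
  rw [← map_smul]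
  rfl

lemma mdot_add_right (p x y : Mink) : mdot p (x + y) = mdot p x + mdot p y := by
  simp only [mdot, ← Finset.sum_add_distrib]
  exact Finset.sum_congr rfl fun μ _ => by simp; ring

lemma mdot_sum_left (p : Fin n → Mink) (y : Mink) : mdot (∑ j, p j) y = ∑ j, mdot (p j) y := by
  simp only [mdot]
  rw [Finset.sum_comm]
  refine Finset.sum_congr rfl fun μ _ => ?_
  rw [WithLp.ofLp_sum, Finset.sum_apply, Finset.mul_sum, Finset.sum_mul]

lemma ftN_translate (F : 𝓢(Fin n → Mink, V)) (y : Mink) (p : Fin n → Mink) :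
    ftN n (SchwartzMap.compSubConstCLM ℂ (fun _ => y) F) p =
      Complex.exp (-Complex.I * (mdot (∑ j, p j) y : ℝ)) • ftN n F p := by
  rw [ftN_apply, ftN_apply, smul_comm (Complex.exp _)]
  congr 1
  rw [← integral_smul]
  rw [← integral_add_right_eq_self (fun x : Fin n → Mink =>
    Complex.exp (-Complex.I * (∑ j, mdot (p j) (x j) : ℝ)) •
      SchwartzMap.compSubConstCLM ℂ (fun _ => y) F x) (fun _ : Fin n => y)]
  refine integral_congr_ae (.of_forall fun x => ?_)
  simp only [SchwartzMap.compSubConstCLM_apply, add_sub_cancel_right, Pi.add_apply, mdot_add_right,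
    smul_smul, ← Complex.exp_add, mdot_sum_left, Finset.sum_add_distrib]
  congr 2
  push_cast
  ring

/-- A common translation multiplies the transform by a character of the total momentum; averaging
turns this into multiplication by the transform of `c` there. -/
lemma ftN_translationAverage [CompleteSpace V] (c : 𝓢(Mink, ℂ)) (F : 𝓢(Fin n → Mink, V))
    (p : Fin n → Mink) : ftN n (translationAverage c F) p =
      (((2 * Real.pi) ^ 2 : ℝ) * ft c (∑ j, p j) : ℂ) • ftN n F p := by
  have h := clm_translationAverage ((evalCLM p).comp (ftN n)) c F
  refine h.trans ?_
  have h2 : ((2 * Real.pi) ^ 2 : ℝ) * ft c (∑ j, p j) =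
      ∫ y, Complex.exp (-Complex.I * (mdot (∑ j, p j) y : ℝ)) * c y := by
    rw [ft_apply, smul_eq_mul, ← mul_assoc, ← Complex.ofReal_mul,
      mul_inv_cancel₀ (by positivity), Complex.ofReal_one, one_mul]
    rfl
  rw [h2, ← integral_smul_const]
  refine integral_congr_ae (.of_forall fun y => ?_)
  change c y • ftN n (SchwartzMap.compSubConstCLM ℂ (fun _ => y) F) p = _
  rw [ftN_translate, smul_smul, mul_comm]

variable {K : ℕ} {H : Type*} [NormedAddCommGroup H] [InnerProductSpace ℂ H]
  [CompleteSpace H] (T : Theory K H)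

lemma mdot_zero_left (x : Mink) : mdot 0 x = 0 := by simp [mdot]

lemma Theory.npoint_translationAverage (c : 𝓢(Mink, ℂ)) (F : TestN K n) :
    T.npoint n (translationAverage c F) = ((2 * Real.pi) ^ 2 : ℝ) * ft c 0 * T.npoint n F := by
  have h := clm_translationAverage ((innerSL ℂ T.Ω).comp (T.Ψ n)) c F
  refine h.trans ?_
  have h2 : ((2 * Real.pi) ^ 2 : ℝ) * ft c 0 = ∫ y, c y := by
    rw [ft_apply, smul_eq_mul, ← mul_assoc, ← Complex.ofReal_mul,
      mul_inv_cancel₀ (by positivity), Complex.ofReal_one, one_mul]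
    simp [mdot_zero_left]
  rw [h2, ← integral_mul_const]
  refine integral_congr_ae (.of_forall fun y => ?_)
  change c y • T.npoint n (SchwartzMap.compSubConstCLM ℂ (fun _ => y) F) = _
  rw [T.npoint_translate, smul_eq_mul]

/-- By translation invariance, the `n`-point functions are supported at total momentum zero. -/
theorem Theory.npoint_eq_of_fourierN_eq (F G : TestN K n) {m : Mink → ℂ}
    (hm : m.HasTemperateGrowth) (h : ∀ p k, fourierN G p k = m (∑ j, p j) * fourierN F p k) :
    T.npoint n G = m 0 * T.npoint n F := by
  -- The multiplier `m` need not be Schwartz, so it is cut off by `χ` with `χ 0 = 1`. Averaging `G`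
  -- with the weight of transform `χ` and `F` with that of transform `m χ` gives the same function;
  -- comparing `n`-point functions leaves only the values at zero.
  obtain ⟨χ, hχ⟩ := exists_schwartz_eq_one Mink 0
  have h0 : χ 0 = 1 := hχ 0 (by simp)
  have hift : ∀ a : 𝓢(Mink, ℂ), ∃ c : 𝓢(Mink, ℂ), ft c = a := fun a =>
    -- The plane is a dummy parameter: `pift` acts on functions with a parameter, and the scalar
    -- factor is one at the slice taken.
    ⟨sliceCLM (0 : Plane) (pift (SchwartzMap.compCLMOfContinuousLinearEquiv ℂ
      (ContinuousLinearEquiv.refl ℝ _) (smulTensor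
        (exists_schwartz_eq_one Plane 0).choose a))), by
      rw [ft_slice_pift]
      ext x
      change (exists_schwartz_eq_one Plane 0).choose 0 • a x = a x
      rw [(exists_schwartz_eq_one Plane 0).choose_spec 0 (by simp), one_smul]⟩
  obtain ⟨c₁, hc₁⟩ := hift χ
  obtain ⟨c₂, hc₂⟩ := hift (SchwartzMap.smulLeftCLM ℂ m χ)
  have heq : translationAverage c₁ G = translationAverage c₂ F := by
    refine fourierN_injective fun p k => ?_
    have e := h p k
    rw [fourierN_eq, fourierN_eq] at e
    rw [fourierN_eq, fourierN_eq, ftN_translationAverage, ftN_translationAverage, hc₁, hc₂,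
      SchwartzMap.smulLeftCLM_apply_apply hm, Pi.smul_apply, Pi.smul_apply, e]
    simp only [smul_eq_mul]
    ring
  have h1 := T.npoint_translationAverage c₁ G
  have h2 := T.npoint_translationAverage c₂ F
  rw [heq, h2, hc₁, hc₂, SchwartzMap.smulLeftCLM_apply_apply hm, h0] at h1
  have hpi : ((((2 * Real.pi) ^ 2 : ℝ)) : ℂ) ≠ 0 := by
    exact_mod_cast (by positivity : (2 * Real.pi) ^ 2 ≠ 0)
  apply mul_left_cancel₀ hpi
  simp only [smul_eq_mul, mul_one] at h1
  linear_combination -h1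

end Convolution

/-! ### Products of Weyl operators -/

section Weyl

variable {κe κm : ℝ} {L : Matrix (Fin 4) (Fin 4) ℝ} {θ : Matrix (Fin 4) (Fin 4) ℝ}

lemma coeff_add (L : Matrix (Fin 4) (Fin 4) ℝ) (p q : Mink) (ν : Fin 4) :
    coeff L (p + q) ν = coeff L p ν + coeff L q ν := by
  simp only [coeff, ← Finset.sum_add_distrib]
  exact Finset.sum_congr rfl fun μ _ => by simp; ring

lemma shift_add (p q : Mink) : shift κe κm L (p + q) = shift κe κm L p + shift κe κm L q := by
  ext i
  fin_cases i <;> simp [shift, coeff_add] <;> ring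

lemma twist_eq_coeff (h : L * thetaRef κe κm * L.transpose = θ) (p q : Mink) :
    twist θ p q = κe * (coeff L p 0 * coeff L q 1 - coeff L p 1 * coeff L q 0) +
      κm * (coeff L p 2 * coeff L q 3 - coeff L p 3 * coeff L q 2) := by
  subst h
  simp only [twist, coeff, Matrix.mul_apply, Matrix.transpose_apply, thetaRef, Fin.sum_univ_four]
  simp
  ring

/-- The Weyl relations. -/
lemma weyl_weyl (h : L * thetaRef κe κm * L.transpose = θ) (p q : Mink) (w : Plane → ℂ) (c : ℂ)
    (s : Plane) : weyl κe κm L p (fun s' => c * weyl κe κm L q w s') s =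
      c * Complex.exp (-(Complex.I / 2) * (twist θ p q : ℝ)) * weyl κe κm L (p + q) w s := by
  have e : Complex.exp (Complex.I * (weylPhase κe κm L p s : ℂ)) *
      Complex.exp (Complex.I * (weylPhase κe κm L q (s + shift κe κm L p) : ℂ)) =
      Complex.exp (-(Complex.I / 2) * (twist θ p q : ℝ)) *
        Complex.exp (Complex.I * (weylPhase κe κm L (p + q) s : ℂ)) := by
    rw [← Complex.exp_add, ← Complex.exp_add, twist_eq_coeff h]
    congr 1
    simp only [weylPhase, coeff_add, shift]
    simp
    ring
  rw [weyl_eq, weyl_eq, weyl_eq, shift_add, ← add_assoc]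
  linear_combination c * w (s + shift κe κm L p + shift κe κm L q) * e

lemma twist_sum_right {n : ℕ} (θ : Matrix (Fin 4) (Fin 4) ℝ) (p : Mink) (q : Fin n → Mink) :
    twist θ p (∑ j, q j) = ∑ j, twist θ p (q j) := by
  refine map_sum (AddMonoidHom.mk' (twist θ p) fun q q' => ?_) q Finset.univ
  simp only [twist, ← Finset.sum_add_distrib]
  exact Finset.sum_congr rfl fun μ _ => Finset.sum_congr rfl fun ν _ => by simp; ring

/-- The phase factor of a product of Weyl operators. -/
def twistFactor (θ : Matrix (Fin 4) (Fin 4) ℝ) {n : ℕ} (p : Fin n → Mink) : ℂ :=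
  ∏ l, ∏ r ∈ Finset.Ioi l, Complex.exp (-(Complex.I / 2) * (twist θ (p l) (p r) : ℝ))

/-- By bilinearity the pairs containing the first index combine into a twist with the total momentum
of the others, the form in which the Weyl relation delivers it. -/
lemma twistFactor_succ (θ : Matrix (Fin 4) (Fin 4) ℝ) {n : ℕ} (p : Fin (n + 1) → Mink) :
    twistFactor θ p = Complex.exp (-(Complex.I / 2) * (twist θ (p 0) (∑ j, Fin.tail p j) : ℝ)) *
      twistFactor θ (Fin.tail p) := by
  rw [twistFactor, Fin.prod_univ_succ, twistFactor]
  congr 1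
  · rw [Fin.prod_Ioi_zero, ← Complex.exp_sum, twist_sum_right, ← Finset.mul_sum]
    push_cast
    rfl
  · exact Finset.prod_congr rfl fun l _ => Fin.prod_Ioi_succ _ l

/-- The test functions with twisted products as Fourier transforms exist. -/
lemma exists_isTwistedProduct {K n : ℕ} (θ : Matrix (Fin 4) (Fin 4) ℝ) (f : Fin n → Test K) :
    ∃ F : TestN K n, IsTwistedProduct θ f F := by
  obtain ⟨F₀, hF₀⟩ := exists_isTensor fun j => ft (f j)
  -- The total phase is a real quadratic polynomial, so its exponential is a multiplier of temperate
  -- growth.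
  let Q : (Fin n → Mink) → ℝ := fun p => ∑ l, ∑ r ∈ Finset.Ioi l, -(1 / 2) * twist θ (p l) (p r)
  have hproj : ∀ j : Fin n, (fun p : Fin n → Mink => p j).HasTemperateGrowth := fun j =>
    (ContinuousLinearMap.proj (R := ℝ) (φ := fun _ : Fin n => Mink) j).hasTemperateGrowth
  have hQ : Q.HasTemperateGrowth := by
    refine Function.HasTemperateGrowth.sum fun l _ => Function.HasTemperateGrowth.sum fun r _ => ?_
    refine (Function.HasTemperateGrowth.const _).mul ?_
    have h1 := fun μ => hasTemperateGrowth_coord (hproj l) μ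
    have h2 := fun ν => hasTemperateGrowth_coord (hproj r) ν
    unfold twist
    refine Function.HasTemperateGrowth.sum fun μ _ => Function.HasTemperateGrowth.sum fun ν _ => ?_
    exact (((Function.HasTemperateGrowth.const _).mul (h1 μ)).mul
      (Function.HasTemperateGrowth.const _)).mul ((Function.HasTemperateGrowth.const _).mul (h2 ν))
  have hexp : (fun p => Complex.exp (Complex.I * (Q p : ℂ))).HasTemperateGrowth := by fun_prop
  refine ⟨iftN n (SchwartzMap.smulLeftCLM _ (fun p => Complex.exp (Complex.I * (Q p : ℂ))) F₀),
    fun p k => ?_⟩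
  rw [fourierN_eq, ftN_iftN, SchwartzMap.smulLeftCLM_apply_apply hexp, Pi.smul_apply, hF₀,
    smul_eq_mul, mul_comm]
  simp only [fourier_eq]
  congr 1
  simp only [← Complex.exp_sum]
  congr 1
  simp only [Q, ← Finset.mul_sum]
  push_cast
  ring

end Weyl

/-! ### Expectation values of products of deformed fields -/

section Products

variable {κe κm : ℝ} {K : ℕ} {H : Type*} [NormedAddCommGroup H] [InnerProductSpace ℂ H]
  [CompleteSpace H] (T : Theory K H) {Λ : Spec κe κm → Matrix (Fin 4) (Fin 4) ℝ}

lemma IsAction.eq_zero {f : Test K} {g h : BigTest κe κm K} (hh : IsAction Λ f g h) {n : ℕ}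
    (hg : g n = 0) : h (n + 1) = 0 := by
  funext θ
  refine slice_injective fun s => fourierN_injective fun p k => ?_
  rw [hh.2, hg]
  simp [fourierN_zero, weyl_zero_fun]

variable [IsLocallyFiniteMeasure (μHE[4] : Measure (Spec κe κm))]

/-- The vector `φ^⊗(f₁) ⋯ φ^⊗(fₙ) (v ⊗ Ω)` in terms of test functions. -/
theorem exists_isFieldProduct (hΛ : IsFrame κe κm Λ) {v : Plane × Spec κe κm → ℂ}
    {g : BigTest κe κm K} (hg : IsBigTest g) (hg0 : ∀ m, m ≠ 0 → g m = 0)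
    (hgv : ∀ s θ, slice s (g 0 θ) = v (s, θ) • constZero fun _ => 1) {ξ : BigHilbert κe κm H}
    (hξ : ξ =ᵐ[specMeasure κe κm] bigPsi T g) : ∀ (n : ℕ) (f : Fin n → Test K),
    ∃ (h : BigTest κe κm K) (ζ : BigHilbert κe κm H), IsBigTest h ∧ (∀ m, m ≠ n → h m = 0) ∧
      ζ =ᵐ[specMeasure κe κm] bigPsi T h ∧ IsFieldProduct Λ T (List.ofFn f) ξ ζ ∧
      ∀ s θ p k, fourierN (slice s (h n θ)) p k = (∏ j, fourier (f j) (p j) (k j)) *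
        twistFactor (toMat θ) p * weyl κe κm (Λ θ) (∑ j, p j) (fun s' => v (s', θ)) s := by
  intro n
  induction n with
  | zero =>
    intro f
    refine ⟨g, ξ, hg, hg0, hξ, rfl, fun s θ p k => ?_⟩
    have h0 : weyl κe κm (Λ θ) 0 (fun s' => v (s', θ)) s = v (s, θ) := by
      simpa using congrFun (weyl_zero κe κm (Λ θ) 0 fun s' => v (s', θ)) s
    simp only [Finset.univ_eq_empty, Finset.prod_empty, Finset.sum_empty, twistFactor, one_mul, h0]
    rw [hgv, fourierN]
    -- In degree zero the Fourier integral runs over a single point of mass one.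
    have hvol : (volume : Measure (Fin 0 → Mink)).real Set.univ = 1 := by
      rw [volume_pi, Measure.pi_of_empty]
      simp [Measure.real]
    simp [constZero_apply, integral_unique, hvol]
  | succ n ih =>
    intro f
    obtain ⟨h, ζ, hb, hz, hζ, hprod, hF⟩ := ih (Fin.tail f)
    obtain ⟨h', hb', hh'⟩ := exists_isAction hΛ (f 0) hb
    have hm := memLp_bigPsi T hb'
    obtain ⟨hdom, heq⟩ := field_apply T hΛ (dense_bigDomain T) hb hb' hh' hζ hm.coeFn_toLp
    refine ⟨h', hm.toLp _, hb', fun m hmn => ?_, hm.coeFn_toLp, ?_, fun s θ p k => ?_⟩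
    · cases m with
      | zero => exact hh'.1
      | succ m => exact hh'.eq_zero (hz m (by omega))
    · rw [List.ofFn_succ]
      exact ⟨ζ, hprod, hdom, heq⟩
    · rw [hh'.2]
      simp only [hF]
      -- The new Weyl operator meets one at the total momentum of the earlier fields; the scalar
      -- factors do not depend on `s` and pass through it.
      rw [weyl_weyl (hΛ.conj θ), Fin.prod_univ_succ, twistFactor_succ, Fin.sum_univ_succ]
      simp only [Fin.tail]
      ring

lemma exists_schwartz_section {v : Plane × Spec κe κm → ℂ} (hv : IsSmoothCompact v)
    (θ : Spec κe κm) : ∃ u : 𝓢(Plane, ℂ), ∀ s, u s = v (s, θ) := by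
  obtain ⟨V, hV, hVc, hvV⟩ := hv
  exact ⟨sliceCLM (θ : MatSpace) (swapCLM (hVc.toSchwartzMap hV)), fun s => (hvV s θ).symm⟩

/-- The two transforms differ by `(e^{iP·X} v)(s)`, a temperate function of the total momentum `P`
alone. Only its value at `P = 0`, which is `v (s, θ)`, survives in a translation-invariant
functional. -/
lemma npoint_slice_eq {v : Plane × Spec κe κm → ℂ} (hv : IsSmoothCompact v) {n : ℕ}
    {f : Fin n → Test K} {θ : Spec κe κm} {s : Plane} {F G : TestN K n}
    (hF : IsTwistedProduct (toMat θ) f F)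
    (hG : ∀ p k, fourierN G p k = (∏ j, fourier (f j) (p j) (k j)) *
        twistFactor (toMat θ) p * weyl κe κm (Λ θ) (∑ j, p j) (fun s' => v (s', θ)) s) :
    T.npoint n G = v (s, θ) * T.npoint n F := by
  obtain ⟨u, hu⟩ := exists_schwartz_section hv θ
  have hm : (fun P => weyl κe κm (Λ θ) P (fun s' => v (s', θ)) s).HasTemperateGrowth := by
    simp only [← hu, weyl_eq]
    refine Function.HasTemperateGrowth.mul ?_ (u.hasTemperateGrowth.comp ?_)
    · exact hasTemperateGrowth_cexp_I_mul (hasTemperateGrowth_weylPhase κe κm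
        (f := fun _ => ofMat (Λ θ)) (by fun_prop) (by fun_prop) (by fun_prop))
    · exact (Function.HasTemperateGrowth.const s).add (hasTemperateGrowth_shift κe κm
        (f := fun _ => ofMat (Λ θ)) (g := fun P => P) (by fun_prop) (by fun_prop))
  have h0 : weyl κe κm (Λ θ) 0 (fun s' => v (s', θ)) s = v (s, θ) := by
    simpa using congrFun (weyl_zero κe κm (Λ θ) 0 fun s' => v (s', θ)) s
  rw [← h0]
  refine T.npoint_eq_of_fourierN_eq F G hm fun p k => ?_
  rw [hG, hF]
  exact mul_comm _ _

/-- The expectation values of products of the deformed fields. -/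
theorem exists_expectation (hΛ : IsFrame κe κm Λ) {v : Plane × Spec κe κm → ℂ}
    (hv : IsSmoothCompact v) : ∃ hv : MemLp (fun z => v z • T.Ω) 2 (specMeasure κe κm),
        ∀ (n : ℕ) (f : Fin n → Test K),
          ∃ (ζ : BigHilbert κe κm H) (F : Spec κe κm → TestN K n),
            IsFieldProduct Λ T (List.ofFn f) (hv.toLp _) ζ ∧
            (∀ θ : Spec κe κm, IsTwistedProduct (toMat θ) f (F θ)) ∧
            Integrable (fun z => T.npoint n (F z.2) * (‖v z‖ ^ 2 : ℝ)) (specMeasure κe κm) ∧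
            inner ℂ (hv.toLp _) ζ =
              ∫ z, T.npoint n (F z.2) * (‖v z‖ ^ 2 : ℝ) ∂(specMeasure κe κm) := by
  have hΩ : T.Ψ 0 (constZero fun _ => 1) = T.Ω := by
    rw [T.Ψ_zero, constZero_apply, one_smul]
  have hm := memLp_smul_Ψ T hv 0 (constZero fun _ => 1)
  obtain ⟨g, hg, hg0, hgv⟩ := exists_pureTest (K := K) hv 0 (constZero fun _ => 1)
  have hgΨ := bigPsi_pureTest T hg0 hgv
  rw [hΩ] at hm hgΨ
  refine ⟨hm, fun n f => ?_⟩
  obtain ⟨h, ζ, hb, hz, hζ, hprod, hF⟩ := exists_isFieldProduct T hΛ hg hg0 hgv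
    (ξ := hm.toLp _) (by rw [hgΨ]; exact hm.coeFn_toLp) n f
  choose F hFθ using fun θ : Spec κe κm => exists_isTwistedProduct (toMat θ) f
  have hae : (fun z => ⟪hm.toLp _ z, ζ z⟫_ℂ) =ᵐ[specMeasure κe κm]
      fun z => T.npoint n (F z.2) * (‖v z‖ ^ 2 : ℝ) := by
    filter_upwards [hm.coeFn_toLp, hζ] with z e1 e2
    rw [e1, e2, bigPsi, finsum_eq_single _ n fun m hmn => by rw [hz m hmn]; simp, inner_smul_left]
    have e3 := npoint_slice_eq T hv (hFθ z.2) (hF z.1 z.2)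
    change _ * T.npoint n (slice z.1 (h n z.2)) = _
    rw [e3, ← mul_assoc, mul_comm ((starRingEnd ℂ) (v z)), Complex.mul_conj,
      Complex.normSq_eq_norm_sq, mul_comm]
  exact ⟨ζ, F, hprod, hFθ, (L2.integrable_inner (𝕜 := ℂ) _ _).congr hae,
    (L2.inner_def _ _).trans (integral_congr_ae hae)⟩

end Products

end WeylWigner

end

open WeylWigner in
theorem mainTheorem9 {K : ℕ} {H : Type*} [NormedAddCommGroup H] [InnerProductSpace ℂ H]
    [CompleteSpace H] [TopologicalSpace.SeparableSpace H] (T : Theory K H)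
    (κe κm : ℝ) (hκ : ¬(κe = 0 ∧ κm = 0))
    (Λ : Spec κe κm → Matrix (Fin 4) (Fin 4) ℝ) (hΛ : IsFrame κe κm Λ) :
    -- vectors `Ψ^⊗(𝐠)` are in the Hilbert space, and `f × 𝐠` stays in the test function space
    (∀ g : BigTest κe κm K, IsBigTest g → MemLp (bigPsi T g) 2 (specMeasure κe κm)) ∧
    (∀ (f : Test K) (g : BigTest κe κm K), IsBigTest g →
      ∃! h : BigTest κe κm K, IsBigTest h ∧ IsAction Λ f g h) ∧
    -- density of the domain
    smoothDomain κe κm T ≤ bigDomain κe κm T ∧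
    Dense (smoothDomain κe κm T : Set (BigHilbert κe κm H)) ∧
    Dense (bigDomain κe κm T : Set (BigHilbert κe κm H)) ∧
    -- the fields are well defined on the domain and leave it invariant
    (∀ f : Test K,
      (∀ ξ ∈ fieldGraph Λ T f, ξ.1 = 0 → ξ.2 = 0) ∧
      (field Λ T f).domain = bigDomain κe κm T ∧
      ∀ ξ : (field Λ T f).domain, field Λ T f ξ ∈ bigDomain κe κm T) ∧
    -- adjoints
    (∀ f : Test K, field Λ T (starTest T.bar f) ≤ (field Λ T f).adjoint) ∧
    -- expectation values
    (∀ v : Plane × Spec κe κm → ℂ, IsSmoothCompact v →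
      ∃ hv : MemLp (fun z => v z • T.Ω) 2 (specMeasure κe κm),
        ∀ (n : ℕ) (f : Fin n → Test K),
          ∃ (ζ : BigHilbert κe κm H) (F : Spec κe κm → TestN K n),
            IsFieldProduct Λ T (List.ofFn f) (hv.toLp _) ζ ∧
            (∀ θ : Spec κe κm, IsTwistedProduct (toMat θ) f (F θ)) ∧
            Integrable (fun z => T.npoint n (F z.2) * (‖v z‖ ^ 2 : ℝ)) (specMeasure κe κm) ∧
            inner ℂ (hv.toLp _) ζ =
              ∫ z, T.npoint n (F z.2) * (‖v z‖ ^ 2 : ℝ) ∂(specMeasure κe κm)) := by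
  have := isLocallyFiniteMeasure_spec hκ
  have hd := dense_bigDomain (κe := κe) (κm := κm) T
  refine ⟨fun g hg => memLp_bigPsi T hg, fun f g hg => ?_, smoothDomain_le T, dense_smoothDomain T,
    hd, fun f => ⟨fieldGraph_single_valued T hΛ hd f, field_domain T hΛ f, field_mem T hΛ hd f⟩,
    field_starTest_le_adjoint T hΛ hd, fun v hv => exists_expectation T hΛ hv⟩
  obtain ⟨h, hh, ha⟩ := exists_isAction hΛ f hg
  exact ⟨h, ⟨hh, ha⟩, fun h' hh' => hh'.2.unique ha⟩
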